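/- Let $N\ge 1$, let $S=\{z\in\mathbb{R}^N:|z|=1\}$ be the Euclidean unit sphere, and let $\nu$ be a (Borel) probability measure on $S$. For $v\ge 0$ let $$g(z)=v\sum_{p\ge 1}2^{-p}x_p\,g_p(z),\qquad g_p(z)=\sum_{1\le i_1,\dots,i_p\le N}g_{i_1,\dots,i_p}\,z_{i_1}\cdots z_{i_p},\qquad z\in S,$$ where the $x_p$ ($p\ge 1$) are i.i.d. uniform on $[0,1]$ and, independently of them, the $g_{i_1,\dots,i_p}$ (all $p\ge 1$ and all $i_1,\dots,i_p$) are i.i.d. standard Gaussian. Let $\nu_g$ be the random probability measure on $S$ with $\dfrac{d\nu_g}{d\nu}=\dfrac{e^{g}}{\int e^{g}\,d\nu}$, and for a function $F$ of $m$ points $z^1,\dots,z^m\in S$ let $\langle F\rangle$ be its average with respect to $\nu_g^{\otimes m}$. Let $\mathbb{E}_g$ and $\mathbb{E}_x$ denote expectation in the Gaussian variables (with $(x_p)$ fixed) and in the uniform variables, respectively. **Theorem 2 (Ghirlanda–Guerra identities).** For every integer $n\ge 1$ and every continuous function $\psi:[-1,1]\to\mathbb{R}$ there is a function $v\mapsto\delta(\psi,n,v)$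 with $\delta(\psi,n,v)\to 0$ as $v\to\infty$, not depending on $N$, $\nu$ or $f$, such that for all $v\ge 0$, all $N\ge 1$, all probability measures $\nu$ on $S$ and all measurable $f:S^n\to\mathbb{R}$ with $|f|\le 1$, $$\mathbb{E}_x\Bigl|\mathbb{E}_g\bigl\langle f\,\psi(z^1\cdot z^{n+1})\bigr\rangle-\frac1n\,\mathbb{E}_g\langle f\rangle\,\mathbb{E}_g\bigl\langle\psi(z^1\cdot z^2)\bigr\rangle-\frac1n\sum_{2\le l\le n}\mathbb{E}_g\bigl\langle f\,\psi(z^1\cdot z^l)\bigr\rangle\Bigr|\le\delta(\psi,n,v),$$ where $f=f(z^1,\dots,z^n)$. -/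

import Mathlib

open MeasureTheory ProbabilityTheory Filter Topology

namespace GG

/-- The unit sphere `S` of the Euclidean space `ℝ^N`, with its Borel σ-algebra. -/
abbrev Sph (N : ℕ) : Type := Metric.sphere (0 : EuclideanSpace ℝ (Fin N)) 1

/-- The scalar product `z · w` of two points of the sphere. -/
noncomputable def overlap {N : ℕ} (z w : Sph N) : ℝ :=
  inner ℝ (z : EuclideanSpace ℝ (Fin N)) (w : EuclideanSpace ℝ (Fin N))

/-- The index set of the Gaussian coefficients: all multi-indices `(i_1, …, i_p)`
with entries in `{1, …, N}`, for all `p ≥ 1`. -/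
abbrev GIdx (N : ℕ) : Type := (p : ℕ+) × (Fin (p : ℕ) → Fin N)

/-- The uniform distribution on `[0,1]`. -/
noncomputable def unif : Measure ℝ := volume.restrict (Set.Icc (0 : ℝ) 1)

instance : IsProbabilityMeasure unif := ⟨by simp [unif]⟩

/-- The joint law of the i.i.d. uniform variables `(x_p)_{p ≥ 1}`. -/
noncomputable def lawX : Measure (ℕ+ → ℝ) := Measure.infinitePi fun _ => unif

/-- The joint law of the i.i.d. standard Gaussian variables `g_{i_1, …, i_p}`. -/
noncomputable def lawG (N : ℕ) : Measure (GIdx N → ℝ) :=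
  Measure.infinitePi fun _ => gaussianReal 0 1

/-- `g_p(z) = ∑_{i_1, …, i_p} g_{i_1, …, i_p} z_{i_1} ⋯ z_{i_p}`. -/
noncomputable def gP {N : ℕ} (ω : GIdx N → ℝ) (p : ℕ+) (z : Sph N) : ℝ :=
  ∑ i : Fin (p : ℕ) → Fin N,
    ω ⟨p, i⟩ * ∏ k : Fin (p : ℕ), (z : EuclideanSpace ℝ (Fin N)) (i k)

/-- `g(z) = v ∑_{p ≥ 1} 2^{-p} x_p g_p(z)`. For each `z` the series converges absolutely for
almost every `(x, ω)`, hence almost surely it does so for almost every `z` with respect to any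
given finite measure on the sphere. -/
noncomputable def gField {N : ℕ} (v : ℝ) (x : ℕ+ → ℝ) (ω : GIdx N → ℝ) (z : Sph N) : ℝ :=
  v * ∑' p : ℕ+, (2 : ℝ)⁻¹ ^ (p : ℕ) * x p * gP ω p z

/-- The random measure `ν_g`, with `dν_g / dν = e^g / ∫ e^g dν`. -/
noncomputable def gibbs {N : ℕ} (ν : Measure (Sph N)) (v : ℝ) (x : ℕ+ → ℝ)
    (ω : GIdx N → ℝ) : Measure (Sph N) :=
  ν.tilted (gField v x ω)

/-- `E_g ⟨F⟩` for a function `F` of `m` replicas, `(x_p)` being fixed: `⟨F⟩` is the average of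
`F` with respect to `ν_g^{⊗ m}`, and `E_g` the expectation in the Gaussian variables. -/
noncomputable def gAvg {N : ℕ} (ν : Measure (Sph N)) (v : ℝ) (x : ℕ+ → ℝ) {m : ℕ}
    (F : (Fin m → Sph N) → ℝ) : ℝ :=
  ∫ ω, (∫ z, F z ∂(Measure.pi fun _ : Fin m => gibbs ν v x ω)) ∂(lawG N)

/-- The quantity inside the absolute value in the Ghirlanda-Guerra identities. Replicas are
numbered from `0`: `z 0` is `z^1`, and the last of the `n + 1` replicas is `z^{n+1}`. -/
noncomputable def ggDefect {N : ℕ} (ν : Measure (Sph N)) (v : ℝ) (x : ℕ+ → ℝ) (n : ℕ) [NeZero n]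
    (f : (Fin n → Sph N) → ℝ) (ψ : ℝ → ℝ) : ℝ :=
  gAvg ν v x (fun z : Fin (n + 1) → Sph N =>
      f (fun i => z i.castSucc) * ψ (overlap (z 0) (z (Fin.last n))))
    - 1 / (n : ℝ) * gAvg ν v x f
        * gAvg ν v x (fun z : Fin 2 → Sph N => ψ (overlap (z 0) (z 1)))
    - 1 / (n : ℝ) * ∑ l ∈ Finset.univ.erase (0 : Fin n),
        gAvg ν v x (fun z : Fin n → Sph N => f z * ψ (overlap (z 0) (z l)))

end GG

/-!
# The Ghirlanda–Guerra identities for a perturbed measure on the sphere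

Fix `p` and all the `x_q` with `q ≠ p`, and put `s = v 2^{-p}` and `t = x_p`. Since `g_p` has
covariance `(z · w)^p`, Gaussian integration by parts gives, for a bounded function `f` of `n`
replicas and for `ψ u = u ^ p`,
`s t n * ggDefect = E_g⟨f⟩ E_g⟨g_p⟩ - E_g⟨f g_p(z^1)⟩` (`mul_ggDefect_pow`). The defect is therefore
controlled by the fluctuations of `g_p`, which are of two kinds
(`mul_abs_ggDefect_pow_le`).

* *Thermal fluctuations.* The Gibbs variance of `g_p` is `s⁻¹` times the derivative of `⟨g_p⟩` in
  `t`, and by integration by parts `|E_g⟨g_p⟩| ≤ 2 s` for `t` in `[0, 1]`. Hence the mean variance,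
  integrated over `t`, is bounded (`integrable_varG`).
* *Disorder fluctuations.* The free energy `log Z`, `Z = ∫ e^g dν`, is convex in `t` with derivative
  `s ⟨g_p⟩`, so `⟨g_p⟩` is close to its mean when `log Z` is close to its mean at three points
  `t - y`, `t`, `t + y`, up to the increments of the nondecreasing function `t ↦ E_g⟨g_p⟩`, which
  telescope after integration over `t` (`integral_abs_sub_integral_le_of_subgradient`,
  `intervalIntegral_shift_sub_shift_le`). The free energy deviates from its mean by `O(v)` only:
  when the disorder is rotated into an independent copy in small steps, each step costs the Gibbs
  average of the increment of the field, as in the argument of Maurey and Pisier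
  (`integral_abs_logZ_sub_le`).

Altogether `∫₀¹ t |ggDefect| dt ≤ C_p / v + 16 y + C_p / (v y)` for all `y` in `(0, 1]`
(`integral_mul_abs_ggDefect_pow_le`), with constants independent of `N`, `ν` and `f`. The range of
small `t` is negligible, as the defect is bounded by `2`, so the expectation over `x` of the
defect of each power tends to `0` uniformly. The defect is linear in `ψ`, it vanishes almost surely
for constant `ψ` and it is at most `2 sup |ψ|`, so the Weierstrass theorem extends this to
continuous `ψ` (`asympGG_of_continuous`), and `δ` is the supremum of the left-hand side over `N`, `ν` and `f`.

The series defining the field need not converge everywhere, and `e^g` is not bounded; the event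
`Regular` collects the almost sure properties that make the Gibbs measure a genuine probability
measure. Changing one `x_p` or one Gaussian coefficient then tilts it by the exponential of a
bounded function, so that derivatives in a single variable are covariances (`hasDerivAt_integral_tilted`).
-/

open scoped ENNReal

namespace GG

/-! ### Tilted and product measures -/

section Tilted

variable {E : Type*} [MeasurableSpace E]

lemma pi_withDensity {ι : Type*} [Fintype ι] (μ : Measure E) [IsProbabilityMeasure μ]
    (f : E → ℝ≥0∞)
    (hf : Measurable f) [SigmaFinite (μ.withDensity f)] :
    Measure.pi (fun _ : ι => μ.withDensity f)
      = (Measure.pi fun _ : ι => μ).withDensity (fun z => ∏ i, f (z i)) := by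
  refine Measure.pi_eq fun s hs => ?_
  rw [withDensity_apply _ (MeasurableSet.univ_pi hs),
    ← lintegral_indicator (MeasurableSet.univ_pi hs)]
  have h : ∀ z : ι → E, (Set.univ.pi s).indicator (fun z => ∏ i, f (z i)) z
      = ∏ i, (s i).indicator f (z i) := by
    intro z
    by_cases hz : z ∈ Set.univ.pi s
    · rw [Set.indicator_of_mem hz]
      exact Finset.prod_congr rfl fun i _ => (Set.indicator_of_mem (hz i trivial) f).symm
    · rw [Set.indicator_of_notMem hz]
      simp only [Set.mem_univ_pi, not_forall] at hz
      obtain ⟨i, hi⟩ := hz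
      exact (Finset.prod_eq_zero (Finset.mem_univ i) (Set.indicator_of_notMem hi f)).symm
  simp_rw [h]
  rw [lintegral_prod_eq_prod_lintegral_of_indepFun Finset.univ
    (fun i (z : ι → E) => (s i).indicator f (z i))
    (iIndepFun_pi fun i => (hf.indicator (hs i)).aemeasurable)
    (fun i => (hf.indicator (hs i)).comp (measurable_pi_apply i))]
  refine Finset.prod_congr rfl fun i _ => ?_
  rw [withDensity_apply _ (hs i), ← lintegral_indicator (hs i),
    (measurePreserving_eval (fun _ : ι => μ) i).lintegral_comp (hf.indicator (hs i))]

/-- Independent replicas of a tilted measure form a tilted product measure. If `exp g` is not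
integrable, both sides are the product of the zero measure. -/
lemma pi_tilted {ι : Type*} [Fintype ι] (μ : Measure E) [IsProbabilityMeasure μ] (g : E → ℝ)
    (hg : Measurable g) :
    Measure.pi (fun _ : ι => μ.tilted g)
      = (Measure.pi fun _ : ι => μ).tilted (fun z => ∑ i, g (z i)) := by
  have : SigmaFinite (μ.withDensity
      fun x => ENNReal.ofReal (Real.exp (g x) / ∫ x, Real.exp (g x) ∂μ)) :=
    inferInstanceAs (SigmaFinite (μ.tilted g))
  unfold Measure.tilted
  rw [pi_withDensity _ _ (by fun_prop)]
  congr 1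
  ext z
  rw [← ENNReal.ofReal_prod_of_nonneg (fun i _ => by positivity), Finset.prod_div_distrib]
  simp_rw [Real.exp_sum]
  congr 2
  rw [integral_fintype_prod_eq_prod (fun _ : ι => fun x => Real.exp (g x))]

lemma stronglyMeasurable_integral_tilted {Θ : Type*} [MeasurableSpace Θ] (μ : Measure E)
    [SFinite μ] {G F : Θ → E → ℝ} (hG : Measurable (Function.uncurry G))
    (hF : Measurable (Function.uncurry F)) :
    StronglyMeasurable fun θ => ∫ z, F θ z ∂(μ.tilted (G θ)) := by
  simp_rw [integral_tilted, smul_eq_mul]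
  have h1 : StronglyMeasurable fun θ => ∫ z, Real.exp (G θ z) ∂μ :=
    StronglyMeasurable.integral_prod_right (f := fun θ z => Real.exp (G θ z))
      (Real.measurable_exp.comp hG).stronglyMeasurable
  have h2 : Measurable (Function.uncurry fun θ z =>
      Real.exp (G θ z) / (∫ z, Real.exp (G θ z) ∂μ) * F θ z) :=
    ((Real.measurable_exp.comp hG).div (h1.measurable.comp measurable_fst)).mul hF
  exact StronglyMeasurable.integral_prod_right h2.stronglyMeasurable

lemma measurable_lintegral_tilted {Θ : Type*} [MeasurableSpace Θ] (μ : Measure E)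
    [SFinite μ] {G : Θ → E → ℝ} {F : Θ → E → ℝ≥0∞} (hG : Measurable (Function.uncurry G))
    (hF : Measurable (Function.uncurry F)) :
    Measurable fun θ => ∫⁻ z, F θ z ∂(μ.tilted (G θ)) := by
  simp_rw [lintegral_tilted]
  have h1 : StronglyMeasurable fun θ => ∫ z, Real.exp (G θ z) ∂μ :=
    StronglyMeasurable.integral_prod_right (f := fun θ z => Real.exp (G θ z))
      (Real.measurable_exp.comp hG).stronglyMeasurable
  have h2 : Measurable (Function.uncurry fun θ z =>
      ENNReal.ofReal (Real.exp (G θ z) / ∫ z, Real.exp (G θ z) ∂μ) * F θ z) :=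
    (ENNReal.measurable_ofReal.comp
      ((Real.measurable_exp.comp hG).div (h1.measurable.comp measurable_fst))).mul hF
  exact h2.lintegral_prod_right'

lemma integrable_exp_of_bound {μ : Measure E} [IsFiniteMeasure μ] {H : E → ℝ} (hH : Measurable H)
    {B : ℝ} (hB : ∀ z, |H z| ≤ B) : Integrable (fun z => Real.exp (H z)) μ :=
  Integrable.of_bound (by fun_prop) (Real.exp B) (ae_of_all _ fun z => by
    rw [Real.norm_eq_abs, Real.abs_exp]
    exact Real.exp_le_exp.2 ((le_abs_self _).trans (hB z)))

lemma integrable_of_abs_le {μ : Measure E} [IsFiniteMeasure μ] {f : E → ℝ} (hf : Measurable f)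
    {B : ℝ} (hB : ∀ z, |f z| ≤ B) : Integrable f μ :=
  Integrable.of_bound hf.aestronglyMeasurable B
    (ae_of_all _ fun z => (Real.norm_eq_abs _).trans_le (hB z))

lemma abs_integral_le_of_abs_le {μ : Measure E} [IsProbabilityMeasure μ] {f : E → ℝ}
    {B : ℝ} (hB : ∀ z, |f z| ≤ B) : |∫ z, f z ∂μ| ≤ B := by
  have := norm_integral_le_of_norm_le_const (μ := μ) (f := f) (C := B)
    (ae_of_all _ fun z => (Real.norm_eq_abs _).trans_le (hB z))
  simpa using this

lemma hasDerivAt_integral_mul_exp {μ : Measure E} [IsFiniteMeasure μ] {f H : E → ℝ}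
    (hf : Measurable f) (hH : Measurable H) {A B : ℝ} (hA : ∀ z, |f z| ≤ A) (hB : ∀ z, |H z| ≤ B)
    (y : ℝ) :
    HasDerivAt (fun y => ∫ z, Real.exp (y * H z) * f z ∂μ)
      (∫ z, Real.exp (y * H z) * (f z * H z) ∂μ) y := by
  have hexp : ∀ u ∈ Metric.ball y 1, ∀ z, |Real.exp (u * H z) * f z|
      ≤ Real.exp ((|y| + 1) * B) * A := by
    intro u hu z
    have hu' : |u| ≤ |y| + 1 := by
      have h1 : |u - y| < 1 := by simpa [Real.dist_eq] using hu
      have h2 := abs_add_le (u - y) y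
      rw [sub_add_cancel] at h2
      linarith
    rw [abs_mul, Real.abs_exp]
    refine mul_le_mul (Real.exp_le_exp.2 ?_) (hA z) (abs_nonneg _) (Real.exp_pos _).le
    refine (le_abs_self _).trans ?_
    rw [abs_mul]
    exact mul_le_mul hu' (hB z) (abs_nonneg _) (by positivity)
  refine (hasDerivAt_integral_of_dominated_loc_of_deriv_le
    (bound := fun _ => Real.exp ((|y| + 1) * B) * A * B)
    (F := fun y z => Real.exp (y * H z) * f z)
    (F' := fun y z => Real.exp (y * H z) * (f z * H z)) (Metric.ball_mem_nhds y one_pos)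
    (Eventually.of_forall fun u => by fun_prop) ?_ (by fun_prop) ?_ (integrable_const _) ?_).2
  · exact integrable_of_abs_le (by fun_prop) (hexp y (Metric.mem_ball_self one_pos))
  · refine ae_of_all _ fun z u hu => ?_
    rw [← mul_assoc, Real.norm_eq_abs, abs_mul]
    exact mul_le_mul (hexp u hu z) (hB z) (abs_nonneg _) ((abs_nonneg _).trans (hexp u hu z))
  · refine ae_of_all _ fun z u _ => ?_
    have := (((hasDerivAt_id u).mul_const (H z)).exp).mul_const (f z)
    refine this.congr_deriv ?_
    simp; ring

/-- The derivative of a tilted average with respect to the tilting parameter is a covariance. -/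
lemma hasDerivAt_integral_tilted {μ : Measure E} [IsProbabilityMeasure μ] {f H : E → ℝ}
    (hf : Measurable f) (hH : Measurable H) {A B : ℝ} (hA : ∀ z, |f z| ≤ A) (hB : ∀ z, |H z| ≤ B)
    (y : ℝ) :
    HasDerivAt (fun y => ∫ z, f z ∂μ.tilted (fun z => y * H z))
      (∫ z, f z * H z ∂μ.tilted (fun z => y * H z)
        - (∫ z, f z ∂μ.tilted (fun z => y * H z)) * ∫ z, H z ∂μ.tilted (fun z => y * H z)) y := by
  have hI : ∀ (y : ℝ) (k : E → ℝ), ∫ z, k z ∂μ.tilted (fun z => y * H z)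
      = (∫ z, Real.exp (y * H z) * k z ∂μ) / ∫ z, Real.exp (y * H z) ∂μ := by
    intro y k
    rw [integral_tilted, ← integral_div]
    exact integral_congr_ae (ae_of_all _ fun z => by simp only [smul_eq_mul]; ring)
  have h0 : 0 < ∫ z, Real.exp (y * H z) ∂μ :=
    integral_exp_pos (integrable_exp_of_bound (by fun_prop) (B := |y| * B) fun z => by
      rw [abs_mul]; exact mul_le_mul_of_nonneg_left (hB z) (abs_nonneg _))
  have h1 := hasDerivAt_integral_mul_exp (μ := μ) hf hH hA hB y
  have h2 := hasDerivAt_integral_mul_exp (μ := μ) (f := fun _ => 1) measurable_const hH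
    (A := 1) (by simp) hB y
  simp only [mul_one, one_mul] at h2
  simp_rw [hI]
  refine (h1.div h2 h0.ne').congr_deriv ?_
  field_simp

/-- Jensen's inequality for the exponential. -/
lemma integral_le_log_integral_exp {μ : Measure E} [IsProbabilityMeasure μ] {H : E → ℝ}
    (hH : Integrable H μ) (hexp : Integrable (fun z => Real.exp (H z)) μ) :
    ∫ z, H z ∂μ ≤ Real.log (∫ z, Real.exp (H z) ∂μ) := by
  rw [Real.le_log_iff_exp_le (integral_exp_pos hexp)]
  exact convexOn_exp.map_integral_le Real.continuous_exp.continuousOn isClosed_univ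
    (ae_of_all _ fun _ => trivial) hH hexp

end Tilted

/-! ### Infinite product measures -/

section InfiniteProducts

open Measure

lemma infinitePi_map_update {ι : Type*} [DecidableEq ι] {X : ι → Type*}
    [∀ i, MeasurableSpace (X i)] (μ : ∀ i, Measure (X i)) [∀ i, IsProbabilityMeasure (μ i)]
    (i : ι) :
    ((infinitePi μ).prod (μ i)).map (fun q => Function.update q.1 i q.2) = infinitePi μ := by
  have hm : Measurable fun q : (∀ j, X j) × X i => Function.update q.1 i q.2 := by
    refine measurable_pi_iff.2 fun j => ?_
    by_cases h : j = i
    · subst h; simpa using measurable_snd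
    · simp only [Function.update_of_ne h]; fun_prop
  refine eq_infinitePi _ fun s t ht => ?_
  rw [Measure.map_apply hm (.pi s.countable_toSet fun _ _ => ht _)]
  by_cases hi : i ∈ s
  · have : (fun q : (∀ j, X j) × X i => Function.update q.1 i q.2) ⁻¹' (Set.pi s t)
        = (Set.pi (s.erase i : Finset ι) t) ×ˢ (t i) := by
      ext q
      simp only [Set.mem_preimage, Set.mem_pi, Set.mem_prod, Finset.coe_erase, Finset.mem_coe,
        Set.mem_sdiff, Set.mem_singleton_iff]
      constructor
      · intro h
        exact ⟨fun j hj => by simpa [Function.update_of_ne hj.2] using h j hj.1,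
          by simpa using h i hi⟩
      · rintro ⟨h1, h2⟩ j hj
        by_cases hji : j = i
        · subst hji; simpa using h2
        · simpa [Function.update_of_ne hji] using h1 j ⟨hj, hji⟩
    rw [this, Measure.prod_prod, infinitePi_pi _ (fun j _ => ht j), Finset.prod_erase_mul _ _ hi]
  · have : (fun q : (∀ j, X j) × X i => Function.update q.1 i q.2) ⁻¹' (Set.pi s t)
        = (Set.pi s t) ×ˢ Set.univ := by
      ext q
      simp only [Set.mem_preimage, Set.mem_pi, Set.mem_prod, Set.mem_univ, and_true]
      refine forall₂_congr fun j hj => ?_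
      rw [Function.update_of_ne (fun h => hi (by rw [← h]; exact hj))]
    rw [this, Measure.prod_prod, infinitePi_pi _ (fun j _ => ht j), measure_univ, mul_one]

/-- Resampling one coordinate preserves a product measure. -/
lemma measurePreserving_update {ι : Type*} [DecidableEq ι] {X : ι → Type*}
    [∀ i, MeasurableSpace (X i)] (μ : ∀ i, Measure (X i)) [∀ i, IsProbabilityMeasure (μ i)]
    (i : ι) :
    MeasurePreserving (fun q : (∀ j, X j) × X i => Function.update q.1 i q.2)
      ((infinitePi μ).prod (μ i)) (infinitePi μ) := by
  refine ⟨?_, infinitePi_map_update μ i⟩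
  refine measurable_pi_iff.2 fun j => ?_
  by_cases h : j = i
  · subst h; simpa using measurable_snd
  · simp only [Function.update_of_ne h]; fun_prop

lemma nonempty_finiteSpanningSetsIn_squareCylinders {ι : Type*} {Z : ι → Type*}
    [∀ i, MeasurableSpace (Z i)] (κ : Measure (∀ i, Z i)) [IsFiniteMeasure κ] :
    Nonempty (κ.FiniteSpanningSetsIn
      (squareCylinders fun i => {s : Set (Z i) | MeasurableSet s})) :=
  ⟨⟨fun _ => Set.univ, fun _ => ⟨∅, fun _ => Set.univ, by simp, by simp⟩,
    fun _ => measure_lt_top _ _, Set.iUnion_const _⟩⟩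

/-- A family of independent pairs with independent entries is a pair of independent families. -/
lemma infinitePi_prod_map {ι : Type*} {X Y : ι → Type*} [∀ i, MeasurableSpace (X i)]
    [∀ i, MeasurableSpace (Y i)] (μ : ∀ i, Measure (X i)) (ν : ∀ i, Measure (Y i))
    [∀ i, IsProbabilityMeasure (μ i)] [∀ i, IsProbabilityMeasure (ν i)] :
    (infinitePi fun i => (μ i).prod (ν i)).map (fun ω => (fun i => (ω i).1, fun i => (ω i).2))
      = (infinitePi μ).prod (infinitePi ν) := by
  have hm : Measurable fun ω : (∀ i, X i × Y i) => ((fun i => (ω i).1), fun i => (ω i).2) := by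
    fun_prop
  refine (Measure.prod_eq_generateFrom generateFrom_squareCylinders generateFrom_squareCylinders
    (isPiSystem_squareCylinders (fun _ => MeasurableSpace.isPiSystem_measurableSet)
      fun _ => MeasurableSet.univ)
    (isPiSystem_squareCylinders (fun _ => MeasurableSpace.isPiSystem_measurableSet)
      fun _ => MeasurableSet.univ)
    (nonempty_finiteSpanningSetsIn_squareCylinders (infinitePi μ)).some
    (nonempty_finiteSpanningSetsIn_squareCylinders (infinitePi ν)).some ?_).symm
  rintro _ ⟨s, a, ha, rfl⟩ _ ⟨s', b, hb, rfl⟩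
  simp only [Set.mem_univ_pi, Set.mem_ofPred_eq] at ha hb
  classical
  have hset : (fun ω : (∀ i, X i × Y i) => ((fun i => (ω i).1), fun i => (ω i).2)) ⁻¹'
      ((s : Set ι).pi a ×ˢ (s' : Set ι).pi b)
      = ((s ∪ s' : Finset ι) : Set ι).pi fun i =>
        (if i ∈ s then a i else Set.univ) ×ˢ (if i ∈ s' then b i else Set.univ) := by
    ext ω
    simp only [Set.mem_preimage, Set.mem_prod, Set.mem_pi, Finset.mem_coe, Finset.mem_union]
    constructor
    · rintro ⟨h1, h2⟩ i -
      constructor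
      · split_ifs with h
        exacts [h1 i h, trivial]
      · split_ifs with h
        exacts [h2 i h, trivial]
    · intro h
      exact ⟨fun i hi => by simpa [hi] using (h i (Or.inl hi)).1,
        fun i hi => by simpa [hi] using (h i (Or.inr hi)).2⟩
  have ha' : ∀ i, MeasurableSet (if i ∈ s then a i else Set.univ) := fun i => by
    split_ifs
    exacts [ha i, .univ]
  have hb' : ∀ i, MeasurableSet (if i ∈ s' then b i else Set.univ) := fun i => by
    split_ifs
    exacts [hb i, .univ]
  rw [Measure.map_apply hm ((MeasurableSet.pi s.countable_toSet fun i _ => ha i).prod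
    (MeasurableSet.pi s'.countable_toSet fun i _ => hb i)), hset,
    infinitePi_pi _ (fun i _ => (ha' i).prod (hb' i)), infinitePi_pi _ (fun i _ => ha i),
    infinitePi_pi _ (fun i _ => hb i)]
  simp_rw [Measure.prod_prod, Finset.prod_mul_distrib]
  congr 1
  · rw [← Finset.prod_subset (Finset.subset_union_left (s₁ := s) (s₂ := s'))
      (fun i _ hi => by simp [hi])]
    exact Finset.prod_congr rfl fun i hi => by simp [hi]
  · rw [← Finset.prod_subset (Finset.subset_union_right (s₁ := s) (s₂ := s'))
      (fun i _ hi => by simp [hi])]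
    exact Finset.prod_congr rfl fun i hi => by simp [hi]

/-- For centred Gaussian variables, a rotation mixing two independent copies of the whole family
preserves their joint law. -/
lemma measurePreserving_rotation {ι : Type*} (θ : ℝ) :
    MeasurePreserving (fun q : (ι → ℝ) × (ι → ℝ) =>
        ((fun i => Real.cos θ * q.1 i + Real.sin θ * q.2 i),
          fun i => -Real.sin θ * q.1 i + Real.cos θ * q.2 i))
      ((infinitePi fun _ => gaussianReal 0 1).prod (infinitePi fun _ => gaussianReal 0 1))
      ((infinitePi fun _ => gaussianReal 0 1).prod (infinitePi fun _ => gaussianReal 0 1)) := by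
  refine ⟨by fun_prop, ?_⟩
  have h2 : ((gaussianReal 0 1).prod (gaussianReal 0 1)).map
      (fun q : ℝ × ℝ => (Real.cos θ * q.1 + Real.sin θ * q.2,
        -Real.sin θ * q.1 + Real.cos θ * q.2))
      = (gaussianReal 0 1).prod (gaussianReal 0 1) := by
    have := IsGaussian.map_rotation_eq_self (μ := gaussianReal 0 1) (by simp) θ
    convert this using 2
    ext q <;> simp [ContinuousLinearMap.rotation_apply]
  conv_lhs => rw [← infinitePi_prod_map]
  rw [Measure.map_map (by fun_prop) (by fun_prop)]
  conv_rhs => rw [← infinitePi_prod_map]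
  conv_rhs => enter [2, 1, i]; rw [← h2]
  rw [← infinitePi_map_pi _ (fun _ => by fun_prop), Measure.map_map (by fun_prop) (by fun_prop)]
  rfl

end InfiniteProducts

/-! ### Gaussian integration by parts -/

/-- Gaussian integration by parts in one variable: `E[Y F(Y)] = E[F'(Y)]`. -/
lemma integral_id_mul_gaussianReal {F F' : ℝ → ℝ} (hF : ∀ y, HasDerivAt F (F' y) y)
    (hF' : Measurable F') {A B : ℝ} (hA : ∀ y, |F y| ≤ A) (hB : ∀ y, |F' y| ≤ B) :
    ∫ y, y * F y ∂gaussianReal 0 1 = ∫ y, F' y ∂gaussianReal 0 1 := by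
  have hFm : Measurable F := (continuous_iff_continuousAt.2
    fun y => (hF y).continuousAt).measurable
  have hpdf : ∀ y, HasDerivAt (gaussianPDFReal 0 1) (-(y * gaussianPDFReal 0 1 y)) y := by
    intro y
    have hfun : gaussianPDFReal 0 1
        = fun x => (√(2 * Real.pi * (1 : NNReal)))⁻¹
          * Real.exp (-(x - 0) ^ 2 / (2 * (1 : NNReal))) := by
      ext x; rw [gaussianPDFReal]
    rw [hfun]
    have := ((((((hasDerivAt_id y).sub_const 0).pow 2).neg).div_const
      (2 * ((1 : NNReal) : ℝ))).exp).const_mul ((√(2 * Real.pi * (1 : NNReal)))⁻¹)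
    refine this.congr_deriv ?_
    simp
    ring
  have hid : Integrable (fun y : ℝ => y) (gaussianReal 0 1) := by
    have := (memLp_id_gaussianReal (μ := 0) (v := 1) 1)
    exact (memLp_one_iff_integrable.1 (by exact_mod_cast this))
  have hpi : Integrable (gaussianPDFReal 0 1) := integrable_gaussianPDFReal 0 1
  have hyp : Integrable (fun y => y * gaussianPDFReal 0 1 y) := by
    rw [gaussianReal_of_var_ne_zero _ one_ne_zero] at hid
    rw [integrable_withDensity_iff_integrable_smul' (measurable_gaussianPDF 0 1)
      (ae_of_all _ fun _ => gaussianPDF_lt_top)] at hid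
    refine hid.congr (ae_of_all _ fun y => ?_)
    simp [toReal_gaussianPDF, mul_comm]
  rw [integral_gaussianReal_eq_integral_smul one_ne_zero,
    integral_gaussianReal_eq_integral_smul one_ne_zero]
  have key := integral_mul_deriv_eq_deriv_mul_of_integrable (u := F) (u' := F')
    (v := gaussianPDFReal 0 1) (v' := fun y => -(y * gaussianPDFReal 0 1 y))
    (fun y _ => hF y) (fun y _ => hpdf y)
    ((hyp.neg).bdd_mul hFm.aestronglyMeasurable (ae_of_all _ hA))
    (hpi.bdd_mul hF'.aestronglyMeasurable (ae_of_all _ hB))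
    (hpi.bdd_mul hFm.aestronglyMeasurable (ae_of_all _ hA))
  simp only [smul_eq_mul]
  have e1 : ∀ y, gaussianPDFReal 0 1 y * (y * F y) = -(F y * -(y * gaussianPDFReal 0 1 y)) :=
    fun y => by ring
  simp_rw [e1, integral_neg, key, neg_neg, mul_comm]

/-- Gaussian integration by parts for the average of `f` under a measure tilted by a Gaussian
multiple of `H`: a bounded function of a Gaussian variable, whose derivative is a covariance. -/
lemma integral_id_mul_integral_tilted {E : Type*} [MeasurableSpace E] {μ : Measure E}
    [IsProbabilityMeasure μ] {f H : E → ℝ} (hf : Measurable f) (hH : Measurable H) {A B : ℝ}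
    (hA : ∀ z, |f z| ≤ A) (hB : ∀ z, |H z| ≤ B) (c y₀ : ℝ) :
    ∫ y, y * ∫ z, f z ∂μ.tilted (fun z => c * (y - y₀) * H z) ∂gaussianReal 0 1
      = ∫ y, c * (∫ z, f z * H z ∂μ.tilted (fun z => c * (y - y₀) * H z)
        - (∫ z, f z ∂μ.tilted (fun z => c * (y - y₀) * H z))
          * ∫ z, H z ∂μ.tilted (fun z => c * (y - y₀) * H z)) ∂gaussianReal 0 1 := by
  have hp : ∀ u : ℝ, IsProbabilityMeasure (μ.tilted fun z => u * H z) := fun u =>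
    isProbabilityMeasure_tilted (integrable_exp_of_bound (by fun_prop) (B := |u| * B) fun z => by
      rw [abs_mul]; exact mul_le_mul_of_nonneg_left (hB z) (abs_nonneg _))
  have hm : ∀ k : E → ℝ, Measurable k →
      Measurable fun y : ℝ => ∫ z, k z ∂μ.tilted (fun z => c * (y - y₀) * H z) := fun k hk =>
    (stronglyMeasurable_integral_tilted μ (G := fun y z => c * (y - y₀) * H z)
      (F := fun _ z => k z) (by fun_prop) (by fun_prop)).measurable
  have hA' : ∀ u : ℝ, |∫ z, f z ∂μ.tilted (fun z => u * H z)| ≤ A := fun u => by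
    have := hp u
    exact abs_integral_le_of_abs_le hA
  have hB' : ∀ u : ℝ, |∫ z, H z ∂μ.tilted (fun z => u * H z)| ≤ B := fun u => by
    have := hp u
    exact abs_integral_le_of_abs_le hB
  have hAB' : ∀ u : ℝ, |∫ z, f z * H z ∂μ.tilted (fun z => u * H z)| ≤ A * B := fun u => by
    have := hp u
    refine abs_integral_le_of_abs_le fun z => ?_
    rw [abs_mul]
    exact mul_le_mul (hA z) (hB z) (abs_nonneg _) ((abs_nonneg _).trans (hA z))
  refine integral_id_mul_gaussianReal (A := A) (B := |c| * (A * B + A * B)) (fun y => ?_)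
    (measurable_const.mul ((hm _ (hf.mul hH)).sub ((hm _ hf).mul (hm _ hH))))
    (fun y => hA' _) fun y => ?_
  · have h1 := hasDerivAt_integral_tilted (μ := μ) hf hH hA hB (c * (y - y₀))
    have h2 : HasDerivAt (fun y : ℝ => c * (y - y₀)) c y := by
      simpa using ((hasDerivAt_id y).sub_const y₀).const_mul c
    refine (HasDerivAt.comp y h1 h2).congr_deriv ?_
    ring
  · rw [abs_mul]
    refine mul_le_mul_of_nonneg_left ((abs_sub _ _).trans (add_le_add (hAB' _) ?_)) (abs_nonneg _)
    rw [abs_mul]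
    exact mul_le_mul (hA' _) (hB' _) (abs_nonneg _) ((abs_nonneg _).trans (hA' (c * (y - y₀))))

/-! ### Derivatives of random convex functions -/

section Convex

variable {Ω : Type*} [MeasurableSpace Ω] {P : Measure Ω}

/-- If `φ t` is a random convex function of `t` with subgradient `s * D t`, then `D t` is close to
its mean as soon as `φ` is close to its mean at three neighbouring points and the mean of `D`
varies little between them. -/
lemma integral_abs_sub_integral_le_of_subgradient {φ D : ℝ → Ω → ℝ} {s y B t : ℝ} (hs : 0 < s)
    (hy : 0 < y) [IsProbabilityMeasure P]
    (h : ∀ t t', ∀ᵐ ω ∂P, s * (t' - t) * D t ω ≤ φ t' ω - φ t ω)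
    (hφ : ∀ t, Integrable (φ t) P) (hD : ∀ t, Integrable (D t) P)
    (hB : ∀ u ∈ ({t - y, t, t + y} : Set ℝ), ∫ ω, |φ u ω - ∫ ω', φ u ω' ∂P| ∂P ≤ B) :
    ∫ ω, |D t ω - ∫ ω', D t ω' ∂P| ∂P
      ≤ (∫ ω, D (t + y) ω ∂P) - (∫ ω, D (t - y) ω ∂P) + 3 * B / (s * y) := by
  have hsy : 0 < s * y := mul_pos hs hy
  set m : ℝ → ℝ := fun t => ∫ ω, D t ω ∂P with hm
  set Φ : ℝ → ℝ := fun t => ∫ ω, φ t ω ∂P with hΦ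
  have hmean : ∀ t t', s * (t' - t) * m t ≤ Φ t' - Φ t := by
    intro t t'
    have := integral_mono_ae ((hD t).const_mul (s * (t' - t))) ((hφ t').sub (hφ t)) (h t t')
    rwa [integral_const_mul, integral_sub' (hφ t') (hφ t)] at this
  have hΔ : ∀ u, Integrable (fun ω => |φ u ω - Φ u|) P := fun u =>
    ((hφ u).sub (integrable_const _)).abs
  have hΔ2 : Integrable (fun ω => |φ (t - y) ω - Φ (t - y)| + |φ t ω - Φ t|) P := (hΔ _).add (hΔ _)
  have hΔ3 : Integrable (fun ω => |φ (t - y) ω - Φ (t - y)| + |φ t ω - Φ t|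
      + |φ (t + y) ω - Φ (t + y)|) P := hΔ2.add (hΔ _)
  have hpt : ∀ᵐ ω ∂P, |D t ω - m t| ≤ m (t + y) - m (t - y)
      + (|φ (t - y) ω - Φ (t - y)| + |φ t ω - Φ t| + |φ (t + y) ω - Φ (t + y)|) / (s * y) := by
    filter_upwards [h t (t + y), h t (t - y)] with ω h1 h2
    -- the slopes of `φ` on both sides of `t` enclose `s * D t ω`; those of `Φ` lie between values
    -- of `s * m`
    have e1 := hmean (t + y) t
    have e2 := hmean t (t + y)
    have e3 := hmean (t - y) t
    have e4 := hmean t (t - y)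
    have a1 := abs_le.1 (le_refl |φ (t - y) ω - Φ (t - y)|)
    have a2 := abs_le.1 (le_refl |φ t ω - Φ t|)
    have a3 := abs_le.1 (le_refl |φ (t + y) ω - Φ (t + y)|)
    rw [← sub_le_iff_le_add', le_div_iff₀ hsy]
    rcases abs_cases (D t ω - m t) with ⟨e, -⟩ | ⟨e, -⟩ <;> rw [e] <;> nlinarith
  calc ∫ ω, |D t ω - m t| ∂P
      ≤ ∫ ω, (m (t + y) - m (t - y)
        + (|φ (t - y) ω - Φ (t - y)| + |φ t ω - Φ t| + |φ (t + y) ω - Φ (t + y)|) / (s * y)) ∂P :=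
        integral_mono_ae ((hD t).sub (integrable_const _)).abs ((integrable_const _).add
          (hΔ3.div_const _)) hpt
    _ = m (t + y) - m (t - y) + ((∫ ω, |φ (t - y) ω - Φ (t - y)| ∂P) + (∫ ω, |φ t ω - Φ t| ∂P)
          + ∫ ω, |φ (t + y) ω - Φ (t + y)| ∂P) / (s * y) := by
        rw [integral_add (integrable_const _) (hΔ3.div_const _),
          integral_div, integral_add hΔ2 (hΔ _), integral_add (hΔ _) (hΔ _)]
        simp
    _ ≤ _ := by
        gcongr
        linarith [hB (t - y) (by simp), hB t (by simp), hB (t + y) (by simp)]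

/-- The difference of two shifts of `m` telescopes to integrals over two intervals of length
`2 * y`. -/
lemma intervalIntegral_shift_sub_shift_le {m : ℝ → ℝ} (hm : Monotone m) {K y : ℝ} (hy : 0 ≤ y)
    (hy1 : y ≤ 1) (hK : ∀ t, |t| ≤ 2 → |m t| ≤ K) :
    ∫ t in (0 : ℝ)..1, (m (t + y) - m (t - y)) ≤ 4 * K * y := by
  have hi : ∀ a b, IntervalIntegrable m volume a b := fun a b => hm.intervalIntegrable
  have hi1 : IntervalIntegrable (fun t => m (t + y)) volume 0 1 :=
    (Monotone.intervalIntegrable fun a b hab => hm (by linarith))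
  have hi2 : IntervalIntegrable (fun t => m (t - y)) volume 0 1 :=
    (Monotone.intervalIntegrable fun a b hab => hm (by linarith))
  rw [intervalIntegral.integral_sub hi1 hi2, intervalIntegral.integral_comp_add_right (f := m),
    intervalIntegral.integral_comp_sub_right (f := m)]
  have e1 := intervalIntegral.integral_add_adjacent_intervals (hi (0 - y) (0 + y))
    (hi (0 + y) (1 + y))
  have e2 := intervalIntegral.integral_add_adjacent_intervals (hi (0 - y) (1 - y))
    (hi (1 - y) (1 + y))
  have b1 := intervalIntegral.norm_integral_le_of_norm_le_const (a := 0 - y) (b := 0 + y) (f := m)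
    (C := K) fun t ht => by
      rw [Set.uIoc_of_le (by linarith)] at ht
      exact hK t (abs_le.2 ⟨by linarith [ht.1], by linarith [ht.2]⟩)
  have b2 := intervalIntegral.norm_integral_le_of_norm_le_const (a := 1 - y) (b := 1 + y) (f := m)
    (C := K) fun t ht => by
      rw [Set.uIoc_of_le (by linarith)] at ht
      exact hK t (abs_le.2 ⟨by linarith [ht.1], by linarith [ht.2]⟩)
  rw [Real.norm_eq_abs, abs_of_nonneg (a := 0 + y - (0 - y)) (by linarith)] at b1
  rw [Real.norm_eq_abs, abs_of_nonneg (a := 1 + y - (1 - y)) (by linarith)] at b2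
  have := abs_le.1 b1
  have := abs_le.1 b2
  linarith

end Convex

/-! ### Monomials and overlaps on the sphere -/

section Monomials

variable {N : ℕ}

/-- The monomial `z_{i_1} ⋯ z_{i_p}`, i.e. the function multiplying `g_{i_1, …, i_p}` in `g_p`. -/
noncomputable def mono {p : ℕ} (i : Fin p → Fin N) (z : Sph N) : ℝ :=
  ∏ k : Fin p, (z : EuclideanSpace ℝ (Fin N)) (i k)

lemma gP_eq (ω : GIdx N → ℝ) (p : ℕ+) (z : Sph N) :
    gP ω p z = ∑ i : Fin (p : ℕ) → Fin N, ω ⟨p, i⟩ * mono i z := rfl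

lemma measurable_mono {p : ℕ} (i : Fin p → Fin N) : Measurable (mono i) := by
  unfold mono
  refine Finset.measurable_prod _ fun k _ => ?_
  exact (measurable_pi_apply (i k)).comp
    ((WithLp.measurable_ofLp 2 (Fin N → ℝ)).comp measurable_subtype_coe)

lemma measurable_overlap : Measurable fun q : Sph N × Sph N => overlap q.1 q.2 := by
  unfold overlap
  exact (continuous_inner.comp
    ((continuous_subtype_val.comp continuous_fst).prodMk
      (continuous_subtype_val.comp continuous_snd))).measurable

lemma norm_coe_sph (z : Sph N) : ‖(z : EuclideanSpace ℝ (Fin N))‖ = 1 := by simp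

lemma abs_mono_le_one {p : ℕ} (i : Fin p → Fin N) (z : Sph N) : |mono i z| ≤ 1 := by
  unfold mono
  rw [Finset.abs_prod]
  refine Finset.prod_le_one (fun _ _ => abs_nonneg _) fun k _ => ?_
  have := PiLp.norm_apply_le (z : EuclideanSpace ℝ (Fin N)) (i k)
  rwa [norm_coe_sph, Real.norm_eq_abs] at this

lemma overlap_self (z : Sph N) : overlap z z = 1 := by
  unfold overlap
  rw [real_inner_self_eq_norm_sq, norm_coe_sph, one_pow]

lemma abs_overlap_le_one (z w : Sph N) : |overlap z w| ≤ 1 := by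
  have := abs_real_inner_le_norm (z : EuclideanSpace ℝ (Fin N)) w
  rwa [norm_coe_sph, norm_coe_sph, one_mul] at this

/-- The covariance of the Gaussian process `g_p`. -/
lemma sum_mono_mul_mono (p : ℕ) (z w : Sph N) :
    ∑ i : Fin p → Fin N, mono i z * mono i w = overlap z w ^ p := by
  have h : overlap z w = ∑ j : Fin N, (z : EuclideanSpace ℝ (Fin N)) j
      * (w : EuclideanSpace ℝ (Fin N)) j := by
    unfold overlap
    simp [PiLp.inner_apply, mul_comm]
  rw [h, Finset.sum_pow']
  simp [mono, Finset.prod_mul_distrib]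

lemma measurable_gP (p : ℕ+) :
    Measurable fun q : (GIdx N → ℝ) × Sph N => gP q.1 p q.2 := by
  simp_rw [gP_eq]
  refine Finset.measurable_sum _ fun i _ => ?_
  exact ((measurable_pi_apply _).comp measurable_fst).mul ((measurable_mono i).comp measurable_snd)

lemma abs_gP_le (ω : GIdx N → ℝ) (p : ℕ+) (z : Sph N) :
    |gP ω p z| ≤ ∑ i : Fin (p : ℕ) → Fin N, |ω ⟨p, i⟩| := by
  rw [gP_eq]
  refine (Finset.abs_sum_le_sum_abs _ _).trans (Finset.sum_le_sum fun i _ => ?_)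
  rw [abs_mul]
  exact mul_le_of_le_one_right (abs_nonneg _) (abs_mono_le_one i z)

lemma measurable_gField (v : ℝ) :
    Measurable fun q : ((ℕ+ → ℝ) × (GIdx N → ℝ)) × Sph N => gField v q.1.1 q.1.2 q.2 := by
  unfold gField
  refine measurable_const.mul (Measurable.tsum fun p => ?_)
  exact (measurable_const.mul ((measurable_pi_apply p).comp
    (measurable_fst.comp measurable_fst))).mul ((measurable_gP p).comp
      ((measurable_snd.comp measurable_fst).prodMk measurable_snd))

end Monomials

/-! ### Exponential moments of the field -/

section Moments

variable {N : ℕ}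

instance : IsProbabilityMeasure (lawG N) := inferInstanceAs (IsProbabilityMeasure
  (Measure.infinitePi fun _ => gaussianReal 0 1))

instance : IsProbabilityMeasure lawX := inferInstanceAs (IsProbabilityMeasure
  (Measure.infinitePi fun _ => unif))

lemma lintegral_exp_mul_gaussianReal (c : ℝ) :
    ∫⁻ y, ENNReal.ofReal (Real.exp (c * y)) ∂gaussianReal 0 1
      = ENNReal.ofReal (Real.exp (c ^ 2 / 2)) := by
  rw [← ofReal_integral_eq_lintegral_ofReal (integrable_exp_mul_gaussianReal c)
    (ae_of_all _ fun _ => (Real.exp_pos _).le)]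
  have := congrFun (mgf_fun_id_gaussianReal (μ := 0) (v := 1)) c
  simp only [mgf] at this
  rw [this]
  simp

/-- On the sphere, `g_p(z)` is a standard Gaussian variable. -/
lemma lintegral_exp_gP (p : ℕ+) (z : Sph N) (b : ℝ) :
    ∫⁻ ω, ENNReal.ofReal (Real.exp (b * gP ω p z)) ∂lawG N
      = ENNReal.ofReal (Real.exp (b ^ 2 / 2)) := by
  have hind : iIndepFun (fun (j : GIdx N) (ω : GIdx N → ℝ) => ω j) (lawG N) :=
    iIndepFun_infinitePi (X := fun _ y => y) fun _ => measurable_id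
  have hinj : Function.Injective fun i : Fin (p : ℕ) → Fin N => (⟨p, i⟩ : GIdx N) := by
    intro i j h
    simpa using h
  have hind' := (hind.precomp hinj).comp
    (fun i y => ENNReal.ofReal (Real.exp (b * mono i z * y))) (fun i => by fun_prop)
  have h1 : ∀ ω : GIdx N → ℝ, ENNReal.ofReal (Real.exp (b * gP ω p z))
      = ∏ i : Fin (p : ℕ) → Fin N, ENNReal.ofReal (Real.exp (b * mono i z * ω ⟨p, i⟩)) := by
    intro ω
    rw [← ENNReal.ofReal_prod_of_nonneg fun i _ => (Real.exp_pos _).le, ← Real.exp_sum, gP_eq,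
      Finset.mul_sum]
    congr 2
    exact Finset.sum_congr rfl fun i _ => by ring
  simp_rw [h1]
  rw [lintegral_prod_eq_prod_lintegral_of_indepFun Finset.univ
    (fun i (ω : GIdx N → ℝ) => ENNReal.ofReal (Real.exp (b * mono i z * ω ⟨p, i⟩))) hind'
    (fun i => by fun_prop)]
  have h2 : ∀ i : Fin (p : ℕ) → Fin N,
      ∫⁻ ω, ENNReal.ofReal (Real.exp (b * mono i z * ω ⟨p, i⟩)) ∂lawG N
        = ENNReal.ofReal (Real.exp ((b * mono i z) ^ 2 / 2)) := by
    intro i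
    rw [← lintegral_exp_mul_gaussianReal]
    exact (measurePreserving_eval_infinitePi (fun _ : GIdx N => gaussianReal 0 1)
      ⟨p, i⟩).lintegral_comp (f := fun y => ENNReal.ofReal (Real.exp (b * mono i z * y)))
        (by fun_prop)
  simp_rw [h2]
  rw [← ENNReal.ofReal_prod_of_nonneg fun i _ => (Real.exp_pos _).le, ← Real.exp_sum]
  congr 2
  have := sum_mono_mul_mono p z z
  rw [overlap_self, one_pow] at this
  calc ∑ i : Fin (p : ℕ) → Fin N, (b * mono i z) ^ 2 / 2
      = b ^ 2 / 2 * ∑ i : Fin (p : ℕ) → Fin N, mono i z * mono i z := by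
        rw [Finset.mul_sum]; exact Finset.sum_congr rfl fun i _ => by ring
    _ = b ^ 2 / 2 := by rw [this, mul_one]

lemma lintegral_exp_abs_gP_le (p : ℕ+) (z : Sph N) (b : ℝ) :
    ∫⁻ ω, ENNReal.ofReal (Real.exp (b * |gP ω p z|)) ∂lawG N
      ≤ 2 * ENNReal.ofReal (Real.exp (b ^ 2 / 2)) := by
  have hm : Measurable fun ω : GIdx N → ℝ => gP ω p z :=
    (measurable_gP p).comp (measurable_id.prodMk measurable_const)
  calc ∫⁻ ω, ENNReal.ofReal (Real.exp (b * |gP ω p z|)) ∂lawG N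
      ≤ ∫⁻ ω, (ENNReal.ofReal (Real.exp (b * gP ω p z))
          + ENNReal.ofReal (Real.exp (-b * gP ω p z))) ∂lawG N := by
        refine lintegral_mono fun ω => ?_
        rcases abs_cases (gP ω p z) with ⟨e, -⟩ | ⟨e, -⟩ <;> rw [e]
        · exact le_self_add
        · rw [mul_neg, ← neg_mul]
          exact le_add_self
    _ = _ := by
        rw [lintegral_add_left (by fun_prop), lintegral_exp_gP, lintegral_exp_gP, neg_sq, two_mul]

lemma lintegral_abs_gP_le (p : ℕ+) (z : Sph N) :
    ∫⁻ ω, ENNReal.ofReal |gP ω p z| ∂lawG N ≤ 4 := by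
  refine (lintegral_mono fun ω => ?_).trans ((lintegral_exp_abs_gP_le p z 1).trans ?_)
  · refine ENNReal.ofReal_le_ofReal ?_
    rw [one_mul]
    linarith [Real.add_one_le_exp |gP ω p z|]
  · have h : Real.exp (1 ^ 2 / 2) ≤ 2 := by
      have h1 := Real.exp_one_lt_d9
      have h2 : Real.exp (1 / 2) * Real.exp (1 / 2) = Real.exp 1 := by
        rw [← Real.exp_add]; norm_num
      rw [one_pow]
      nlinarith [Real.exp_pos (1 / 2)]
    calc 2 * ENNReal.ofReal (Real.exp (1 ^ 2 / 2)) ≤ 2 * ENNReal.ofReal 2 := by gcongr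
      _ = 4 := by
        rw [ENNReal.ofReal_ofNat]; norm_num

lemma hasSum_two_inv_pow_pnat : HasSum (fun p : ℕ+ => (2 : ℝ)⁻¹ ^ (p : ℕ)) 1 := by
  have h := hasSum_geometric_two' 1
  rw [← Equiv.pnatEquivNat.hasSum_iff] at h
  convert h using 2 with p
  obtain ⟨k, rfl⟩ : ∃ k : ℕ, p = k.succPNat := ⟨p.natPred, p.succPNat_natPred.symm⟩
  simp [pow_succ]
  ring

/-- The `p`-th term of the series defining `g(z) / v`. -/
noncomputable def fieldTerm (x : ℕ+ → ℝ) (ω : GIdx N → ℝ) (z : Sph N) (p : ℕ+) : ℝ :=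
  (2 : ℝ)⁻¹ ^ (p : ℕ) * x p * gP ω p z

lemma gField_eq (v : ℝ) (x : ℕ+ → ℝ) (ω : GIdx N → ℝ) (z : Sph N) :
    gField v x ω z = v * ∑' p, fieldTerm x ω z p := rfl

lemma tsum_ofReal_two_inv_pow : ∑' p : ℕ+, ENNReal.ofReal ((2 : ℝ)⁻¹ ^ (p : ℕ)) = 1 := by
  rw [← ENNReal.ofReal_tsum_of_nonneg (fun p => by positivity) hasSum_two_inv_pow_pnat.summable,
    hasSum_two_inv_pow_pnat.tsum_eq, ENNReal.ofReal_one]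

/-- Jensen's inequality for the exponential and the weights `2^{-p}`. -/
lemma ofReal_exp_tsum_le {Y : ℕ+ → ℝ} (hY : Summable fun p : ℕ+ => (2 : ℝ)⁻¹ ^ (p : ℕ) * Y p) :
    ENNReal.ofReal (Real.exp (∑' p : ℕ+, (2 : ℝ)⁻¹ ^ (p : ℕ) * Y p))
      ≤ ∑' p : ℕ+, ENNReal.ofReal ((2 : ℝ)⁻¹ ^ (p : ℕ)) * ENNReal.ofReal (Real.exp (Y p)) := by
  set m := ∑' p : ℕ+, (2 : ℝ)⁻¹ ^ (p : ℕ) * Y p with hm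
  have hmul : ∀ p : ℕ+, ENNReal.ofReal ((2 : ℝ)⁻¹ ^ (p : ℕ)) * ENNReal.ofReal (Real.exp (Y p))
      = ENNReal.ofReal ((2 : ℝ)⁻¹ ^ (p : ℕ) * Real.exp (Y p)) := fun p =>
    (ENNReal.ofReal_mul (by positivity)).symm
  simp_rw [hmul]
  by_cases htop : ∑' p : ℕ+, ENNReal.ofReal ((2 : ℝ)⁻¹ ^ (p : ℕ) * Real.exp (Y p)) = ⊤
  · rw [htop]; exact le_top
  have hs : Summable fun p : ℕ+ => (2 : ℝ)⁻¹ ^ (p : ℕ) * Real.exp (Y p) := by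
    refine (ENNReal.summable_toReal htop).congr fun p => ?_
    rw [ENNReal.toReal_ofReal (by positivity)]
  rw [← ENNReal.ofReal_tsum_of_nonneg (fun p => by positivity) hs]
  refine ENNReal.ofReal_le_ofReal ?_
  -- sum the tangent line inequality `exp (Y p) ≥ exp m * (1 + Y p - m)` at the barycentre `m`
  have h1 : HasSum (fun p : ℕ+ => Real.exp m * ((1 - m) * (2 : ℝ)⁻¹ ^ (p : ℕ)
      + (2 : ℝ)⁻¹ ^ (p : ℕ) * Y p)) (Real.exp m * ((1 - m) * 1 + m)) :=
    ((hasSum_two_inv_pow_pnat.mul_left (1 - m)).add hY.hasSum).mul_left (Real.exp m)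
  have h2 := hasSum_le (fun p : ℕ+ => ?_) h1 hs.hasSum
  · linarith [h2, show Real.exp m * ((1 - m) * 1 + m) = Real.exp m by ring]
  · have h3 := Real.add_one_le_exp (Y p - m)
    have h4 : Real.exp (Y p) = Real.exp m * Real.exp (Y p - m) := by
      rw [← Real.exp_add]; congr 1; ring
    rw [h4]
    have h5 : (0 : ℝ) ≤ (2 : ℝ)⁻¹ ^ (p : ℕ) * Real.exp m := by positivity
    nlinarith [mul_le_mul_of_nonneg_left h3 h5]

/-- An exponential moment of the field is controlled by those of the `g_p`, uniformly in `p`. -/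
lemma ofReal_exp_abs_gField_le {v a b : ℝ} (hv : 0 ≤ v) (ha : 0 ≤ a) {x : ℕ+ → ℝ}
    (hx : ∀ q, |x q| ≤ b) (ω : GIdx N → ℝ) (z : Sph N) :
    ENNReal.ofReal (Real.exp (a * |gField v x ω z|))
      ≤ ∑' p : ℕ+, ENNReal.ofReal ((2 : ℝ)⁻¹ ^ (p : ℕ))
          * ENNReal.ofReal (Real.exp (a * v * b * |gP ω p z|)) := by
  have hb : 0 ≤ b := (abs_nonneg _).trans (hx 1)
  have hterm : ∀ p, a * v * |fieldTerm x ω z p|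
      = (2 : ℝ)⁻¹ ^ (p : ℕ) * (a * v * |x p| * |gP ω p z|) := by
    intro p
    rw [fieldTerm, abs_mul, abs_mul, abs_of_nonneg (a := (2 : ℝ)⁻¹ ^ (p : ℕ)) (by positivity)]
    ring
  have hle : ∀ p, a * v * |x p| * |gP ω p z| ≤ a * v * b * |gP ω p z| := fun p => by
    gcongr; exact hx p
  by_cases hs : Summable (fieldTerm x ω z)
  · have hs' : Summable fun p : ℕ+ => (2 : ℝ)⁻¹ ^ (p : ℕ) * (a * v * |x p| * |gP ω p z|) :=
      (hs.abs.mul_left (a * v)).congr hterm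
    have h1 : a * |gField v x ω z|
        ≤ ∑' p : ℕ+, (2 : ℝ)⁻¹ ^ (p : ℕ) * (a * v * |x p| * |gP ω p z|) := by
      rw [gField_eq, abs_mul, abs_of_nonneg hv, ← mul_assoc]
      simp_rw [← hterm]
      rw [tsum_mul_left]
      have h2 := norm_tsum_le_tsum_norm (f := fieldTerm x ω z) hs.norm
      exact mul_le_mul_of_nonneg_left (by simpa using h2) (mul_nonneg ha hv)
    refine (ENNReal.ofReal_le_ofReal (Real.exp_le_exp.2 h1)).trans
      ((ofReal_exp_tsum_le hs').trans (ENNReal.tsum_le_tsum fun p => ?_))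
    gcongr ENNReal.ofReal _ * ENNReal.ofReal (Real.exp ?_)
    exact hle p
  -- where the series diverges, the field is `0` and the right-hand side is at least `1`
  · rw [gField_eq, tsum_eq_zero_of_not_summable hs, mul_zero, abs_zero, mul_zero, Real.exp_zero,
      ENNReal.ofReal_one]
    calc (1 : ℝ≥0∞) = ∑' p : ℕ+, ENNReal.ofReal ((2 : ℝ)⁻¹ ^ (p : ℕ)) * 1 := by
          simp_rw [mul_one]; exact tsum_ofReal_two_inv_pow.symm
      _ ≤ _ := ENNReal.tsum_le_tsum fun p => by
          gcongr
          rw [← ENNReal.ofReal_one]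
          exact ENNReal.ofReal_le_ofReal (Real.one_le_exp (by positivity))

lemma measurable_gP_left (p : ℕ+) (z : Sph N) : Measurable fun ω : GIdx N → ℝ => gP ω p z :=
  (measurable_gP p).comp (measurable_id.prodMk measurable_const)

lemma lintegral_exp_abs_gField_le {v a b : ℝ} (hv : 0 ≤ v) (ha : 0 ≤ a) {x : ℕ+ → ℝ}
    (hx : ∀ q, |x q| ≤ b) (z : Sph N) :
    ∫⁻ ω, ENNReal.ofReal (Real.exp (a * |gField v x ω z|)) ∂lawG N
      ≤ 2 * ENNReal.ofReal (Real.exp ((a * v * b) ^ 2 / 2)) := by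
  refine (lintegral_mono fun ω => ofReal_exp_abs_gField_le hv ha hx ω z).trans ?_
  have hm : ∀ p : ℕ+, Measurable fun ω : GIdx N → ℝ => gP ω p z := fun p => measurable_gP_left p z
  rw [lintegral_tsum fun p => by fun_prop]
  calc ∑' p : ℕ+, ∫⁻ ω, ENNReal.ofReal ((2 : ℝ)⁻¹ ^ (p : ℕ))
          * ENNReal.ofReal (Real.exp (a * v * b * |gP ω p z|)) ∂lawG N
      ≤ ∑' p : ℕ+, ENNReal.ofReal ((2 : ℝ)⁻¹ ^ (p : ℕ))
          * (2 * ENNReal.ofReal (Real.exp ((a * v * b) ^ 2 / 2))) :=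
        ENNReal.tsum_le_tsum fun p => by
          rw [lintegral_const_mul _ (by fun_prop)]
          gcongr
          exact lintegral_exp_abs_gP_le p z _
    _ = _ := by rw [ENNReal.tsum_mul_right, tsum_ofReal_two_inv_pow, one_mul]

lemma lintegral_tsum_abs_fieldTerm_le {b : ℝ} {x : ℕ+ → ℝ} (hx : ∀ q, |x q| ≤ b) (z : Sph N) :
    ∫⁻ ω, ∑' p, ENNReal.ofReal |fieldTerm x ω z p| ∂lawG N ≤ ENNReal.ofReal b * 4 := by
  have hm : ∀ p : ℕ+, Measurable fun ω : GIdx N → ℝ => gP ω p z := fun p => measurable_gP_left p z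
  rw [lintegral_tsum fun p => by unfold fieldTerm; fun_prop]
  calc ∑' p : ℕ+, ∫⁻ ω, ENNReal.ofReal |fieldTerm x ω z p| ∂lawG N
      ≤ ∑' p : ℕ+, ENNReal.ofReal ((2 : ℝ)⁻¹ ^ (p : ℕ)) * (ENNReal.ofReal b * 4) :=
        ENNReal.tsum_le_tsum fun p => by
          calc ∫⁻ ω, ENNReal.ofReal |fieldTerm x ω z p| ∂lawG N
              ≤ ∫⁻ ω, ENNReal.ofReal ((2 : ℝ)⁻¹ ^ (p : ℕ)) * (ENNReal.ofReal b
                  * ENNReal.ofReal |gP ω p z|) ∂lawG N := by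
                refine lintegral_mono fun ω => ?_
                rw [fieldTerm, abs_mul, abs_mul, mul_assoc, ENNReal.ofReal_mul (abs_nonneg _),
                  ENNReal.ofReal_mul (abs_nonneg _),
                  abs_of_nonneg (a := (2 : ℝ)⁻¹ ^ (p : ℕ)) (by positivity)]
                gcongr
                exact hx p
            _ ≤ _ := by
                rw [lintegral_const_mul _ (by fun_prop), lintegral_const_mul _ (by fun_prop)]
                gcongr
                exact lintegral_abs_gP_le p z
    _ = _ := by rw [ENNReal.tsum_mul_right, tsum_ofReal_two_inv_pow, one_mul]

lemma ofReal_abs_gField_le {v : ℝ} (hv : 0 ≤ v) (x : ℕ+ → ℝ) (ω : GIdx N → ℝ) (z : Sph N) :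
    ENNReal.ofReal |gField v x ω z|
      ≤ ENNReal.ofReal v * ∑' p, ENNReal.ofReal |fieldTerm x ω z p| := by
  rw [gField_eq, abs_mul, abs_of_nonneg hv, ENNReal.ofReal_mul hv]
  gcongr
  by_cases hs : Summable (fieldTerm x ω z)
  · rw [← ENNReal.ofReal_tsum_of_nonneg (fun p => abs_nonneg _) hs.abs]
    exact ENNReal.ofReal_le_ofReal
      (by simpa using norm_tsum_le_tsum_norm (f := fieldTerm x ω z) hs.norm)
  · rw [tsum_eq_zero_of_not_summable hs]; simp

lemma lintegral_abs_gField_le {v b : ℝ} (hv : 0 ≤ v) {x : ℕ+ → ℝ} (hx : ∀ q, |x q| ≤ b)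
    (z : Sph N) :
    ∫⁻ ω, ENNReal.ofReal |gField v x ω z| ∂lawG N ≤ ENNReal.ofReal (4 * v * b) := by
  have hm : ∀ p : ℕ+, Measurable fun ω : GIdx N → ℝ => gP ω p z := fun p => measurable_gP_left p z
  refine (lintegral_mono fun ω => ofReal_abs_gField_le hv x ω z).trans ?_
  rw [lintegral_const_mul _ (Measurable.tsum fun p => by
    unfold fieldTerm; fun_prop)]
  refine (mul_le_mul_right (lintegral_tsum_abs_fieldTerm_le hx z) _).trans_eq ?_
  rw [mul_assoc, mul_comm (4 : ℝ), mul_assoc, ENNReal.ofReal_mul hv,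
    ENNReal.ofReal_mul ((abs_nonneg _).trans (hx 1)), ENNReal.ofReal_ofNat]

end Moments

/-! ### Almost sure regularity of the Gibbs measure -/

section Regular

variable {N : ℕ}

/-- The realizations `(x, ω)` of the disorder for which the series defining the field converges at
`ν`-almost every point of the sphere, and the field and its exponential are `ν`-integrable. -/
structure Regular (ν : Measure (Sph N)) (v : ℝ) (x : ℕ+ → ℝ) (ω : GIdx N → ℝ) : Prop where
  summable : ∀ᵐ z ∂ν, Summable (fieldTerm x ω z)
  integrable_exp : Integrable (fun z => Real.exp (gField v x ω z)) ν
  integrable : Integrable (gField v x ω) ν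

lemma measurable_gField_right (v : ℝ) (x : ℕ+ → ℝ) (ω : GIdx N → ℝ) :
    Measurable (gField v x ω) :=
  (measurable_gField v).comp ((measurable_const (a := (x, ω))).prodMk measurable_id)

lemma measurable_gField_uncurry (v : ℝ) (x : ℕ+ → ℝ) :
    Measurable fun q : (GIdx N → ℝ) × Sph N => gField v x q.1 q.2 :=
  (measurable_gField v).comp ((measurable_const.prodMk measurable_fst).prodMk measurable_snd)

lemma lintegral_lintegral_exp_abs_gField_le (ν : Measure (Sph N)) [IsProbabilityMeasure ν]
    {v a b : ℝ} (hv : 0 ≤ v) (ha : 0 ≤ a) {x : ℕ+ → ℝ} (hx : ∀ q, |x q| ≤ b) :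
    ∫⁻ ω, ∫⁻ z, ENNReal.ofReal (Real.exp (a * |gField v x ω z|)) ∂ν ∂lawG N
      ≤ 2 * ENNReal.ofReal (Real.exp ((a * v * b) ^ 2 / 2)) := by
  have hm := measurable_gField_uncurry (N := N) v x
  rw [lintegral_lintegral_swap (Measurable.aemeasurable (by fun_prop))]
  refine (lintegral_mono fun z => lintegral_exp_abs_gField_le hv ha hx z).trans_eq ?_
  simp

lemma ae_regular (ν : Measure (Sph N)) [IsProbabilityMeasure ν] {v b : ℝ} (hv : 0 ≤ v)
    {x : ℕ+ → ℝ} (hx : ∀ q, |x q| ≤ b) : ∀ᵐ ω ∂lawG N, Regular ν v x ω := by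
  have hm := measurable_gField_uncurry (N := N) v x
  have hm' : ∀ p, Measurable fun q : (GIdx N → ℝ) × Sph N => gP q.1 p q.2 := measurable_gP
  have h1 : ∀ᵐ ω ∂lawG N,
      ∫⁻ z, ENNReal.ofReal (Real.exp (1 * |gField v x ω z|)) ∂ν < ⊤ := by
    refine ae_lt_top ?_ ((lintegral_lintegral_exp_abs_gField_le ν hv zero_le_one hx).trans_lt
      (ENNReal.mul_lt_top (by simp) ENNReal.ofReal_lt_top)).ne
    have : Measurable fun q : (GIdx N → ℝ) × Sph N =>
      ENNReal.ofReal (Real.exp (1 * |gField v x q.1 q.2|)) := by fun_prop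
    exact this.lintegral_prod_right
  have hmt : Measurable fun q : (GIdx N → ℝ) × Sph N =>
      ∑' p, ENNReal.ofReal |fieldTerm x q.1 q.2 p| :=
    Measurable.tsum fun p => by unfold fieldTerm; fun_prop
  have h2 : ∀ᵐ ω ∂lawG N, ∫⁻ z, ∑' p, ENNReal.ofReal |fieldTerm x ω z p| ∂ν < ⊤ := by
    refine ae_lt_top hmt.lintegral_prod_right ?_
    rw [lintegral_lintegral_swap hmt.aemeasurable]
    refine ((lintegral_mono fun z => lintegral_tsum_abs_fieldTerm_le hx z).trans_lt ?_).ne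
    simp [ENNReal.mul_lt_top]
  filter_upwards [h1, h2] with ω h1 h2
  have hg := measurable_gField_right v x ω
  have he : Integrable (fun z => Real.exp |gField v x ω z|) ν := by
    refine ⟨by fun_prop, ?_⟩
    rw [hasFiniteIntegral_iff_ofReal (ae_of_all _ fun _ => (Real.exp_pos _).le)]
    simpa using h1
  refine ⟨?_, ?_, ?_⟩
  · refine (ae_lt_top (hmt.comp (measurable_const.prodMk measurable_id)) h2.ne).mono fun z hz => ?_
    refine Summable.of_abs ((ENNReal.summable_toReal hz.ne).congr fun p => ?_)
    exact ENNReal.toReal_ofReal (abs_nonneg _)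
  · refine he.mono' (by fun_prop) (ae_of_all _ fun z => ?_)
    rw [Real.norm_eq_abs, Real.abs_exp]
    exact Real.exp_le_exp.2 (le_abs_self _)
  · refine he.mono' hg.aestronglyMeasurable (ae_of_all _ fun z => ?_)
    rw [Real.norm_eq_abs]
    linarith [Real.add_one_le_exp |gField v x ω z|]

/-- The free energy `log ∫ e^g dν`. -/
noncomputable def logZ (ν : Measure (Sph N)) (v : ℝ) (x : ℕ+ → ℝ) (ω : GIdx N → ℝ) : ℝ :=
  Real.log (∫ z, Real.exp (gField v x ω z) ∂ν)

namespace Regular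

variable {ν : Measure (Sph N)} [IsProbabilityMeasure ν] {v : ℝ} {x : ℕ+ → ℝ} {ω : GIdx N → ℝ}

lemma isProbabilityMeasure_gibbs (h : Regular ν v x ω) : IsProbabilityMeasure (gibbs ν v x ω) :=
  isProbabilityMeasure_tilted h.integrable_exp

lemma integral_exp_gField_pos (h : Regular ν v x ω) : 0 < ∫ z, Real.exp (gField v x ω z) ∂ν :=
  integral_exp_pos h.integrable_exp

/-- Adding a bounded function to the field tilts the Gibbs measure. -/
lemma perturb (h : Regular ν v x ω) {x' : ℕ+ → ℝ} {ω' : GIdx N → ℝ} {H : Sph N → ℝ}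
    (hH : Measurable H) {B : ℝ} (hB : ∀ z, |H z| ≤ B)
    (hs : ∀ z, Summable (fieldTerm x ω z) →
      Summable (fieldTerm x' ω' z) ∧ gField v x' ω' z = gField v x ω z + H z) :
    Regular ν v x' ω' ∧ gibbs ν v x' ω' = (gibbs ν v x ω).tilted H := by
  have hae : gField v x' ω' =ᵐ[ν] gField v x ω + H := h.summable.mono fun z hz => (hs z hz).2
  have hg := measurable_gField_right v x ω
  refine ⟨⟨h.summable.mono fun z hz => (hs z hz).1, ?_, ?_⟩, ?_⟩
  · have : Integrable (fun z => Real.exp (gField v x ω z) * Real.exp (H z)) ν := by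
      refine h.integrable_exp.mul_bdd (c := Real.exp B) (by fun_prop) (ae_of_all _ fun z => ?_)
      rw [Real.norm_eq_abs, Real.abs_exp]
      exact Real.exp_le_exp.2 ((le_abs_self _).trans (hB z))
    refine this.congr (hae.mono fun z hz => ?_)
    simp only [hz, Pi.add_apply, Real.exp_add]
  · exact (h.integrable.add (integrable_of_abs_le hH hB)).congr hae.symm
  · unfold gibbs
    rw [tilted_tilted h.integrable_exp, tilted_congr hae]

end Regular

lemma gField_update_left {v t : ℝ} {x : ℕ+ → ℝ} {ω : GIdx N → ℝ} {z : Sph N} (p : ℕ+)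
    (hs : Summable (fieldTerm x ω z)) :
    Summable (fieldTerm (Function.update x p t) ω z) ∧
      gField v (Function.update x p t) ω z
        = gField v x ω z + v * (2 : ℝ)⁻¹ ^ (p : ℕ) * (t - x p) * gP ω p z := by
  have he : fieldTerm (Function.update x p t) ω z
      = Function.update (fieldTerm x ω z) p ((2 : ℝ)⁻¹ ^ (p : ℕ) * t * gP ω p z) := by
    ext q
    by_cases hq : q = p
    · subst hq; simp [fieldTerm]
    · simp [fieldTerm, Function.update_of_ne hq]
  have h := hs.hasSum.update p ((2 : ℝ)⁻¹ ^ (p : ℕ) * t * gP ω p z)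
  rw [← he] at h
  refine ⟨h.summable, ?_⟩
  rw [gField_eq, h.tsum_eq, gField_eq, fieldTerm]
  ring

lemma gP_update_self (ω : GIdx N → ℝ) (p : ℕ+) (i : Fin (p : ℕ) → Fin N) (y : ℝ) (z : Sph N) :
    gP (Function.update ω ⟨p, i⟩ y) p z = gP ω p z + (y - ω ⟨p, i⟩) * mono i z := by
  rw [gP_eq, gP_eq, ← Finset.add_sum_erase _ _ (Finset.mem_univ i),
    ← Finset.add_sum_erase _ (fun j => ω ⟨p, j⟩ * mono j z) (Finset.mem_univ i)]
  rw [Finset.sum_congr rfl fun j hj => by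
    rw [Function.update_of_ne (by simpa using Finset.ne_of_mem_erase hj)]]
  simp
  ring

lemma gP_update_of_ne (ω : GIdx N → ℝ) {p q : ℕ+} (h : q ≠ p) (i : Fin (p : ℕ) → Fin N) (y : ℝ)
    (z : Sph N) : gP (Function.update ω ⟨p, i⟩ y) q z = gP ω q z := by
  rw [gP_eq, gP_eq]
  refine Finset.sum_congr rfl fun j _ => ?_
  rw [Function.update_of_ne fun e => h (congrArg Sigma.fst e)]

lemma gField_update_right {v y : ℝ} {x : ℕ+ → ℝ} {ω : GIdx N → ℝ} {z : Sph N} (p : ℕ+)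
    (i : Fin (p : ℕ) → Fin N) (hs : Summable (fieldTerm x ω z)) :
    Summable (fieldTerm x (Function.update ω ⟨p, i⟩ y) z) ∧
      gField v x (Function.update ω ⟨p, i⟩ y) z
        = gField v x ω z + v * (2 : ℝ)⁻¹ ^ (p : ℕ) * x p * (y - ω ⟨p, i⟩) * mono i z := by
  have he : fieldTerm x (Function.update ω ⟨p, i⟩ y) z
      = Function.update (fieldTerm x ω z) p
        ((2 : ℝ)⁻¹ ^ (p : ℕ) * x p * (gP ω p z + (y - ω ⟨p, i⟩) * mono i z)) := by
    ext q
    by_cases hq : q = p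
    · subst hq; simp [fieldTerm, gP_update_self]
    · simp [fieldTerm, Function.update_of_ne hq, gP_update_of_ne ω hq]
  have h := hs.hasSum.update p
    ((2 : ℝ)⁻¹ ^ (p : ℕ) * x p * (gP ω p z + (y - ω ⟨p, i⟩) * mono i z))
  rw [← he] at h
  refine ⟨h.summable, ?_⟩
  rw [gField_eq, h.tsum_eq, gField_eq, fieldTerm]
  ring

namespace Regular

variable {ν : Measure (Sph N)} [IsProbabilityMeasure ν] {v : ℝ} {x : ℕ+ → ℝ} {ω : GIdx N → ℝ}

lemma measurable_gP_const (ω : GIdx N → ℝ) (p : ℕ+) : Measurable (gP ω p) :=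
  (measurable_gP p).comp (measurable_const.prodMk measurable_id)

lemma update_left (h : Regular ν v x ω) (p : ℕ+) (t : ℝ) :
    Regular ν v (Function.update x p t) ω ∧
      gibbs ν v (Function.update x p t) ω = (gibbs ν v x ω).tilted
        fun z => v * (2 : ℝ)⁻¹ ^ (p : ℕ) * (t - x p) * gP ω p z := by
  refine h.perturb ((measurable_gP_const ω p).const_mul _)
    (B := |v * (2 : ℝ)⁻¹ ^ (p : ℕ) * (t - x p)| * ∑ i : Fin (p : ℕ) → Fin N, |ω ⟨p, i⟩|)
    (fun z => ?_) fun z hz => gField_update_left p hz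
  rw [abs_mul]
  exact mul_le_mul_of_nonneg_left (abs_gP_le ω p z) (abs_nonneg _)

lemma update_right (h : Regular ν v x ω) (p : ℕ+) (i : Fin (p : ℕ) → Fin N) (y : ℝ) :
    Regular ν v x (Function.update ω ⟨p, i⟩ y) ∧
      gibbs ν v x (Function.update ω ⟨p, i⟩ y) = (gibbs ν v x ω).tilted
        fun z => v * (2 : ℝ)⁻¹ ^ (p : ℕ) * x p * (y - ω ⟨p, i⟩) * mono i z := by
  refine h.perturb ((measurable_mono i).const_mul _)
    (B := |v * (2 : ℝ)⁻¹ ^ (p : ℕ) * x p * (y - ω ⟨p, i⟩)| * 1)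
    (fun z => ?_) fun z hz => gField_update_right p i hz
  rw [abs_mul]
  exact mul_le_mul_of_nonneg_left (abs_mono_le_one i z) (abs_nonneg _)

/-- The free energy is convex: its increments dominate the averaged increments of the field. -/
lemma integral_sub_le_logZ_sub (h : Regular ν v x ω) {x' : ℕ+ → ℝ} {ω' : GIdx N → ℝ}
    (h' : Regular ν v x' ω')
    (hi : Integrable (fun z => gField v x' ω' z - gField v x ω z) (gibbs ν v x ω)) :
    ∫ z, (gField v x' ω' z - gField v x ω z) ∂gibbs ν v x ω ≤ logZ ν v x' ω' - logZ ν v x ω := by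
  have := h.isProbabilityMeasure_gibbs
  have e : ∀ z, Real.exp (gField v x ω z) * Real.exp (gField v x' ω' z - gField v x ω z)
      = Real.exp (gField v x' ω' z) := fun z => by rw [← Real.exp_add]; congr 1; ring
  refine (integral_le_log_integral_exp hi ?_).trans_eq ?_
  · rw [gibbs, integrable_tilted_iff h.integrable_exp]
    simp_rw [smul_eq_mul, e]
    exact h'.integrable_exp
  · rw [gibbs, integral_exp_tilted, Real.log_div ?_ h.integral_exp_gField_pos.ne']
    · simp [logZ]
    · simpa using h'.integral_exp_gField_pos.ne'

end Regular

end Regular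

/-! ### Averages over replicas -/

section Replicas

variable {E : Type*} [MeasurableSpace E]

lemma integral_pi_eval {ι : Type*} [Fintype ι] (G : Measure E) [IsProbabilityMeasure G]
    (l : ι) {k : E → ℝ} (hk : Measurable k) :
    ∫ z, k (z l) ∂(Measure.pi fun _ : ι => G) = ∫ z, k z ∂G := by
  conv_rhs => rw [← (measurePreserving_eval (fun _ : ι => G) l).map_eq]
  rw [integral_map (measurable_pi_apply l).aemeasurable hk.aestronglyMeasurable]

/-- A replica not involved in `f` is independent of it. -/
lemma integral_pi_castSucc_mul_last (G : Measure E) [IsProbabilityMeasure G] (n : ℕ)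
    (f : (Fin n → E) → ℝ) (k : E → ℝ) :
    ∫ z, f (fun i => z i.castSucc) * k (z (Fin.last n)) ∂(Measure.pi fun _ : Fin (n + 1) => G)
      = (∫ z, f z ∂(Measure.pi fun _ : Fin n => G)) * ∫ z, k z ∂G := by
  have h := measurePreserving_piFinSuccAbove (fun _ : Fin (n + 1) => G) (Fin.last n)
  rw [mul_comm, ← integral_prod_mul k f, ← h.integral_comp']
  refine integral_congr_ae (ae_of_all _ fun z => ?_)
  simp only [MeasurableEquiv.piFinSuccAbove_apply, Fin.insertNthEquiv_symm_apply, mul_comm]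
  congr 2
  ext i
  simp [Fin.removeNth]

variable {N : ℕ}

lemma pi_gibbs (ν : Measure (Sph N)) [IsProbabilityMeasure ν] (v : ℝ) (x : ℕ+ → ℝ)
    (ω : GIdx N → ℝ) (m : ℕ) :
    (Measure.pi fun _ : Fin m => gibbs ν v x ω)
      = (Measure.pi fun _ : Fin m => ν).tilted fun z => ∑ l, gField v x ω (z l) :=
  pi_tilted ν _ (measurable_gField_right v x ω)

lemma stronglyMeasurable_gibbs (ν : Measure (Sph N)) [IsProbabilityMeasure ν] (v : ℝ)
    {Θ : Type*} [MeasurableSpace Θ] {X : Θ → ℕ+ → ℝ} {W : Θ → GIdx N → ℝ} (hX : Measurable X)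
    (hW : Measurable W) {F : Θ → Sph N → ℝ} (hF : Measurable (Function.uncurry F)) :
    StronglyMeasurable fun θ => ∫ z, F θ z ∂gibbs ν v (X θ) (W θ) := by
  refine stronglyMeasurable_integral_tilted ν ?_ hF
  exact (measurable_gField v).comp
    (((hX.comp measurable_fst).prodMk (hW.comp measurable_fst)).prodMk
    measurable_snd)

lemma measurable_lintegral_gibbs (ν : Measure (Sph N)) [IsProbabilityMeasure ν] (v : ℝ)
    {Θ : Type*} [MeasurableSpace Θ] {X : Θ → ℕ+ → ℝ} {W : Θ → GIdx N → ℝ} (hX : Measurable X)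
    (hW : Measurable W) {F : Θ → Sph N → ℝ≥0∞} (hF : Measurable (Function.uncurry F)) :
    Measurable fun θ => ∫⁻ z, F θ z ∂gibbs ν v (X θ) (W θ) := by
  refine measurable_lintegral_tilted ν ?_ hF
  exact (measurable_gField v).comp
    (((hX.comp measurable_fst).prodMk (hW.comp measurable_fst)).prodMk
    measurable_snd)

lemma stronglyMeasurable_replicas (ν : Measure (Sph N)) [IsProbabilityMeasure ν] (v : ℝ)
    {Θ : Type*} [MeasurableSpace Θ] {X : Θ → ℕ+ → ℝ} {W : Θ → GIdx N → ℝ} (hX : Measurable X)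
    (hW : Measurable W) {m : ℕ} {F : Θ → (Fin m → Sph N) → ℝ}
    (hF : Measurable (Function.uncurry F)) :
    StronglyMeasurable fun θ =>
      ∫ z, F θ z ∂(Measure.pi fun _ : Fin m => gibbs ν v (X θ) (W θ)) := by
  simp_rw [pi_gibbs]
  refine stronglyMeasurable_integral_tilted _ ?_ hF
  refine Finset.measurable_sum _ fun l _ => ?_
  exact (measurable_gField v).comp
    (((hX.comp measurable_fst).prodMk (hW.comp measurable_fst)).prodMk
    ((measurable_pi_apply l).comp measurable_snd))

/-- `⟨F⟩`: the average of a function of `m` replicas under the Gibbs measure. -/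
noncomputable def repAvg (ν : Measure (Sph N)) (v : ℝ) (x : ℕ+ → ℝ) (ω : GIdx N → ℝ) {m : ℕ}
    (F : (Fin m → Sph N) → ℝ) : ℝ :=
  ∫ z, F z ∂(Measure.pi fun _ : Fin m => gibbs ν v x ω)

lemma gAvg_eq (ν : Measure (Sph N)) (v : ℝ) (x : ℕ+ → ℝ) {m : ℕ} (F : (Fin m → Sph N) → ℝ) :
    gAvg ν v x F = ∫ ω, repAvg ν v x ω F ∂lawG N := rfl

lemma measurable_repAvg (ν : Measure (Sph N)) [IsProbabilityMeasure ν] (v : ℝ) (x : ℕ+ → ℝ)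
    {m : ℕ} {F : (Fin m → Sph N) → ℝ} (hF : Measurable F) :
    Measurable fun ω => repAvg ν v x ω F :=
  (stronglyMeasurable_replicas ν v measurable_const measurable_id (F := fun _ => F)
    (hF.comp measurable_snd)).measurable

/-- The Gibbs measure is either a probability measure or zero. -/
lemma gibbs_univ_le_one (ν : Measure (Sph N)) [IsProbabilityMeasure ν] (v : ℝ) (x : ℕ+ → ℝ)
    (ω : GIdx N → ℝ) : gibbs ν v x ω Set.univ ≤ 1 := by
  by_cases h : Integrable (fun z => Real.exp (gField v x ω z)) ν
  · have : IsProbabilityMeasure (gibbs ν v x ω) := isProbabilityMeasure_tilted h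
    exact prob_le_one
  · simp [gibbs, tilted_of_not_integrable h]

instance (ν : Measure (Sph N)) [IsProbabilityMeasure ν] (v : ℝ) (x : ℕ+ → ℝ)
    (ω : GIdx N → ℝ) : IsFiniteMeasure (gibbs ν v x ω) :=
  ⟨(gibbs_univ_le_one ν v x ω).trans_lt ENNReal.one_lt_top⟩

lemma abs_repAvg_le (ν : Measure (Sph N)) [IsProbabilityMeasure ν] (v : ℝ) (x : ℕ+ → ℝ)
    (ω : GIdx N → ℝ) {m : ℕ} {F : (Fin m → Sph N) → ℝ} {A : ℝ} (hA0 : 0 ≤ A)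
    (hA : ∀ z, |F z| ≤ A) : |repAvg ν v x ω F| ≤ A := by
  have h1 := norm_integral_le_of_norm_le_const (μ := Measure.pi fun _ : Fin m => gibbs ν v x ω)
    (f := F) (C := A) (ae_of_all _ fun z => (Real.norm_eq_abs _).trans_le (hA z))
  refine h1.trans (mul_le_of_le_one_right hA0 ?_)
  rw [measureReal_def, Measure.pi_univ]
  refine ENNReal.toReal_le_of_le_ofReal zero_le_one ?_
  rw [ENNReal.ofReal_one]
  exact Finset.prod_le_one' fun _ _ => gibbs_univ_le_one ν v x ω

lemma repAvg_sum (ν : Measure (Sph N)) [IsProbabilityMeasure ν] (v : ℝ) (x : ℕ+ → ℝ)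
    (ω : GIdx N → ℝ) {m : ℕ} {ι : Type*} (s : Finset ι) {F : ι → (Fin m → Sph N) → ℝ}
    (hF : ∀ i, Measurable (F i)) {A : ℝ} (hA : ∀ i z, |F i z| ≤ A) :
    repAvg ν v x ω (fun z => ∑ i ∈ s, F i z) = ∑ i ∈ s, repAvg ν v x ω (F i) :=
  integral_finsetSum _ fun i _ => integrable_of_abs_le (hF i) (hA i)

lemma integrable_repAvg (ν : Measure (Sph N)) [IsProbabilityMeasure ν] (v : ℝ) (x : ℕ+ → ℝ)
    {m : ℕ} {F : (Fin m → Sph N) → ℝ} (hF : Measurable F) {A : ℝ} (hA0 : 0 ≤ A)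
    (hA : ∀ z, |F z| ≤ A) : Integrable (fun ω => repAvg ν v x ω F) (lawG N) :=
  integrable_of_abs_le (measurable_repAvg ν v x hF) fun _ => abs_repAvg_le ν v x _ hA0 hA

end Replicas

/-! ### Integration by parts for the Gibbs measure -/

section IntegrationByParts

variable {N : ℕ}

lemma integrable_coord (j : GIdx N) : Integrable (fun ω : GIdx N → ℝ => ω j) (lawG N) := by
  have hid : Integrable (fun y : ℝ => y) (gaussianReal 0 1) := by
    have := (memLp_id_gaussianReal (μ := 0) (v := 1) 1)
    exact (memLp_one_iff_integrable.1 (by exact_mod_cast this))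
  exact (measurePreserving_eval_infinitePi (fun _ : GIdx N => gaussianReal 0 1)
    j).integrable_comp_of_integrable hid

lemma integral_update (j : GIdx N) {G : (GIdx N → ℝ) → ℝ} (hG : Integrable G (lawG N)) :
    ∫ ω, G ω ∂lawG N
      = ∫ ω, ∫ y, G (Function.update ω j y) ∂gaussianReal 0 1 ∂lawG N := by
  classical
  have hp := measurePreserving_update (fun _ : GIdx N => gaussianReal 0 1) j
  have h1 : ∫ ω, G ω ∂lawG N
      = ∫ q, G (Function.update q.1 j q.2) ∂(lawG N).prod (gaussianReal 0 1) := by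
    have h2 : (lawG N) = ((lawG N).prod (gaussianReal 0 1)).map
      (fun q => Function.update q.1 j q.2) := hp.map_eq.symm
    conv_lhs => rw [h2]
    rw [integral_map hp.measurable.aemeasurable (h2 ▸ hG.aestronglyMeasurable)]
  rw [h1, integral_prod]
  exact hp.integrable_comp_of_integrable hG

lemma abs_sum_mono_le {p : ℕ} (i : Fin p → Fin N) {m : ℕ} (z : Fin m → Sph N) :
    |∑ l, mono i (z l)| ≤ m := by
  refine (Finset.abs_sum_le_sum_abs _ _).trans ?_
  refine (Finset.sum_le_sum fun l _ => abs_mono_le_one i (z l)).trans ?_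
  simp

lemma measurable_sum_mono {p : ℕ} (i : Fin p → Fin N) {m : ℕ} :
    Measurable fun z : Fin m → Sph N => ∑ l, mono i (z l) :=
  Finset.measurable_sum _ fun l _ => (measurable_mono i).comp (measurable_pi_apply l)

lemma integrable_coord_mul_repAvg (ν : Measure (Sph N)) [IsProbabilityMeasure ν] (v : ℝ)
    (x : ℕ+ → ℝ) (j : GIdx N) {m : ℕ} {F : (Fin m → Sph N) → ℝ} (hF : Measurable F) {A : ℝ}
    (hA0 : 0 ≤ A) (hA : ∀ z, |F z| ≤ A) :
    Integrable (fun ω => ω j * repAvg ν v x ω F) (lawG N) :=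
  (integrable_coord j).mul_bdd (c := A) (measurable_repAvg ν v x hF).aestronglyMeasurable
    (ae_of_all _ fun ω => abs_repAvg_le ν v x ω hA0 hA)

/-- Gaussian integration by parts in the coefficient `g_{i_1, …, i_p}`. -/
lemma integral_coord_mul_repAvg (ν : Measure (Sph N)) [IsProbabilityMeasure ν] {v b : ℝ}
    (hv : 0 ≤ v) {x : ℕ+ → ℝ} (hx : ∀ q, |x q| ≤ b) (p : ℕ+) (i : Fin (p : ℕ) → Fin N) {m : ℕ}
    {F : (Fin m → Sph N) → ℝ} (hF : Measurable F) {A : ℝ} (hA0 : 0 ≤ A) (hA : ∀ z, |F z| ≤ A) :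
    ∫ ω, ω ⟨p, i⟩ * repAvg ν v x ω F ∂lawG N
      = ∫ ω, v * (2 : ℝ)⁻¹ ^ (p : ℕ) * x p
          * (repAvg ν v x ω (fun z => F z * ∑ l, mono i (z l))
            - repAvg ν v x ω F * repAvg ν v x ω (fun z : Fin m → Sph N => ∑ l, mono i (z l)))
          ∂lawG N := by
  have hH := measurable_sum_mono i (m := m)
  have hHb := abs_sum_mono_le i (m := m)
  have hFH : ∀ z, |F z * ∑ l, mono i (z l)| ≤ A * m := fun z => by
    rw [abs_mul]; exact mul_le_mul (hA z) (hHb z) (abs_nonneg _) hA0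
  rw [integral_update ⟨p, i⟩ (integrable_coord_mul_repAvg ν v x ⟨p, i⟩ hF hA0 hA),
    integral_update ⟨p, i⟩ (Integrable.const_mul ?_ _)]
  · refine integral_congr_ae ((ae_regular ν hv hx).mono fun ω hω => ?_)
    have hprob := hω.isProbabilityMeasure_gibbs
    have hpi : ∀ y, (Measure.pi fun _ : Fin m => gibbs ν v x (Function.update ω ⟨p, i⟩ y))
        = (Measure.pi fun _ : Fin m => gibbs ν v x ω).tilted
          fun z => v * (2 : ℝ)⁻¹ ^ (p : ℕ) * x p * (y - ω ⟨p, i⟩) * ∑ l, mono i (z l) := by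
      intro y
      rw [(hω.update_right p i y).2, pi_tilted _ _ ((measurable_mono i).const_mul _)]
      simp_rw [Finset.mul_sum]
    simp only [repAvg, hpi, Function.update_self]
    exact integral_id_mul_integral_tilted hF hH hA hHb _ _
  · refine (integrable_repAvg ν v x (hF.mul hH) (by positivity) hFH).sub ?_
    exact (integrable_repAvg ν v x hH (Nat.cast_nonneg m) hHb).bdd_mul (c := A)
      (measurable_repAvg ν v x hF).aestronglyMeasurable
      (ae_of_all _ fun ω => abs_repAvg_le ν v x ω hA0 hA)

lemma repAvg_sum_mono (ν : Measure (Sph N)) [IsProbabilityMeasure ν] {v : ℝ} {x : ℕ+ → ℝ}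
    {ω : GIdx N → ℝ} (h : Regular ν v x ω) {p : ℕ} (i : Fin p → Fin N) (m : ℕ) :
    repAvg ν v x ω (fun z : Fin m → Sph N => ∑ l, mono i (z l))
      = m * ∫ z, mono i z ∂gibbs ν v x ω := by
  have := h.isProbabilityMeasure_gibbs
  have hi : ∀ l : Fin m, Integrable (fun z : Fin m → Sph N => mono i (z l))
      (Measure.pi fun _ : Fin m => gibbs ν v x ω) := fun l =>
    integrable_of_abs_le ((measurable_mono i).comp (measurable_pi_apply l))
      fun z => abs_mono_le_one i (z l)
  simp only [repAvg]
  rw [integral_finsetSum _ fun l _ => hi l]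
  simp_rw [integral_pi_eval _ _ (measurable_mono i)]
  simp

lemma measurable_overlap_comp {m : ℕ} (l l' : Fin m) :
    Measurable fun z : Fin m → Sph N => overlap (z l) (z l') :=
  measurable_overlap.comp (f := fun z : Fin m → Sph N => (z l, z l'))
    ((measurable_pi_apply l).prodMk (measurable_pi_apply l'))

lemma measurable_castSucc {E : Type*} [MeasurableSpace E] (n : ℕ) :
    Measurable fun (z : Fin (n + 1) → E) (i : Fin n) => z i.castSucc :=
  measurable_pi_iff.2 fun _ => measurable_pi_apply _

lemma abs_overlap_pow_le_one (p : ℕ) (z w : Sph N) : |overlap z w ^ p| ≤ 1 := by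
  rw [abs_pow]; exact pow_le_one₀ (abs_nonneg _) (abs_overlap_le_one z w)

/-- Gaussian integration by parts for `E_g ⟨f g_p(z^1)⟩`. -/
lemma integral_repAvg_mul_gP (ν : Measure (Sph N)) [IsProbabilityMeasure ν] {v b : ℝ}
    (hv : 0 ≤ v) {x : ℕ+ → ℝ} (hx : ∀ q, |x q| ≤ b) (p : ℕ+) {n : ℕ} [NeZero n]
    {f : (Fin n → Sph N) → ℝ} (hf : Measurable f) (hf1 : ∀ z, |f z| ≤ 1) :
    ∫ ω, repAvg ν v x ω (fun z => f z * gP ω p (z 0)) ∂lawG N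
      = v * (2 : ℝ)⁻¹ ^ (p : ℕ) * x p
        * ((∑ l, gAvg ν v x (fun z : Fin n → Sph N => f z * overlap (z 0) (z l) ^ (p : ℕ)))
          - n * gAvg ν v x (fun z : Fin (n + 1) → Sph N =>
              f (fun i => z i.castSucc) * overlap (z 0) (z (Fin.last n)) ^ (p : ℕ))) := by
  set c := v * (2 : ℝ)⁻¹ ^ (p : ℕ) * x p with hc
  have hm : ∀ i : Fin (p : ℕ) → Fin N, Measurable fun z : Fin n → Sph N => f z * mono i (z 0) :=
    fun i => hf.mul ((measurable_mono i).comp (measurable_pi_apply 0))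
  have hb : ∀ (i : Fin (p : ℕ) → Fin N) (z : Fin n → Sph N), |f z * mono i (z 0)| ≤ 1 :=
    fun i z => by
      rw [abs_mul]; exact mul_le_one₀ (hf1 z) (abs_nonneg _) (abs_mono_le_one i _)
  have hmo : ∀ l, Measurable fun z : Fin n → Sph N => f z * overlap (z 0) (z l) ^ (p : ℕ) :=
    fun l => hf.mul ((measurable_overlap_comp 0 l).pow_const _)
  have hbo : ∀ l (z : Fin n → Sph N), |f z * overlap (z 0) (z l) ^ (p : ℕ)| ≤ 1 := fun l z => by
    rw [abs_mul]; exact mul_le_one₀ (hf1 z) (abs_nonneg _) (abs_overlap_pow_le_one _ _ _)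
  have hml : Measurable fun z : Fin (n + 1) → Sph N =>
      f (fun i => z i.castSucc) * overlap (z 0) (z (Fin.last n)) ^ (p : ℕ) :=
    (hf.comp (measurable_castSucc n)).mul
      ((measurable_overlap_comp 0 (Fin.last n)).pow_const _)
  have hbl : ∀ z : Fin (n + 1) → Sph N,
      |f (fun i => z i.castSucc) * overlap (z 0) (z (Fin.last n)) ^ (p : ℕ)| ≤ 1 := fun z => by
    rw [abs_mul]; exact mul_le_one₀ (hf1 _) (abs_nonneg _) (abs_overlap_pow_le_one _ _ _)
  have hml3 : ∀ i : Fin (p : ℕ) → Fin N, Measurable fun z : Fin (n + 1) → Sph N =>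
      f (fun i => z i.castSucc) * mono i (z 0) * mono i (z (Fin.last n)) := fun i =>
    ((hf.comp (measurable_castSucc n)).mul ((measurable_mono i).comp (measurable_pi_apply 0))).mul
      ((measurable_mono i).comp (measurable_pi_apply (Fin.last n)))
  have hbl3 : ∀ (i : Fin (p : ℕ) → Fin N) (z : Fin (n + 1) → Sph N),
      |f (fun i => z i.castSucc) * mono i (z 0) * mono i (z (Fin.last n))| ≤ 1 := fun i z => by
    rw [abs_mul, abs_mul]
    exact mul_le_one₀ (mul_le_one₀ (hf1 _) (abs_nonneg _) (abs_mono_le_one i _)) (abs_nonneg _)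
      (abs_mono_le_one i _)
  have e1 : ∀ ω : GIdx N → ℝ, repAvg ν v x ω (fun z => f z * gP ω p (z 0))
      = ∑ i : Fin (p : ℕ) → Fin N, ω ⟨p, i⟩ * repAvg ν v x ω (fun z => f z * mono i (z 0)) := by
    intro ω
    unfold repAvg
    simp_rw [← integral_const_mul]
    rw [← integral_finsetSum _ fun i _ => (integrable_of_abs_le (hm i) (hb i)).const_mul _]
    refine integral_congr_ae (ae_of_all _ fun z => ?_)
    simp only [gP_eq, Finset.mul_sum]
    exact Finset.sum_congr rfl fun i _ => by ring
  simp_rw [e1]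
  rw [integral_finsetSum _ fun i _ => integrable_coord_mul_repAvg ν v x ⟨p, i⟩ (hm i) zero_le_one
    (hb i)]
  simp_rw [integral_coord_mul_repAvg ν hv hx p _ (hm _) zero_le_one (hb _)]
  have hFH : ∀ (i : Fin (p : ℕ) → Fin N) (z : Fin n → Sph N),
      |f z * mono i (z 0) * ∑ l, mono i (z l)| ≤ 1 * n := fun i z => by
    rw [abs_mul]; exact mul_le_mul (hb i z) (abs_sum_mono_le i z) (abs_nonneg _) zero_le_one
  have hint : ∀ i : Fin (p : ℕ) → Fin N, Integrable (fun ω => v * (2 : ℝ)⁻¹ ^ (p : ℕ) * x p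
          * (repAvg ν v x ω (fun z => f z * mono i (z 0) * ∑ l, mono i (z l))
            - repAvg ν v x ω (fun z => f z * mono i (z 0))
              * repAvg ν v x ω (fun z : Fin n → Sph N => ∑ l, mono i (z l)))) (lawG N) := by
    intro i
    refine Integrable.const_mul ?_ _
    refine (integrable_repAvg ν v x ((hm i).mul (measurable_sum_mono i)) (by positivity)
      (hFH i)).sub ?_
    exact (integrable_repAvg ν v x (measurable_sum_mono i) (Nat.cast_nonneg n)
      (abs_sum_mono_le i)).bdd_mul (c := 1) (measurable_repAvg ν v x (hm i)).aestronglyMeasurable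
      (ae_of_all _ fun ω => abs_repAvg_le ν v x ω zero_le_one (hb i))
  rw [← integral_finsetSum _ fun i _ => hint i]
  have e2 : ∀ᵐ ω ∂lawG N, ∑ i : Fin (p : ℕ) → Fin N, c
          * (repAvg ν v x ω (fun z => f z * mono i (z 0) * ∑ l, mono i (z l))
            - repAvg ν v x ω (fun z => f z * mono i (z 0))
              * repAvg ν v x ω (fun z : Fin n → Sph N => ∑ l, mono i (z l)))
      = c * ((∑ l, repAvg ν v x ω (fun z : Fin n → Sph N => f z * overlap (z 0) (z l) ^ (p : ℕ)))
          - n * repAvg ν v x ω (fun z : Fin (n + 1) → Sph N =>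
              f (fun i => z i.castSucc) * overlap (z 0) (z (Fin.last n)) ^ (p : ℕ))) := by
    filter_upwards [ae_regular ν hv hx] with ω hω
    have hprob := hω.isProbabilityMeasure_gibbs
    rw [← Finset.mul_sum, Finset.sum_sub_distrib]
    congr 2
    · rw [← repAvg_sum ν v x ω _ (F := fun (i : Fin (p : ℕ) → Fin N) z =>
          f z * mono i (z 0) * ∑ l, mono i (z l)) (fun i => (hm i).mul (measurable_sum_mono i)) hFH,
        ← repAvg_sum ν v x ω _ hmo hbo]
      congr 1
      ext z
      simp only [← sum_mono_mul_mono, Finset.mul_sum]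
      rw [Finset.sum_comm]
      exact Finset.sum_congr rfl fun l _ => Finset.sum_congr rfl fun i _ => by ring
    · simp_rw [repAvg_sum_mono ν hω]
      -- the product of two replica averages is an average with one more replica
      have e3 : ∀ i : Fin (p : ℕ) → Fin N,
          repAvg ν v x ω (fun z => f z * mono i (z 0)) * (n * ∫ z, mono i z ∂gibbs ν v x ω)
          = n * repAvg ν v x ω (fun z : Fin (n + 1) → Sph N =>
              f (fun i => z i.castSucc) * mono i (z 0) * mono i (z (Fin.last n))) := by
        intro i
        have := integral_pi_castSucc_mul_last (gibbs ν v x ω) n (fun z => f z * mono i (z 0))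
          (mono i)
        simp only [Fin.castSucc_zero'] at this
        unfold repAvg
        rw [this]; ring
      simp_rw [e3]
      rw [← Finset.mul_sum]
      rw [← repAvg_sum ν v x ω _ hml3 hbl3]
      congr 2
      ext z
      simp only [← sum_mono_mul_mono, Finset.mul_sum]
      exact Finset.sum_congr rfl fun i _ => by ring
  rw [integral_congr_ae e2, integral_const_mul, integral_sub, integral_const_mul,
    integral_finsetSum]
  · rfl
  · exact fun l _ => integrable_repAvg ν v x (hmo l) zero_le_one (hbo l)
  · exact integrable_finsetSum _ fun l _ => integrable_repAvg ν v x (hmo l) zero_le_one (hbo l)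
  · exact (integrable_repAvg ν v x hml zero_le_one hbl).const_mul _

lemma integral_gibbs_gP (ν : Measure (Sph N)) [IsProbabilityMeasure ν] {v b : ℝ}
    (hv : 0 ≤ v) {x : ℕ+ → ℝ} (hx : ∀ q, |x q| ≤ b) (p : ℕ+) :
    ∫ ω, ∫ z, gP ω p z ∂gibbs ν v x ω ∂lawG N
      = v * (2 : ℝ)⁻¹ ^ (p : ℕ) * x p
        * (1 - gAvg ν v x (fun z : Fin 2 → Sph N => overlap (z 0) (z 1) ^ (p : ℕ))) := by
  have h := integral_repAvg_mul_gP ν hv hx p (n := 1) (f := fun _ => 1) measurable_const (by simp)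
  have e1 : ∀ᵐ ω ∂lawG N, repAvg ν v x ω (fun z : Fin 1 → Sph N => 1 * gP ω p (z 0))
      = ∫ z, gP ω p z ∂gibbs ν v x ω := by
    filter_upwards [ae_regular ν hv hx] with ω hω
    have := hω.isProbabilityMeasure_gibbs
    simp only [repAvg, one_mul]
    exact integral_pi_eval _ _ (Regular.measurable_gP_const ω p)
  have e2 : gAvg ν v x (fun _ : Fin 1 → Sph N => (1 : ℝ)) = 1 := by
    rw [gAvg_eq, integral_congr_ae (g := fun _ => (1 : ℝ))]
    · simp
    filter_upwards [ae_regular ν hv hx] with ω hω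
    have := hω.isProbabilityMeasure_gibbs
    simp [repAvg]
  rw [integral_congr_ae e1] at h
  rw [h]
  simp only [Fin.sum_univ_one, overlap_self, one_pow, one_mul, e2, Nat.cast_one]
  rfl

/-- The defect in the Ghirlanda–Guerra identity for a monomial is a covariance of `g_p`. -/
lemma mul_ggDefect_pow (ν : Measure (Sph N)) [IsProbabilityMeasure ν] {v b : ℝ}
    (hv : 0 ≤ v) {x : ℕ+ → ℝ} (hx : ∀ q, |x q| ≤ b) (p : ℕ+) {n : ℕ} [NeZero n]
    {f : (Fin n → Sph N) → ℝ} (hf : Measurable f) (hf1 : ∀ z, |f z| ≤ 1) :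
    v * (2 : ℝ)⁻¹ ^ (p : ℕ) * x p * n * ggDefect ν v x n f (fun u => u ^ (p : ℕ))
      = gAvg ν v x f * (∫ ω, ∫ z, gP ω p z ∂gibbs ν v x ω ∂lawG N)
        - ∫ ω, repAvg ν v x ω (fun z => f z * gP ω p (z 0)) ∂lawG N := by
  have hn : (n : ℝ) ≠ 0 := Nat.cast_ne_zero.2 (NeZero.ne n)
  rw [integral_repAvg_mul_gP ν hv hx p hf hf1, integral_gibbs_gP ν hv hx p, ggDefect,
    ← Finset.add_sum_erase Finset.univ (fun l => gAvg ν v x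
      (fun z : Fin n → Sph N => f z * overlap (z 0) (z l) ^ (p : ℕ))) (Finset.mem_univ 0)]
  simp only [overlap_self, one_pow, mul_one]
  field_simp
  ring

end IntegrationByParts

/-! ### Gaussian concentration by rotation -/

section Rotation

/-- The law of a family of independent standard Gaussian variables. -/
noncomputable abbrev gaussianFamily (ι : Type*) : Measure (ι → ℝ) :=
  Measure.infinitePi fun _ => gaussianReal 0 1

/-- The Gaussian family `cos θ * ω + sin θ * ω'` interpolating between two copies. -/
noncomputable def rotFst {ι : Type*} (θ : ℝ) (q : (ι → ℝ) × (ι → ℝ)) : ι → ℝ :=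
  fun i => Real.cos θ * q.1 i + Real.sin θ * q.2 i

lemma rotFst_zero {ι : Type*} (q : (ι → ℝ) × (ι → ℝ)) : rotFst 0 q = q.1 := by
  ext i; simp [rotFst]

lemma rotFst_pi_div_two {ι : Type*} (q : (ι → ℝ) × (ι → ℝ)) : rotFst (Real.pi / 2) q = q.2 := by
  ext i; simp [rotFst]

lemma measurePreserving_rotFst {ι : Type*} (θ : ℝ) :
    MeasurePreserving (rotFst (ι := ι) θ) ((gaussianFamily ι).prod (gaussianFamily ι))
      (gaussianFamily ι) :=
  measurePreserving_fst.comp (measurePreserving_rotation (ι := ι) θ)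

/-- The mean displacement of a function under a rotation is subadditive in the angle, since a
rotation preserves the joint law of the two copies. -/
lemma integral_abs_rotFst_add_le {ι : Type*} {Φ : (ι → ℝ) → ℝ}
    (hΦ : Integrable Φ (gaussianFamily ι)) (α β : ℝ) :
    ∫ q, |Φ (rotFst (α + β) q) - Φ q.1| ∂(gaussianFamily ι).prod (gaussianFamily ι)
      ≤ (∫ q, |Φ (rotFst α q) - Φ q.1| ∂(gaussianFamily ι).prod (gaussianFamily ι))
        + ∫ q, |Φ (rotFst β q) - Φ q.1| ∂(gaussianFamily ι).prod (gaussianFamily ι) := by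
  have hr := measurePreserving_rotation (ι := ι) α
  have hi : ∀ θ, Integrable (fun q => |Φ (rotFst θ q) - Φ q.1|)
      ((gaussianFamily ι).prod (gaussianFamily ι)) := fun θ =>
    (((measurePreserving_rotFst θ).integrable_comp_of_integrable hΦ).sub
      (measurePreserving_fst.integrable_comp_of_integrable hΦ)).abs
  set R : (ι → ℝ) × (ι → ℝ) → (ι → ℝ) × (ι → ℝ) := fun q =>
    ((fun i => Real.cos α * q.1 i + Real.sin α * q.2 i),
      fun i => -Real.sin α * q.1 i + Real.cos α * q.2 i) with hR
  have hcomp : ∀ q, rotFst (α + β) q = rotFst β (R q) := by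
    intro q
    ext i
    simp only [rotFst, hR, Real.cos_add, Real.sin_add]
    ring
  have e : ∫ q, |Φ (rotFst β q) - Φ q.1| ∂(gaussianFamily ι).prod (gaussianFamily ι)
      = ∫ q, |Φ (rotFst β (R q)) - Φ (R q).1| ∂(gaussianFamily ι).prod (gaussianFamily ι) := by
    conv_lhs => rw [← hr.map_eq]
    rw [integral_map hr.measurable.aemeasurable]
    rw [hr.map_eq]
    exact (hi β).aestronglyMeasurable
  have hi2 : Integrable (fun q => |Φ (rotFst β (R q)) - Φ (R q).1|)
      ((gaussianFamily ι).prod (gaussianFamily ι)) :=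
    hr.integrable_comp_of_integrable (hi β)
  rw [e, ← integral_add (hi α) hi2]
  refine integral_mono (hi _) ((hi α).add hi2) fun q => ?_
  have : (R q).1 = rotFst α q := rfl
  simp only [hcomp, this]
  have := abs_sub_le (Φ (rotFst β (R q))) (Φ (rotFst α q)) (Φ q.1)
  linarith

/-- A function of a Gaussian family which moves little, in mean, under small rotations mixing in
an independent copy, is concentrated around its mean: rotate by `π / 2` in many small steps. -/
lemma integral_abs_sub_integral_le_of_rotation {ι : Type*} {Φ : (ι → ℝ) → ℝ}
    (hΦ : Integrable Φ (gaussianFamily ι)) {M K : ℝ} (hM : 0 ≤ M) (hK : 0 ≤ K)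
    (h : ∀ θ, ∫ q, |Φ (rotFst θ q) - Φ q.1| ∂(gaussianFamily ι).prod (gaussianFamily ι)
      ≤ 2 * (1 - Real.cos θ) * M + 2 * |Real.sin θ| * K) :
    ∫ ω, |Φ ω - ∫ ω', Φ ω' ∂gaussianFamily ι| ∂gaussianFamily ι ≤ Real.pi * K := by
  set a : ℝ → ℝ := fun θ =>
    ∫ q, |Φ (rotFst θ q) - Φ q.1| ∂(gaussianFamily ι).prod (gaussianFamily ι) with ha
  have hmul : ∀ (k : ℕ) (θ : ℝ), a (k * θ) ≤ k * a θ := by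
    intro k θ
    induction k with
    | zero => simp [ha, rotFst_zero]
    | succ k ih =>
      have := integral_abs_rotFst_add_le hΦ (k * θ) θ
      push_cast
      rw [add_mul, one_mul, add_mul, one_mul]
      exact this.trans (add_le_add_left ih _)
  have hquarter : a (Real.pi / 2) ≤ Real.pi * K := by
    have hk : ∀ k : ℕ,
        a (Real.pi / 2) ≤ Real.pi ^ 2 * M / 4 * (1 / ((k : ℝ) + 1)) + Real.pi * K := by
      intro k
      have hk0 : (0 : ℝ) < (k : ℝ) + 1 := by positivity
      set δ := Real.pi / 2 / ((k : ℝ) + 1) with hδ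
      have hδ0 : 0 ≤ δ := by positivity
      have h1 := hmul (k + 1) δ
      have e1 : ((k + 1 : ℕ) : ℝ) * δ = Real.pi / 2 := by
        rw [hδ]; push_cast; field_simp
      rw [e1] at h1
      have h2 : 1 - Real.cos δ ≤ δ ^ 2 / 2 := by linarith [Real.one_sub_sq_div_two_le_cos (x := δ)]
      have h3 : |Real.sin δ| ≤ δ := (Real.abs_sin_le_abs (x := δ)).trans_eq (abs_of_nonneg hδ0)
      calc a (Real.pi / 2) ≤ ((k + 1 : ℕ) : ℝ) * a δ := h1
        _ ≤ ((k + 1 : ℕ) : ℝ) * (2 * (δ ^ 2 / 2) * M + 2 * δ * K) := by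
            gcongr
            exact (h δ).trans (by gcongr)
        _ = _ := by
            rw [hδ]; push_cast; field_simp; ring
    have hlim : Tendsto (fun k : ℕ => Real.pi ^ 2 * M / 4 * (1 / ((k : ℝ) + 1)) + Real.pi * K)
        atTop (𝓝 (Real.pi ^ 2 * M / 4 * 0 + Real.pi * K)) :=
      (tendsto_one_div_add_atTop_nhds_zero_nat.const_mul _).add_const _
    rw [mul_zero, zero_add] at hlim
    exact ge_of_tendsto' hlim hk
  refine le_trans ?_ hquarter
  have hi : Integrable (fun q : (ι → ℝ) × (ι → ℝ) => |Φ q.2 - Φ q.1|)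
      ((gaussianFamily ι).prod (gaussianFamily ι)) :=
    ((measurePreserving_snd.integrable_comp_of_integrable hΦ).sub
      (measurePreserving_fst.integrable_comp_of_integrable hΦ)).abs
  have e : a (Real.pi / 2)
      = ∫ q, |Φ q.2 - Φ q.1| ∂(gaussianFamily ι).prod (gaussianFamily ι) := by
    simp only [ha, rotFst_pi_div_two]
  rw [e, integral_prod _ hi]
  refine integral_mono (hΦ.sub (integrable_const _)).abs hi.integral_prod_left fun ω => ?_
  have h1 : Φ ω - ∫ ω', Φ ω' ∂gaussianFamily ι = ∫ ω', (Φ ω - Φ ω') ∂gaussianFamily ι := by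
    rw [integral_sub (integrable_const _) hΦ]; simp
  simp only [h1]
  refine (abs_integral_le_integral_abs).trans_eq ?_
  exact integral_congr_ae (ae_of_all _ fun ω' => abs_sub_comm _ _)

end Rotation

/-! ### Concentration of the free energy -/

section FreeEnergy

variable {N : ℕ}

lemma integrable_of_lintegral_ofReal_le {Ω : Type*} [MeasurableSpace Ω] {P : Measure Ω}
    {K : Ω → ℝ} (hK : AEStronglyMeasurable K P) (hK0 : ∀ ω, 0 ≤ K ω) {C : ℝ} (hC : 0 ≤ C)
    (h : ∫⁻ ω, ENNReal.ofReal (K ω) ∂P ≤ ENNReal.ofReal C) :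
    Integrable K P ∧ ∫ ω, K ω ∂P ≤ C := by
  refine ⟨⟨hK, ?_⟩, ?_⟩
  · rw [hasFiniteIntegral_iff_ofReal (ae_of_all _ hK0)]
    exact h.trans_lt ENNReal.ofReal_lt_top
  · rw [integral_eq_lintegral_of_nonneg_ae (ae_of_all _ hK0) hK]
    exact ENNReal.toReal_le_of_le_ofReal hC h

lemma integrable_exp_abs_gField (ν : Measure (Sph N)) [IsProbabilityMeasure ν] {v a b : ℝ}
    (hv : 0 ≤ v) (ha : 0 ≤ a) {x : ℕ+ → ℝ} (hx : ∀ q, |x q| ≤ b) :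
    Integrable (fun q : (GIdx N → ℝ) × Sph N => Real.exp (a * |gField v x q.1 q.2|))
      ((lawG N).prod ν) := by
  have hm := measurable_gField_uncurry (N := N) v x
  refine ⟨by fun_prop, ?_⟩
  rw [hasFiniteIntegral_iff_ofReal (ae_of_all _ fun _ => (Real.exp_pos _).le),
    lintegral_prod _ (Measurable.aemeasurable (by fun_prop))]
  exact (lintegral_lintegral_exp_abs_gField_le ν hv ha hx).trans_lt
    (ENNReal.mul_lt_top (by simp) ENNReal.ofReal_lt_top)

lemma measurable_logZ (ν : Measure (Sph N)) [IsProbabilityMeasure ν] (v : ℝ) (x : ℕ+ → ℝ) :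
    Measurable (logZ ν v x) := by
  have hm := measurable_gField_uncurry (N := N) v x
  have : StronglyMeasurable fun ω => ∫ z, Real.exp (gField v x ω z) ∂ν :=
    StronglyMeasurable.integral_prod_right (f := fun ω z => Real.exp (gField v x ω z))
      (Real.measurable_exp.comp hm).stronglyMeasurable
  exact Real.measurable_log.comp this.measurable

lemma integrable_logZ (ν : Measure (Sph N)) [IsProbabilityMeasure ν] {v b : ℝ}
    (hv : 0 ≤ v) {x : ℕ+ → ℝ} (hx : ∀ q, |x q| ≤ b) : Integrable (logZ ν v x) (lawG N) := by
  have hm := measurable_gField_uncurry (N := N) v x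
  have h1 := integrable_exp_abs_gField ν hv zero_le_one hx
  have h2 : Integrable (fun q : (GIdx N → ℝ) × Sph N => Real.exp (gField v x q.1 q.2))
      ((lawG N).prod ν) := by
    refine h1.mono' (by fun_prop) (ae_of_all _ fun q => ?_)
    rw [Real.norm_eq_abs, Real.abs_exp, one_mul]
    exact Real.exp_le_exp.2 (le_abs_self _)
  have h3 : Integrable (fun q : (GIdx N → ℝ) × Sph N => |gField v x q.1 q.2|)
      ((lawG N).prod ν) := by
    refine h1.mono' (by fun_prop) (ae_of_all _ fun q => ?_)
    rw [Real.norm_eq_abs, abs_abs, one_mul]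
    linarith [Real.add_one_le_exp |gField v x q.1 q.2|]
  refine (h2.integral_prod_left.add h3.integral_prod_left).mono'
    (measurable_logZ ν v x).aestronglyMeasurable ?_
  filter_upwards [ae_regular ν hv hx] with ω hω
  have l1 : logZ ν v x ω ≤ ∫ z, Real.exp (gField v x ω z) ∂ν :=
    Real.log_le_self hω.integral_exp_gField_pos.le
  have l2 : ∫ z, gField v x ω z ∂ν ≤ logZ ν v x ω :=
    integral_le_log_integral_exp hω.integrable hω.integrable_exp
  have l3 : |∫ z, gField v x ω z ∂ν| ≤ ∫ z, |gField v x ω z| ∂ν := abs_integral_le_integral_abs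
  have l4 := hω.integral_exp_gField_pos
  have l5 := abs_le.1 l3
  rw [Real.norm_eq_abs, abs_le]
  simp only [Pi.add_apply]
  constructor <;> linarith [abs_nonneg (∫ z, gField v x ω z ∂ν)]

/-- Under the Gibbs measure the field is integrable, with integrable average of its absolute
value: by Jensen's inequality `⟨|g|⟩ ≤ log ⟨e^{|g|}⟩`. -/
lemma integrable_gibbs_abs_gField (ν : Measure (Sph N)) [IsProbabilityMeasure ν] {v b : ℝ}
    (hv : 0 ≤ v) {x : ℕ+ → ℝ} (hx : ∀ q, |x q| ≤ b) :
    (∀ᵐ ω ∂lawG N, Integrable (gField v x ω) (gibbs ν v x ω)) ∧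
      Integrable (fun ω => ∫ z, |gField v x ω z| ∂gibbs ν v x ω) (lawG N) := by
  have hm := measurable_gField_uncurry (N := N) v x
  have h2 := integrable_exp_abs_gField ν hv zero_le_two hx
  have key : ∀ᵐ ω ∂lawG N, Integrable (gField v x ω) (gibbs ν v x ω) ∧
      ∫ z, |gField v x ω z| ∂gibbs ν v x ω
        ≤ (∫ z, Real.exp (2 * |gField v x ω z|) ∂ν) + |logZ ν v x ω| := by
    filter_upwards [ae_regular ν hv hx, h2.prod_right_ae] with ω hω hω2
    have hprob := hω.isProbabilityMeasure_gibbs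
    have hg := measurable_gField_right v x ω
    have i1 : Integrable (gField v x ω) (gibbs ν v x ω) := by
      rw [gibbs, integrable_tilted_iff hω.integrable_exp]
      refine hω2.mono' (by fun_prop) (ae_of_all _ fun z => ?_)
      rw [smul_eq_mul, Real.norm_eq_abs, abs_mul, Real.abs_exp, two_mul, Real.exp_add]
      refine mul_le_mul (Real.exp_le_exp.2 (le_abs_self _)) ?_ (abs_nonneg _) (Real.exp_pos _).le
      linarith [Real.add_one_le_exp |gField v x ω z|]
    have i2 : Integrable (fun z => Real.exp (gField v x ω z + |gField v x ω z|)) ν := by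
      refine hω2.mono' (by fun_prop) (ae_of_all _ fun z => ?_)
      rw [Real.norm_eq_abs, Real.abs_exp]
      exact Real.exp_le_exp.2 (by linarith [le_abs_self (gField v x ω z)])
    have i3 : Integrable (fun z => Real.exp |gField v x ω z|) (gibbs ν v x ω) := by
      rw [gibbs, integrable_tilted_iff hω.integrable_exp]
      refine i2.congr (ae_of_all _ fun z => ?_)
      simp only [smul_eq_mul, ← Real.exp_add]
    refine ⟨i1, (integral_le_log_integral_exp i1.abs i3).trans ?_⟩
    rw [gibbs, integral_exp_tilted]
    have hpos : 0 < ∫ z, Real.exp ((gField v x ω + fun z => |gField v x ω z|) z) ∂ν :=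
      integral_exp_pos i2
    rw [Real.log_div hpos.ne' hω.integral_exp_gField_pos.ne']
    have l1 := Real.log_le_self hpos.le
    have l2 : ∫ z, Real.exp ((gField v x ω + fun z => |gField v x ω z|) z) ∂ν
        ≤ ∫ z, Real.exp (2 * |gField v x ω z|) ∂ν :=
      integral_mono i2 hω2 fun z =>
        Real.exp_le_exp.2 (by simp only [Pi.add_apply]; linarith [le_abs_self (gField v x ω z)])
    have l3 := neg_abs_le (logZ ν v x ω)
    simp only [logZ] at l3 ⊢
    linarith
  refine ⟨key.mono fun _ h => h.1, ?_⟩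
  refine (h2.integral_prod_left.add (integrable_logZ ν hv hx).abs).mono' ?_ ?_
  · exact (stronglyMeasurable_gibbs ν v measurable_const measurable_id
      (F := fun ω z => |gField v x ω z|) hm.abs).aestronglyMeasurable
  · filter_upwards [key] with ω hω
    rw [Real.norm_eq_abs, abs_of_nonneg (integral_nonneg fun _ => abs_nonneg _)]
    exact hω.2

/-- The absolute value of an independent copy of the field has a Gibbs average of order `v` in mean:
by Fubini's theorem it suffices to bound `E|g(z)|` for each `z`. -/
lemma integrable_gibbs_abs_gField_copy (ν : Measure (Sph N)) [IsProbabilityMeasure ν] {v b : ℝ}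
    (hv : 0 ≤ v) {x : ℕ+ → ℝ} (hx : ∀ q, |x q| ≤ b) :
    (∀ᵐ q ∂(lawG N).prod (lawG N), Integrable (gField v x q.2) (gibbs ν v x q.1)) ∧
      Integrable (fun q : (GIdx N → ℝ) × (GIdx N → ℝ) => ∫ z, |gField v x q.2 z| ∂gibbs ν v x q.1)
        ((lawG N).prod (lawG N)) ∧
      ∫ q : (GIdx N → ℝ) × (GIdx N → ℝ), (∫ z, |gField v x q.2 z| ∂gibbs ν v x q.1)
        ∂(lawG N).prod (lawG N) ≤ 4 * v * b := by
  have hb : 0 ≤ b := (abs_nonneg _).trans (hx 1)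
  have hm := measurable_gField_uncurry (N := N) v x
  have hsm : Measurable fun q : (GIdx N → ℝ) × (GIdx N → ℝ) =>
      ∫⁻ z, ENNReal.ofReal |gField v x q.2 z| ∂gibbs ν v x q.1 := by
    have hF : Measurable (Function.uncurry fun (q : (GIdx N → ℝ) × (GIdx N → ℝ)) (z : Sph N) =>
        ENNReal.ofReal |gField v x q.2 z|) :=
      ENNReal.measurable_ofReal.comp (hm.comp
        ((measurable_snd.comp measurable_fst).prodMk measurable_snd)).abs
    exact measurable_lintegral_gibbs ν v (X := fun _ => x) (W := Prod.fst) measurable_const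
      measurable_fst hF
  have hle : ∫⁻ q : (GIdx N → ℝ) × (GIdx N → ℝ), ∫⁻ z, ENNReal.ofReal |gField v x q.2 z|
      ∂gibbs ν v x q.1 ∂(lawG N).prod (lawG N) ≤ ENNReal.ofReal (4 * v * b) := by
    rw [lintegral_prod _ hsm.aemeasurable]
    calc ∫⁻ ω, ∫⁻ ω', ∫⁻ z, ENNReal.ofReal |gField v x ω' z| ∂gibbs ν v x ω ∂lawG N ∂lawG N
        ≤ ∫⁻ _, ENNReal.ofReal (4 * v * b) ∂lawG N := by
          refine lintegral_mono fun ω => ?_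
          rw [lintegral_lintegral_swap (Measurable.aemeasurable (by fun_prop))]
          refine (lintegral_mono fun z => lintegral_abs_gField_le hv hx z).trans ?_
          rw [lintegral_const]
          exact mul_le_of_le_one_right' (gibbs_univ_le_one ν v x ω)
      _ = _ := by simp
  have hae : ∀ᵐ q ∂(lawG N).prod (lawG N), Integrable (gField v x q.2) (gibbs ν v x q.1) := by
    filter_upwards [ae_lt_top hsm (hle.trans_lt ENNReal.ofReal_lt_top).ne] with q hq
    refine ⟨(measurable_gField_right v x q.2).aestronglyMeasurable, ?_⟩
    rw [hasFiniteIntegral_iff_norm]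
    exact hq
  have hK : AEStronglyMeasurable (fun q : (GIdx N → ℝ) × (GIdx N → ℝ) =>
      ∫ z, |gField v x q.2 z| ∂gibbs ν v x q.1) ((lawG N).prod (lawG N)) :=
    (stronglyMeasurable_gibbs ν v measurable_const measurable_fst
      (F := fun (q : (GIdx N → ℝ) × (GIdx N → ℝ)) z => |gField v x q.2 z|) (hm.comp
        ((measurable_snd.comp measurable_fst).prodMk measurable_snd)).abs).aestronglyMeasurable
  have hKle : ∫⁻ q : (GIdx N → ℝ) × (GIdx N → ℝ),
      ENNReal.ofReal (∫ z, |gField v x q.2 z| ∂gibbs ν v x q.1) ∂(lawG N).prod (lawG N)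
      ≤ ENNReal.ofReal (4 * v * b) := by
    refine le_trans (le_of_eq (lintegral_congr_ae (hae.mono fun q hq => ?_))) hle
    exact ofReal_integral_eq_lintegral_ofReal hq.abs (ae_of_all _ fun _ => abs_nonneg _)
  exact ⟨hae, integrable_of_lintegral_ofReal_le hK (fun q => integral_nonneg fun _ => abs_nonneg _)
    (by positivity) hKle⟩

lemma gField_rotFst {v θ : ℝ} {x : ℕ+ → ℝ} {q : (GIdx N → ℝ) × (GIdx N → ℝ)} {z : Sph N}
    (h1 : Summable (fieldTerm x q.1 z)) (h2 : Summable (fieldTerm x q.2 z)) :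
    gField v x (rotFst θ q) z = Real.cos θ * gField v x q.1 z + Real.sin θ * gField v x q.2 z := by
  have e : fieldTerm x (rotFst θ q) z
      = fun p => Real.cos θ * fieldTerm x q.1 z p + Real.sin θ * fieldTerm x q.2 z p := by
    ext p
    simp only [fieldTerm, gP_eq, rotFst, add_mul, Finset.sum_add_distrib, mul_assoc,
      ← Finset.mul_sum]
    ring
  rw [gField_eq, e, ((h1.hasSum.mul_left _).add (h2.hasSum.mul_left _)).tsum_eq, gField_eq,
    gField_eq]
  ring

/-- Rotating the disorder by a small angle `θ` changes the free energy by `O(|θ| v)` in mean, up to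
terms of second order in `θ`. -/
lemma integral_abs_logZ_rotFst_le (ν : Measure (Sph N)) [IsProbabilityMeasure ν] {v b : ℝ}
    (hv : 0 ≤ v) {x : ℕ+ → ℝ} (hx : ∀ q, |x q| ≤ b) (θ : ℝ) :
    ∫ q, |logZ ν v x (rotFst θ q) - logZ ν v x q.1| ∂(lawG N).prod (lawG N)
      ≤ 2 * (1 - Real.cos θ) * (∫ ω, ∫ z, |gField v x ω z| ∂gibbs ν v x ω ∂lawG N)
        + 2 * |Real.sin θ| * (4 * v * b) := by
  have hφ := integrable_logZ ν hv hx
  have hreg := ae_regular ν hv hx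
  obtain ⟨hg1, hM⟩ := integrable_gibbs_abs_gField ν hv hx
  obtain ⟨hg2, hK, hKle⟩ := integrable_gibbs_abs_gField_copy ν hv hx
  have hrot : MeasurePreserving (rotFst θ) ((lawG N).prod (lawG N)) (lawG N) :=
    measurePreserving_rotFst θ
  have hfst : MeasurePreserving Prod.fst ((lawG N).prod (lawG N)) (lawG N) := measurePreserving_fst
  have hsnd : MeasurePreserving Prod.snd ((lawG N).prod (lawG N)) (lawG N) := measurePreserving_snd
  have iφr : Integrable (fun q => logZ ν v x (rotFst θ q)) ((lawG N).prod (lawG N)) :=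
    hrot.integrable_comp_of_integrable hφ
  have iφ : Integrable (fun q : (GIdx N → ℝ) × (GIdx N → ℝ) => logZ ν v x q.1)
    ((lawG N).prod (lawG N)) := hfst.integrable_comp_of_integrable hφ
  have iM : Integrable (fun q : (GIdx N → ℝ) × (GIdx N → ℝ) =>
    ∫ z, |gField v x q.1 z| ∂gibbs ν v x q.1) ((lawG N).prod (lawG N)) :=
    hfst.integrable_comp_of_integrable hM
  have hcos : 0 ≤ 1 - Real.cos θ := by linarith [Real.cos_le_one θ]
  -- convexity bounds the increment of the free energy from below only; as this increment has mean
  -- zero, its absolute value is controlled through `|u| ≤ u + 2 * R` for `-R ≤ u`, `0 ≤ R`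
  have key : ∀ᵐ q ∂(lawG N).prod (lawG N), |logZ ν v x (rotFst θ q) - logZ ν v x q.1|
      ≤ (logZ ν v x (rotFst θ q) - logZ ν v x q.1)
        + (2 * (1 - Real.cos θ) * (∫ z, |gField v x q.1 z| ∂gibbs ν v x q.1)
          + 2 * |Real.sin θ| * ∫ z, |gField v x q.2 z| ∂gibbs ν v x q.1) := by
    filter_upwards [hrot.quasiMeasurePreserving.ae hreg, hfst.quasiMeasurePreserving.ae hreg,
      hsnd.quasiMeasurePreserving.ae hreg, hfst.quasiMeasurePreserving.ae hg1, hg2]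
      with q r0 r1 r2 g1 g2
    have hprob := r1.isProbabilityMeasure_gibbs
    have hae : ∀ᵐ z ∂gibbs ν v x q.1, gField v x (rotFst θ q) z - gField v x q.1 z
        = -(1 - Real.cos θ) * gField v x q.1 z + Real.sin θ * gField v x q.2 z := by
      refine (tilted_absolutelyContinuous ν _).ae_le ?_
      filter_upwards [r1.summable, r2.summable] with z s1 s2
      rw [gField_rotFst s1 s2]; ring
    have hi : Integrable (fun z => gField v x (rotFst θ q) z - gField v x q.1 z)
        (gibbs ν v x q.1) :=
      ((g1.const_mul (-(1 - Real.cos θ))).add (g2.const_mul (Real.sin θ))).congr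
        (hae.mono fun z hz => hz.symm)
    have hJ := r1.integral_sub_le_logZ_sub r0 hi
    rw [integral_congr_ae hae, integral_add (g1.const_mul _) (g2.const_mul _), integral_const_mul,
      integral_const_mul] at hJ
    have l1 : |∫ z, gField v x q.1 z ∂gibbs ν v x q.1| ≤ ∫ z, |gField v x q.1 z| ∂gibbs ν v x q.1 :=
      abs_integral_le_integral_abs
    have l2 : |∫ z, gField v x q.2 z ∂gibbs ν v x q.1| ≤ ∫ z, |gField v x q.2 z| ∂gibbs ν v x q.1 :=
      abs_integral_le_integral_abs
    have l3 := mul_le_mul_of_nonneg_left ((le_abs_self _).trans l1) hcos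
    have l4 : -(|Real.sin θ| * ∫ z, |gField v x q.2 z| ∂gibbs ν v x q.1)
        ≤ Real.sin θ * ∫ z, gField v x q.2 z ∂gibbs ν v x q.1 := by
      have := neg_abs_le (Real.sin θ * ∫ z, gField v x q.2 z ∂gibbs ν v x q.1)
      rw [abs_mul] at this
      linarith [mul_le_mul_of_nonneg_left l2 (abs_nonneg (Real.sin θ))]
    have l5 : 0 ≤ (1 - Real.cos θ) * ∫ z, |gField v x q.1 z| ∂gibbs ν v x q.1 :=
      mul_nonneg hcos (integral_nonneg fun _ => abs_nonneg _)
    have l6 : 0 ≤ |Real.sin θ| * ∫ z, |gField v x q.2 z| ∂gibbs ν v x q.1 :=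
      mul_nonneg (abs_nonneg _) (integral_nonneg fun _ => abs_nonneg _)
    rcases abs_cases (logZ ν v x (rotFst θ q) - logZ ν v x q.1) with ⟨e, -⟩ | ⟨e, -⟩ <;> rw [e] <;>
      linarith
  have iX : Integrable (fun q => logZ ν v x (rotFst θ q) - logZ ν v x q.1)
    ((lawG N).prod (lawG N)) := iφr.sub iφ
  have iR : Integrable (fun q : (GIdx N → ℝ) × (GIdx N → ℝ) =>
      2 * (1 - Real.cos θ) * (∫ z, |gField v x q.1 z| ∂gibbs ν v x q.1)
          + 2 * |Real.sin θ| * ∫ z, |gField v x q.2 z| ∂gibbs ν v x q.1)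
    ((lawG N).prod (lawG N)) := (iM.const_mul _).add (hK.const_mul _)
  refine (integral_mono_ae iX.abs (iX.add iR) key).trans ?_
  have e0 : ∫ q, (logZ ν v x (rotFst θ q) - logZ ν v x q.1) ∂(lawG N).prod (lawG N) = 0 := by
    have t1 : ∫ q, logZ ν v x (rotFst θ q) ∂(lawG N).prod (lawG N) = ∫ ω, logZ ν v x ω ∂lawG N := by
      conv_rhs => rw [← hrot.map_eq]
      rw [integral_map hrot.measurable.aemeasurable (measurable_logZ ν v x).aestronglyMeasurable]
    have t2 : ∫ q, logZ ν v x q.1 ∂(lawG N).prod (lawG N) = ∫ ω, logZ ν v x ω ∂lawG N := by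
      conv_rhs => rw [← hfst.map_eq]
      rw [integral_map hfst.measurable.aemeasurable (measurable_logZ ν v x).aestronglyMeasurable]
    rw [integral_sub iφr iφ, t1, t2, sub_self]
  have e1 : ∫ q : (GIdx N → ℝ) × (GIdx N → ℝ), (∫ z, |gField v x q.1 z| ∂gibbs ν v x q.1)
      ∂(lawG N).prod (lawG N) = ∫ ω, ∫ z, |gField v x ω z| ∂gibbs ν v x ω ∂lawG N := by
    conv_rhs => rw [← hfst.map_eq]
    rw [integral_map hfst.measurable.aemeasurable]
    rw [hfst.map_eq]
    exact hM.aestronglyMeasurable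
  rw [integral_add' iX iR, e0, zero_add, integral_add (iM.const_mul _) (hK.const_mul _),
    integral_const_mul, integral_const_mul]
  refine add_le_add (le_of_eq ?_) (mul_le_mul_of_nonneg_left hKle (by positivity))
  rw [← e1]

/-- The fluctuations of the free energy are of order `v`. -/
lemma integral_abs_logZ_sub_le (ν : Measure (Sph N)) [IsProbabilityMeasure ν] {v b : ℝ}
    (hv : 0 ≤ v) {x : ℕ+ → ℝ} (hx : ∀ q, |x q| ≤ b) :
    ∫ ω, |logZ ν v x ω - ∫ ω', logZ ν v x ω' ∂lawG N| ∂lawG N ≤ 16 * v * b := by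
  have hb : 0 ≤ b := (abs_nonneg _).trans (hx 1)
  refine (integral_abs_sub_integral_le_of_rotation (ι := GIdx N) (integrable_logZ ν hv hx)
    (M := ∫ ω, ∫ z, |gField v x ω z| ∂gibbs ν v x ω ∂lawG N) (K := 4 * v * b)
    (integral_nonneg fun _ => integral_nonneg fun _ => abs_nonneg _) (by positivity)
    (integral_abs_logZ_rotFst_le ν hv hx)).trans ?_
  have h1 := Real.pi_le_four
  have h2 : 0 ≤ v * b := mul_nonneg hv hb
  nlinarith

end FreeEnergy

/-! ### Measurability, bounds and linearity of the defect -/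

section Defect

variable {N : ℕ}

lemma stronglyMeasurable_gAvg (ν : Measure (Sph N)) [IsProbabilityMeasure ν] (v : ℝ) {m : ℕ}
    {F : (Fin m → Sph N) → ℝ} (hF : Measurable F) :
    StronglyMeasurable fun x => gAvg ν v x F :=
  StronglyMeasurable.integral_prod_right (f := fun x ω => repAvg ν v x ω F)
    (stronglyMeasurable_replicas ν v (Θ := (ℕ+ → ℝ) × (GIdx N → ℝ)) measurable_fst measurable_snd
      (F := fun _ => F) (hF.comp measurable_snd))

lemma abs_gAvg_le (ν : Measure (Sph N)) [IsProbabilityMeasure ν] (v : ℝ) (x : ℕ+ → ℝ) {m : ℕ}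
    {F : (Fin m → Sph N) → ℝ} {A : ℝ} (hA0 : 0 ≤ A) (hA : ∀ z, |F z| ≤ A) :
    |gAvg ν v x F| ≤ A :=
  abs_integral_le_of_abs_le fun ω => abs_repAvg_le ν v x ω hA0 hA

lemma gAvg_add (ν : Measure (Sph N)) [IsProbabilityMeasure ν] (v : ℝ) (x : ℕ+ → ℝ) {m : ℕ}
    {F G : (Fin m → Sph N) → ℝ} {A B : ℝ} (hF : Measurable F) (hG : Measurable G) (hA0 : 0 ≤ A)
    (hA : ∀ z, |F z| ≤ A) (hB0 : 0 ≤ B) (hB : ∀ z, |G z| ≤ B) :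
    gAvg ν v x (fun z => F z + G z) = gAvg ν v x F + gAvg ν v x G := by
  simp_rw [gAvg_eq]
  rw [← integral_add (integrable_repAvg ν v x hF hA0 hA) (integrable_repAvg ν v x hG hB0 hB)]
  exact integral_congr_ae (ae_of_all _ fun ω =>
    integral_add (integrable_of_abs_le hF hA) (integrable_of_abs_le hG hB))

lemma gAvg_const_mul (ν : Measure (Sph N)) (v : ℝ) (x : ℕ+ → ℝ) {m : ℕ}
    (F : (Fin m → Sph N) → ℝ) (c : ℝ) :
    gAvg ν v x (fun z => c * F z) = c * gAvg ν v x F := by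
  unfold gAvg
  simp_rw [integral_const_mul]

variable {n : ℕ} {f : (Fin n → Sph N) → ℝ} {ψ χ : ℝ → ℝ} {B : ℝ}

lemma measurable_mul_overlap_last (hf : Measurable f) (hψ : Measurable ψ) :
    Measurable fun z : Fin (n + 1) → Sph N =>
      f (fun i => z i.castSucc) * ψ (overlap (z 0) (z (Fin.last n))) :=
  (hf.comp (measurable_castSucc n)).mul (hψ.comp (measurable_overlap_comp 0 (Fin.last n)))

lemma measurable_overlap_two (hψ : Measurable ψ) :
    Measurable fun z : Fin 2 → Sph N => ψ (overlap (z 0) (z 1)) :=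
  hψ.comp (measurable_overlap_comp 0 1)

lemma abs_mul_comp_overlap_le (hf1 : ∀ z, |f z| ≤ 1) (hB : ∀ u ∈ Set.Icc (-1 : ℝ) 1, |ψ u| ≤ B)
    (z : Fin n → Sph N) (a b : Sph N) : |f z * ψ (overlap a b)| ≤ B := by
  have h := hB _ (abs_le.1 (abs_overlap_le_one a b))
  rw [abs_mul]
  exact (mul_le_mul (hf1 z) h (abs_nonneg _) zero_le_one).trans_eq (one_mul B)

variable [NeZero n]

lemma measurable_mul_overlap (hf : Measurable f) (hψ : Measurable ψ) (l : Fin n) :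
    Measurable fun z : Fin n → Sph N => f z * ψ (overlap (z 0) (z l)) :=
  hf.mul (hψ.comp (measurable_overlap_comp 0 l))

lemma stronglyMeasurable_ggDefect (ν : Measure (Sph N)) [IsProbabilityMeasure ν] (v : ℝ)
    (hf : Measurable f) (hψ : Measurable ψ) :
    StronglyMeasurable fun x => ggDefect ν v x n f ψ := by
  unfold ggDefect
  refine ((stronglyMeasurable_gAvg ν v (measurable_mul_overlap_last hf hψ)).sub
    ((stronglyMeasurable_const.mul (stronglyMeasurable_gAvg ν v hf)).mul
      (stronglyMeasurable_gAvg ν v (measurable_overlap_two hψ)))).sub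
    (stronglyMeasurable_const.mul (Finset.stronglyMeasurable_fun_sum _ fun l _ =>
      stronglyMeasurable_gAvg ν v (measurable_mul_overlap hf hψ l)))

lemma abs_ggDefect_le (ν : Measure (Sph N)) [IsProbabilityMeasure ν] (v : ℝ) (x : ℕ+ → ℝ)
    (hf1 : ∀ z, |f z| ≤ 1) (hB : ∀ u ∈ Set.Icc (-1 : ℝ) 1, |ψ u| ≤ B) :
    |ggDefect ν v x n f ψ| ≤ 2 * B := by
  have hn : (0 : ℝ) < n := Nat.cast_pos.2 (Nat.pos_of_ne_zero (NeZero.ne n))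
  have hB0 : 0 ≤ B := (abs_nonneg _).trans (hB 0 (by simp))
  have h1 : |gAvg ν v x (fun z : Fin (n + 1) → Sph N =>
      f (fun i => z i.castSucc) * ψ (overlap (z 0) (z (Fin.last n))))| ≤ B :=
    abs_gAvg_le ν v x hB0 fun z => abs_mul_comp_overlap_le hf1 hB _ _ _
  have h2 : |gAvg ν v x f| ≤ 1 := abs_gAvg_le ν v x zero_le_one hf1
  have h3 : |gAvg ν v x (fun z : Fin 2 → Sph N => ψ (overlap (z 0) (z 1)))| ≤ B :=
    abs_gAvg_le ν v x hB0 fun z => hB _ (abs_le.1 (abs_overlap_le_one _ _))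
  have h4 : |∑ l ∈ Finset.univ.erase (0 : Fin n),
      gAvg ν v x (fun z : Fin n → Sph N => f z * ψ (overlap (z 0) (z l)))| ≤ (n - 1) * B := by
    refine (Finset.abs_sum_le_sum_abs _ _).trans ((Finset.sum_le_sum fun l _ =>
      abs_gAvg_le ν v x hB0 fun z => abs_mul_comp_overlap_le hf1 hB _ _ _).trans_eq ?_)
    rw [Finset.sum_const, Finset.card_erase_of_mem (Finset.mem_univ _), Finset.card_univ,
      Fintype.card_fin, nsmul_eq_mul, Nat.cast_pred (Nat.pos_of_ne_zero (NeZero.ne n))]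
  unfold ggDefect
  refine (abs_sub _ _).trans ((add_le_add ((abs_sub _ _).trans (add_le_add h1 (b := _)
    (d := 1 / (n : ℝ) * 1 * B) ?_)) (d := 1 / (n : ℝ) * ((n - 1) * B)) ?_).trans_eq ?_)
  · rw [abs_mul, abs_mul, abs_of_pos (a := 1 / (n : ℝ)) (by positivity)]
    gcongr
  · rw [abs_mul, abs_of_pos (a := 1 / (n : ℝ)) (by positivity)]
    gcongr
  · field_simp; ring

lemma ggDefect_add (ν : Measure (Sph N)) [IsProbabilityMeasure ν] (v : ℝ) (x : ℕ+ → ℝ)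
    (hf : Measurable f) (hf1 : ∀ z, |f z| ≤ 1) (hψ : Measurable ψ) (hχ : Measurable χ) {C : ℝ}
    (hB : ∀ u ∈ Set.Icc (-1 : ℝ) 1, |ψ u| ≤ B) (hC : ∀ u ∈ Set.Icc (-1 : ℝ) 1, |χ u| ≤ C) :
    ggDefect ν v x n f (fun u => ψ u + χ u) = ggDefect ν v x n f ψ + ggDefect ν v x n f χ := by
  have hB0 : 0 ≤ B := (abs_nonneg _).trans (hB 0 (by simp))
  have hC0 : 0 ≤ C := (abs_nonneg _).trans (hC 0 (by simp))
  unfold ggDefect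
  simp_rw [mul_add]
  rw [gAvg_add ν v x (measurable_mul_overlap_last hf hψ) (measurable_mul_overlap_last hf hχ) hB0
      (fun z => abs_mul_comp_overlap_le hf1 hB _ _ _) hC0
      (fun z => abs_mul_comp_overlap_le hf1 hC _ _ _),
    gAvg_add ν v x (measurable_overlap_two hψ) (measurable_overlap_two hχ) hB0
      (fun z => hB _ (abs_le.1 (abs_overlap_le_one _ _))) hC0
      (fun z => hC _ (abs_le.1 (abs_overlap_le_one _ _))),
    Finset.sum_congr rfl fun l _ => gAvg_add ν v x (measurable_mul_overlap hf hψ l)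
      (measurable_mul_overlap hf hχ l) hB0 (fun z => abs_mul_comp_overlap_le hf1 hB _ _ _) hC0
      (fun z => abs_mul_comp_overlap_le hf1 hC _ _ _), Finset.sum_add_distrib]
  ring

lemma ggDefect_const_mul (ν : Measure (Sph N)) (v : ℝ) (x : ℕ+ → ℝ) (c : ℝ) :
    ggDefect ν v x n f (fun u => c * ψ u) = c * ggDefect ν v x n f ψ := by
  unfold ggDefect
  simp_rw [mul_left_comm _ c, gAvg_const_mul, ← Finset.mul_sum]
  ring

lemma ggDefect_one (ν : Measure (Sph N)) [IsProbabilityMeasure ν] {v b : ℝ} (hv : 0 ≤ v)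
    {x : ℕ+ → ℝ} (hx : ∀ q, |x q| ≤ b) :
    ggDefect ν v x n f (fun _ => 1) = 0 := by
  have hn : (n : ℝ) ≠ 0 := Nat.cast_ne_zero.2 (NeZero.ne n)
  have e1 : gAvg ν v x (fun z : Fin (n + 1) → Sph N => f fun i => z i.castSucc) = gAvg ν v x f := by
    refine integral_congr_ae ((ae_regular ν hv hx).mono fun ω hω => ?_)
    have := hω.isProbabilityMeasure_gibbs
    have h := integral_pi_castSucc_mul_last (gibbs ν v x ω) n f fun _ => 1
    simpa using h
  have e2 : gAvg ν v x (fun _ : Fin 2 → Sph N => (1 : ℝ)) = 1 := by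
    rw [gAvg_eq, integral_congr_ae (g := fun _ => (1 : ℝ))]
    · simp
    filter_upwards [ae_regular ν hv hx] with ω hω
    have := hω.isProbabilityMeasure_gibbs
    simp [repAvg]
  unfold ggDefect
  simp only [mul_one, e1, e2, Finset.sum_const]
  rw [Finset.card_erase_of_mem (Finset.mem_univ _), Finset.card_univ,
      Fintype.card_fin, nsmul_eq_mul, Nat.cast_pred (Nat.pos_of_ne_zero (NeZero.ne n))]
  field_simp
  ring

end Defect

/-! ### Fluctuations of `g_p` in the parameter `x_p` -/

section Fluctuations

variable {N : ℕ} (ν : Measure (Sph N)) (p : ℕ+)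

/-- The Gibbs average `⟨g_p⟩` when `x_p = t`. -/
noncomputable def meanG (v : ℝ) (x : ℕ+ → ℝ) (t : ℝ) (ω : GIdx N → ℝ) : ℝ :=
  ∫ z, gP ω p z ∂gibbs ν v (Function.update x p t) ω

/-- The Gibbs variance `⟨(g_p - ⟨g_p⟩)²⟩` when `x_p = t`. -/
noncomputable def varG (v : ℝ) (x : ℕ+ → ℝ) (t : ℝ) (ω : GIdx N → ℝ) : ℝ :=
  ∫ z, (gP ω p z - meanG ν p v x t ω) ^ 2 ∂gibbs ν v (Function.update x p t) ω

lemma varG_nonneg (v : ℝ) (x : ℕ+ → ℝ) (t : ℝ) (ω : GIdx N → ℝ) : 0 ≤ varG ν p v x t ω :=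
  integral_nonneg fun _ => sq_nonneg _

variable [IsProbabilityMeasure ν] {v : ℝ} {x : ℕ+ → ℝ}

lemma abs_update_le (hx : ∀ q, |x q| ≤ 1) (t : ℝ) (q : ℕ+) :
    |Function.update x p t q| ≤ max 1 |t| := by
  by_cases h : q = p
  · subst h; simp
  · rw [Function.update_of_ne h]; exact (hx q).trans (le_max_left _ _)

lemma measurable_update_param (x : ℕ+ → ℝ) : Measurable fun t : ℝ => Function.update x p t := by
  fun_prop

lemma measurable_meanG (v : ℝ) (x : ℕ+ → ℝ) :
    Measurable fun q : ℝ × (GIdx N → ℝ) => meanG ν p v x q.1 q.2 := by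
  refine (stronglyMeasurable_gibbs ν v (X := fun q : ℝ × (GIdx N → ℝ) => Function.update x p q.1)
    (W := Prod.snd) ((measurable_update_param p x).comp measurable_fst) measurable_snd
    (F := fun q z => gP q.2 p z) ?_).measurable
  exact (measurable_gP p).comp ((measurable_snd.comp measurable_fst).prodMk measurable_snd)

lemma measurable_varG (v : ℝ) (x : ℕ+ → ℝ) :
    Measurable fun q : ℝ × (GIdx N → ℝ) => varG ν p v x q.1 q.2 := by
  refine (stronglyMeasurable_gibbs ν v (X := fun q : ℝ × (GIdx N → ℝ) => Function.update x p q.1)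
    (W := Prod.snd) ((measurable_update_param p x).comp measurable_fst) measurable_snd
    (F := fun q z => (gP q.2 p z - meanG ν p v x q.1 q.2) ^ 2) ?_).measurable
  exact (((measurable_gP p).comp ((measurable_snd.comp measurable_fst).prodMk measurable_snd)).sub
    ((measurable_meanG ν p v x).comp measurable_fst)).pow_const 2

lemma ae_regular_update (hv : 0 ≤ v) (hx : ∀ q, |x q| ≤ 1) (t : ℝ) :
    ∀ᵐ ω ∂lawG N, Regular ν v (Function.update x p t) ω :=
  ae_regular ν hv (abs_update_le p hx t)

lemma integrable_meanG (hv : 0 ≤ v) (hx : ∀ q, |x q| ≤ 1) (t : ℝ) :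
    Integrable (meanG ν p v x t) (lawG N) := by
  have h : Integrable (fun ω : GIdx N → ℝ => ∑ i : Fin (p : ℕ) → Fin N, |ω ⟨p, i⟩|) (lawG N) :=
    integrable_finsetSum _ fun i _ => (integrable_coord _).abs
  refine h.mono' ((measurable_meanG ν p v x).comp
    (measurable_const.prodMk measurable_id)).aestronglyMeasurable ?_
  filter_upwards [ae_regular_update ν p hv hx t] with ω hω
  have := hω.isProbabilityMeasure_gibbs
  exact abs_integral_le_of_abs_le (abs_gP_le ω p)

/-- `s ⟨g_p⟩` is a subgradient of the free energy as a function of `x_p`. -/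
lemma meanG_subgradient (hv : 0 ≤ v) (hx : ∀ q, |x q| ≤ 1) (t t' : ℝ) :
    ∀ᵐ ω ∂lawG N, v * (2 : ℝ)⁻¹ ^ (p : ℕ) * (t' - t) * meanG ν p v x t ω
      ≤ logZ ν v (Function.update x p t') ω - logZ ν v (Function.update x p t) ω := by
  filter_upwards [ae_regular_update ν p hv hx t, ae_regular_update ν p hv hx t'] with ω h h'
  have := h.isProbabilityMeasure_gibbs
  have hae : ∀ᵐ z ∂gibbs ν v (Function.update x p t) ω,
      gField v (Function.update x p t') ω z - gField v (Function.update x p t) ω z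
        = v * (2 : ℝ)⁻¹ ^ (p : ℕ) * (t' - t) * gP ω p z := by
    refine (tilted_absolutelyContinuous ν _).ae_le ?_
    filter_upwards [h.summable] with z hz
    have := (gField_update_left (v := v) (t := t') p hz).2
    rw [Function.update_idem, Function.update_self] at this
    rw [this]; ring
  have hi : Integrable (gP ω p) (gibbs ν v (Function.update x p t) ω) :=
    integrable_of_abs_le (Regular.measurable_gP_const ω p) (abs_gP_le ω p)
  have hJ := h.integral_sub_le_logZ_sub h' ((hi.const_mul _).congr (hae.mono fun z hz => hz.symm))
  rwa [integral_congr_ae hae, integral_const_mul] at hJ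

lemma integral_meanG (hv : 0 ≤ v) (hx : ∀ q, |x q| ≤ 1) (t : ℝ) :
    ∫ ω, meanG ν p v x t ω ∂lawG N = v * (2 : ℝ)⁻¹ ^ (p : ℕ) * t
      * (1 - gAvg ν v (Function.update x p t)
        (fun z : Fin 2 → Sph N => overlap (z 0) (z 1) ^ (p : ℕ))) := by
  have := integral_gibbs_gP ν hv (abs_update_le p hx t) p
  rwa [Function.update_self] at this

lemma abs_integral_meanG_le (hv : 0 ≤ v) (hx : ∀ q, |x q| ≤ 1) (t : ℝ) :
    |∫ ω, meanG ν p v x t ω ∂lawG N| ≤ v * (2 : ℝ)⁻¹ ^ (p : ℕ) * |t| * 2 := by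
  rw [integral_meanG ν p hv hx, abs_mul, abs_mul,
    abs_of_nonneg (a := v * (2 : ℝ)⁻¹ ^ (p : ℕ)) (by positivity)]
  have h := abs_gAvg_le ν v (Function.update x p t) (m := 2)
    (F := fun z => overlap (z 0) (z 1) ^ (p : ℕ)) zero_le_one
    fun z => abs_overlap_pow_le_one _ _ _
  gcongr
  rw [abs_le] at h ⊢
  constructor <;> linarith [h.1, h.2]

lemma monotone_integral_meanG (hv : 0 < v) (hx : ∀ q, |x q| ≤ 1) :
    Monotone fun t => ∫ ω, meanG ν p v x t ω ∂lawG N := by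
  intro t t' htt
  rcases htt.eq_or_lt with rfl | hlt
  · exact le_rfl
  refine integral_mono_ae (integrable_meanG ν p hv.le hx t) (integrable_meanG ν p hv.le hx t') ?_
  filter_upwards [meanG_subgradient ν p hv.le hx t t', meanG_subgradient ν p hv.le hx t' t]
    with ω h1 h2
  have hs : 0 < v * (2 : ℝ)⁻¹ ^ (p : ℕ) * (t' - t) :=
    mul_pos (by positivity) (sub_pos.2 hlt)
  refine le_of_mul_le_mul_left ?_ hs
  linarith

lemma varG_eq {t : ℝ} {ω : GIdx N → ℝ} (h : Regular ν v (Function.update x p t) ω) :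
    varG ν p v x t ω = (∫ z, gP ω p z * gP ω p z ∂gibbs ν v (Function.update x p t) ω)
      - meanG ν p v x t ω * meanG ν p v x t ω := by
  have := h.isProbabilityMeasure_gibbs
  have hm := Regular.measurable_gP_const ω p
  have hi : Integrable (gP ω p) (gibbs ν v (Function.update x p t) ω) :=
    integrable_of_abs_le hm (abs_gP_le ω p)
  have hi2 : Integrable (fun z => gP ω p z * gP ω p z) (gibbs ν v (Function.update x p t) ω) :=
    hi.mul_bdd (c := ∑ i : Fin (p : ℕ) → Fin N, |ω ⟨p, i⟩|) hm.aestronglyMeasurable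
      (ae_of_all _ (abs_gP_le ω p))
  set D := meanG ν p v x t ω with hD
  have hexp : ∀ z, (gP ω p z - D) ^ 2 = (gP ω p z * gP ω p z - 2 * D * gP ω p z) + D * D :=
    fun z => by ring
  have hi3 : Integrable (fun z => gP ω p z * gP ω p z - 2 * D * gP ω p z)
    (gibbs ν v (Function.update x p t) ω) := hi2.sub (hi.const_mul _)
  have hDi : ∫ z, gP ω p z ∂gibbs ν v (Function.update x p t) ω = D := rfl
  rw [varG, ← hD]
  simp_rw [hexp]
  rw [integral_add hi3 (integrable_const _),
    integral_sub hi2 (hi.const_mul _), integral_const_mul, hDi]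
  simp
  ring

/-- The variance of `g_p` under the Gibbs measure is the derivative of its mean in `x_p`. -/
lemma integral_varG {ω : GIdx N → ℝ} (h : Regular ν v (Function.update x p 0) ω) :
    IntervalIntegrable (fun t => varG ν p v x t ω) volume 0 1 ∧
    v * (2 : ℝ)⁻¹ ^ (p : ℕ) * ∫ t in (0 : ℝ)..1, varG ν p v x t ω
      = meanG ν p v x 1 ω - meanG ν p v x 0 ω := by
  have hprob := h.isProbabilityMeasure_gibbs
  have hm := Regular.measurable_gP_const ω p
  set s := v * (2 : ℝ)⁻¹ ^ (p : ℕ) with hs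
  have hgibbs : ∀ t, gibbs ν v (Function.update x p t) ω
      = (gibbs ν v (Function.update x p 0) ω).tilted fun z => s * t * gP ω p z := by
    intro t
    have := (h.update_left p t).2
    rwa [Function.update_idem, Function.update_self, sub_zero] at this
  have hreg : ∀ t, Regular ν v (Function.update x p t) ω := fun t => by
    have := (h.update_left p t).1
    rwa [Function.update_idem] at this
  have hmean : ∀ t, meanG ν p v x t ω = ∫ z, gP ω p z
      ∂(gibbs ν v (Function.update x p 0) ω).tilted fun z => s * t * gP ω p z := fun t => by
    rw [meanG, hgibbs t]
  have hsqm : ∀ t, ∫ z, gP ω p z * gP ω p z ∂gibbs ν v (Function.update x p t) ω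
      = ∫ z, gP ω p z * gP ω p z
        ∂(gibbs ν v (Function.update x p 0) ω).tilted fun z => s * t * gP ω p z := fun t => by
    rw [hgibbs t]
  have hlin : ∀ t : ℝ, HasDerivAt (fun t : ℝ => s * t) s t := fun t => by
    simpa using (hasDerivAt_id t).const_mul s
  have hsq : ∀ z, |gP ω p z * gP ω p z|
      ≤ (∑ i : Fin (p : ℕ) → Fin N, |ω ⟨p, i⟩|) * ∑ i : Fin (p : ℕ) → Fin N, |ω ⟨p, i⟩| :=
      fun z => by
    rw [abs_mul]
    exact mul_le_mul (abs_gP_le ω p z) (abs_gP_le ω p z) (abs_nonneg _)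
      ((abs_nonneg _).trans (abs_gP_le ω p z))
  have hd1 : ∀ t, HasDerivAt (fun t => meanG ν p v x t ω) (s * varG ν p v x t ω) t := by
    intro t
    have h1 := HasDerivAt.comp t (hasDerivAt_integral_tilted
      (μ := gibbs ν v (Function.update x p 0) ω) hm hm (abs_gP_le ω p) (abs_gP_le ω p) (s * t))
      (hlin t)
    rw [varG_eq ν p (hreg t)]
    simp only [hmean, hsqm]
    refine h1.congr_deriv ?_
    ring
  have hc2 : Continuous fun t => ∫ z, gP ω p z * gP ω p z ∂gibbs ν v (Function.update x p t) ω := by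
    refine continuous_iff_continuousAt.2 fun t => ?_
    have h1 := HasDerivAt.comp t (hasDerivAt_integral_tilted
      (μ := gibbs ν v (Function.update x p 0) ω) (hm.mul hm) hm hsq (abs_gP_le ω p) (s * t))
      (hlin t)
    simp only [hsqm]
    exact h1.continuousAt
  have hc : Continuous fun t => varG ν p v x t ω := by
    have hcm : Continuous fun t => meanG ν p v x t ω :=
      continuous_iff_continuousAt.2 fun t => (hd1 t).continuousAt
    simp_rw [fun t => varG_eq ν p (hreg t)]
    exact hc2.sub (hcm.mul hcm)
  refine ⟨hc.intervalIntegrable _ _, ?_⟩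
  rw [← intervalIntegral.integral_const_mul]
  exact intervalIntegral.integral_eq_sub_of_hasDerivAt (fun t _ => hd1 t)
    ((hc.const_mul s).intervalIntegrable _ _)

lemma integral_unif (h : ℝ → ℝ) : ∫ t, h t ∂unif = ∫ t in (0 : ℝ)..1, h t := by
  rw [unif, integral_Icc_eq_integral_Ioc, intervalIntegral.integral_of_le zero_le_one]

lemma integrable_unif_of_intervalIntegrable {h : ℝ → ℝ} (hi : IntervalIntegrable h volume 0 1) :
    Integrable h unif := by
  rw [intervalIntegrable_iff_integrableOn_Ioc_of_le zero_le_one] at hi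
  change IntegrableOn h (Set.Icc 0 1) volume
  rwa [integrableOn_Icc_iff_integrableOn_Ioc]

/-- Averaged over `x_p`, the thermal fluctuations of `g_p` are bounded. -/
lemma integrable_varG (hv : 0 < v) (hx : ∀ q, |x q| ≤ 1) :
    Integrable (fun q : ℝ × (GIdx N → ℝ) => varG ν p v x q.1 q.2) (unif.prod (lawG N)) ∧
      ∫ q : ℝ × (GIdx N → ℝ), varG ν p v x q.1 q.2 ∂unif.prod (lawG N) ≤ 2 := by
  have hm := measurable_varG ν p v x
  have hs : 0 < v * (2 : ℝ)⁻¹ ^ (p : ℕ) := by positivity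
  refine integrable_of_lintegral_ofReal_le hm.aestronglyMeasurable
    (fun q => varG_nonneg ν p v x q.1 q.2) zero_le_two ?_
  rw [lintegral_prod_symm _ (Measurable.aemeasurable (by fun_prop))]
  have hD : Integrable (fun ω => (v * (2 : ℝ)⁻¹ ^ (p : ℕ))⁻¹
      * (meanG ν p v x 1 ω - meanG ν p v x 0 ω)) (lawG N) :=
    ((integrable_meanG ν p hv.le hx 1).sub (integrable_meanG ν p hv.le hx 0)).const_mul _
  have key : ∀ᵐ ω ∂lawG N, ∫ t, varG ν p v x t ω ∂unif = (v * (2 : ℝ)⁻¹ ^ (p : ℕ))⁻¹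
      * (meanG ν p v x 1 ω - meanG ν p v x 0 ω) ∧
      ∫⁻ t, ENNReal.ofReal (varG ν p v x t ω) ∂unif = ENNReal.ofReal ((v * (2 : ℝ)⁻¹ ^ (p : ℕ))⁻¹
      * (meanG ν p v x 1 ω - meanG ν p v x 0 ω)) := by
    filter_upwards [ae_regular_update ν p hv.le hx 0] with ω hω
    obtain ⟨h1, h2⟩ := integral_varG ν p hω
    have h3 : ∫ t, varG ν p v x t ω ∂unif = (v * (2 : ℝ)⁻¹ ^ (p : ℕ))⁻¹
      * (meanG ν p v x 1 ω - meanG ν p v x 0 ω) := by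
      rw [integral_unif, ← h2, inv_mul_cancel_left₀ hs.ne']
    refine ⟨h3, ?_⟩
    rw [← h3, ofReal_integral_eq_lintegral_ofReal (integrable_unif_of_intervalIntegrable h1)
      (ae_of_all _ fun t => varG_nonneg ν p v x t ω)]
  rw [lintegral_congr_ae (key.mono fun ω h => h.2),
    ← ofReal_integral_eq_lintegral_ofReal hD (key.mono fun ω h => by
      simp only [Pi.zero_apply]
      rw [← h.1]; exact integral_nonneg fun t => varG_nonneg ν p v x t ω),
    integral_const_mul, integral_sub (integrable_meanG ν p hv.le hx 1)
      (integrable_meanG ν p hv.le hx 0)]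
  refine ENNReal.ofReal_le_ofReal ?_
  have h1 := (le_abs_self _).trans (abs_integral_meanG_le ν p hv.le hx 1)
  have h0 := abs_integral_meanG_le ν p hv.le hx 0
  rw [abs_zero, mul_zero, zero_mul, abs_nonpos_iff] at h0
  rw [h0, inv_mul_le_iff₀ hs]
  simpa using h1

/-- Averaged over `x_p`, the disorder fluctuations of `g_p` are small compared with `v`, for small
`y` and large `v`. They are bounded by an explicit integrable function `k` of `x_p`. -/
lemma integral_abs_meanG_sub_le (hv : 0 < v) (hx : ∀ q, |x q| ≤ 1) {y : ℝ} (hy : 0 < y)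
    (hy1 : y ≤ 1) :
    ∃ k : ℝ → ℝ, Integrable k unif ∧
      (∀ t ∈ Set.Icc (0 : ℝ) 1,
        ∫ ω, |meanG ν p v x t ω - ∫ ω', meanG ν p v x t ω' ∂lawG N| ∂lawG N ≤ k t) ∧
      ∫ t, k t ∂unif ≤ 16 * (v * (2 : ℝ)⁻¹ ^ (p : ℕ)) * y
        + 96 * v / (v * (2 : ℝ)⁻¹ ^ (p : ℕ) * y) := by
  set s := v * (2 : ℝ)⁻¹ ^ (p : ℕ) with hs
  have hs0 : 0 < s := by positivity
  set m : ℝ → ℝ := fun t => ∫ ω, meanG ν p v x t ω ∂lawG N with hm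
  have hmono : Monotone m := monotone_integral_meanG ν p hv hx
  have hint : IntervalIntegrable (fun t => m (t + y) - m (t - y)) volume 0 1 :=
    (Monotone.intervalIntegrable fun a b hab => hmono (by linarith)).sub
      (Monotone.intervalIntegrable fun a b hab => hmono (by linarith))
  refine ⟨fun t => m (t + y) - m (t - y) + 3 * (32 * v) / (s * y),
    (integrable_unif_of_intervalIntegrable hint).add (integrable_const _), ?_, ?_⟩
  · intro t ht
    refine integral_abs_sub_integral_le_of_subgradient
      (φ := fun t ω => logZ ν v (Function.update x p t) ω) hs0 hy
      (meanG_subgradient ν p hv.le hx)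
      (fun t => integrable_logZ ν hv.le (abs_update_le p hx t))
      (integrable_meanG ν p hv.le hx) ?_
    intro u hu
    have hu2 : |u| ≤ 2 := by
      have : -1 ≤ u ∧ u ≤ 2 := by
        simp only [Set.mem_insert_iff, Set.mem_singleton_iff] at hu
        rcases hu with rfl | rfl | rfl <;> constructor <;> linarith [ht.1, ht.2]
      exact abs_le.2 ⟨by linarith, this.2⟩
    -- `u` is one of `t - y`, `t`, `t + y`, so the parameters of the field are bounded by `2`
    refine (integral_abs_logZ_sub_le ν hv.le (b := 2) fun q =>
      (abs_update_le p hx u q).trans (max_le (by norm_num) hu2)).trans_eq ?_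
    ring
  · rw [integral_add (integrable_unif_of_intervalIntegrable hint) (integrable_const _),
      integral_unif]
    refine add_le_add ((intervalIntegral_shift_sub_shift_le hmono (K := 4 * s) hy.le hy1
      fun t ht => ?_).trans_eq (by ring)) (le_of_eq ?_)
    · refine (abs_integral_meanG_le ν p hv.le hx t).trans ?_
      rw [← hs]
      nlinarith
    · simp; ring

end Fluctuations

/-! ### The identities for monomials -/

/-- Replacing a function of the first replica by a constant inside a weighted replica average
costs at most its variance and the deviation of its mean. -/
lemma abs_integral_pi_mul_sub_le {E : Type*} [MeasurableSpace E] (G : Measure E)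
    [IsProbabilityMeasure G] {n : ℕ} [NeZero n] {f : (Fin n → E) → ℝ} {h : E → ℝ} {B : ℝ}
    (hf : Measurable f) (hf1 : ∀ z, |f z| ≤ 1) (hh : Measurable h) (hB : ∀ z, |h z| ≤ B) (m : ℝ) :
    |(∫ z, f z ∂(Measure.pi fun _ : Fin n => G)) * m
        - ∫ z, f z * h (z 0) ∂(Measure.pi fun _ : Fin n => G)|
      ≤ 1 + (∫ z, (h z - ∫ w, h w ∂G) ^ 2 ∂G) + |(∫ z, h z ∂G) - m| := by
  set D := ∫ z, h z ∂G
  have hhi : Integrable h G := integrable_of_abs_le hh hB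
  have hbound : ∀ z, |h z - m| ≤ (1 + (h z - D) ^ 2) + |D - m| := fun z => by
    have h1 := abs_sub_le (h z) D m
    have h2 : |h z - D| ≤ 1 + (h z - D) ^ 2 := by
      rw [← sq_abs]; nlinarith [sq_nonneg (|h z - D| - 1 / 2)]
    linarith
  have hsqi : Integrable (fun z => (h z - D) ^ 2) G := by
    refine integrable_of_abs_le (by fun_prop) (B := (B + |D|) ^ 2) fun z => ?_
    rw [abs_pow]
    gcongr
    exact (abs_sub _ _).trans (by gcongr; exact hB z)
  have i1 : Integrable (fun z => f z * m) (Measure.pi fun _ : Fin n => G) :=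
    (integrable_of_abs_le hf hf1).mul_const m
  have i2 : Integrable (fun z => f z * h (z 0)) (Measure.pi fun _ : Fin n => G) := by
    refine integrable_of_abs_le (hf.mul (hh.comp (measurable_pi_apply 0))) (B := B) fun z => ?_
    rw [abs_mul]
    exact (mul_le_mul (hf1 z) (hB _) (abs_nonneg _) zero_le_one).trans_eq (one_mul _)
  rw [← integral_mul_const, ← integral_sub i1 i2]
  have i3 : Integrable (fun z => |h z - m|) G := (hhi.sub (integrable_const _)).abs
  have i4 : Integrable (fun z : Fin n → E => |h (z 0) - m|) (Measure.pi fun _ : Fin n => G) :=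
    (measurePreserving_eval (fun _ : Fin n => G) 0).integrable_comp_of_integrable i3
  have i5 : Integrable (fun z => 1 + (h z - D) ^ 2) G := (integrable_const _).add hsqi
  calc |∫ z, (f z * m - f z * h (z 0)) ∂(Measure.pi fun _ : Fin n => G)|
      ≤ ∫ z, |h (z 0) - m| ∂(Measure.pi fun _ : Fin n => G) := by
        refine norm_integral_le_of_norm_le (f := fun z : Fin n → E => f z * m - f z * h (z 0)) i4
          (ae_of_all _ fun z => ?_)
        rw [← mul_sub, Real.norm_eq_abs, abs_mul, abs_sub_comm m]
        exact mul_le_of_le_one_left (abs_nonneg _) (hf1 z)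
    _ = ∫ z, |h z - m| ∂G :=
        integral_pi_eval G 0 (k := fun z => |h z - m|) (by fun_prop)
    _ ≤ ∫ z, ((1 + (h z - D) ^ 2) + |D - m|) ∂G :=
        integral_mono i3 (i5.add (integrable_const _)) hbound
    _ = 1 + (∫ z, (h z - D) ^ 2 ∂G) + |D - m| := by
        rw [integral_add i5 (integrable_const _), integral_add (integrable_const _) hsqi]
        simp

section Monomial

variable {N : ℕ} (ν : Measure (Sph N)) [IsProbabilityMeasure ν] {v : ℝ} {x : ℕ+ → ℝ} (p : ℕ+)
  {n : ℕ} [NeZero n] {f : (Fin n → Sph N) → ℝ}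

/-- The defect for a monomial is bounded by the thermal and the disorder fluctuations of `g_p`. -/
lemma mul_abs_ggDefect_pow_le (hv : 0 ≤ v) (hx : ∀ q, |x q| ≤ 1) {t : ℝ} (ht : 0 ≤ t)
    (hf : Measurable f) (hf1 : ∀ z, |f z| ≤ 1) (hvar : Integrable (varG ν p v x t) (lawG N)) :
    v * (2 : ℝ)⁻¹ ^ (p : ℕ) * t
        * |ggDefect ν v (Function.update x p t) n f (fun u => u ^ (p : ℕ))|
      ≤ 1 + (∫ ω, varG ν p v x t ω ∂lawG N)
        + ∫ ω, |meanG ν p v x t ω - ∫ ω', meanG ν p v x t ω' ∂lawG N| ∂lawG N := by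
  have hn : (1 : ℝ) ≤ n := Nat.one_le_cast.2 (Nat.pos_of_ne_zero (NeZero.ne n))
  set xt := Function.update x p t with hxt
  set m := ∫ ω, meanG ν p v x t ω ∂lawG N with hm
  have hid := mul_ggDefect_pow ν hv (abs_update_le p hx t) p hf hf1
  rw [Function.update_self, ← hxt] at hid
  have hmean := integrable_meanG ν p hv hx t
  have hdev : Integrable (fun ω => |meanG ν p v x t ω - m|) (lawG N) :=
    (hmean.sub (integrable_const _)).abs
  have hIf := integrable_repAvg ν v xt hf zero_le_one hf1
  have hsum : Integrable (fun ω : GIdx N → ℝ => ∑ i : Fin (p : ℕ) → Fin N, |ω ⟨p, i⟩|) (lawG N) :=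
    integrable_finsetSum _ fun i _ => (integrable_coord _).abs
  have hmg : Measurable (Function.uncurry fun (ω : GIdx N → ℝ) (z : Fin n → Sph N) =>
      f z * gP ω p (z 0)) := by
    have h0 : Measurable fun q : (GIdx N → ℝ) × (Fin n → Sph N) => (q.1, q.2 0) :=
      measurable_fst.prodMk ((measurable_pi_apply (0 : Fin n)).comp measurable_snd)
    exact (hf.comp measurable_snd).mul ((measurable_gP p).comp h0)
  have hfb : ∀ (ω : GIdx N → ℝ) (z : Fin n → Sph N),
      |f z * gP ω p (z 0)| ≤ ∑ i : Fin (p : ℕ) → Fin N, |ω ⟨p, i⟩| := fun ω z => by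
    rw [abs_mul]
    exact (mul_le_mul (hf1 z) (abs_gP_le ω p _) (abs_nonneg _) zero_le_one).trans_eq (one_mul _)
  have hIg : Integrable (fun ω => repAvg ν v xt ω (fun z => f z * gP ω p (z 0))) (lawG N) := by
    refine hsum.mono' (stronglyMeasurable_replicas ν v measurable_const measurable_id
      hmg).aestronglyMeasurable (ae_of_all _ fun ω => ?_)
    exact abs_repAvg_le ν v xt ω (Finset.sum_nonneg fun _ _ => abs_nonneg _) (hfb ω)
  have hcov : v * (2 : ℝ)⁻¹ ^ (p : ℕ) * t * n * ggDefect ν v xt n f (fun u => u ^ (p : ℕ))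
      = ∫ ω, (repAvg ν v xt ω f * m - repAvg ν v xt ω (fun z => f z * gP ω p (z 0))) ∂lawG N := by
    rw [integral_sub (hIf.mul_const m) hIg, integral_mul_const, hid]
    rfl
  have hpt : ∀ᵐ ω ∂lawG N,
      |repAvg ν v xt ω f * m - repAvg ν v xt ω (fun z => f z * gP ω p (z 0))|
        ≤ 1 + varG ν p v x t ω + |meanG ν p v x t ω - m| := by
    filter_upwards [ae_regular_update ν p hv hx t] with ω hω
    have hprob := hω.isProbabilityMeasure_gibbs
    have hgm := Regular.measurable_gP_const ω p
    exact abs_integral_pi_mul_sub_le (gibbs ν v xt ω) hf hf1 hgm (abs_gP_le ω p) m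
  have hst : 0 ≤ v * (2 : ℝ)⁻¹ ^ (p : ℕ) * t := by positivity
  have i6 : Integrable (fun ω => 1 + varG ν p v x t ω) (lawG N) := (integrable_const _).add hvar
  calc v * (2 : ℝ)⁻¹ ^ (p : ℕ) * t * |ggDefect ν v xt n f (fun u => u ^ (p : ℕ))|
      ≤ v * (2 : ℝ)⁻¹ ^ (p : ℕ) * t * (n * |ggDefect ν v xt n f (fun u => u ^ (p : ℕ))|) := by
        gcongr
        exact le_mul_of_one_le_left (abs_nonneg _) hn
    _ = |v * (2 : ℝ)⁻¹ ^ (p : ℕ) * t * n * ggDefect ν v xt n f (fun u => u ^ (p : ℕ))| := by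
        rw [abs_mul, abs_mul, abs_of_nonneg hst, abs_of_nonneg (zero_le_one.trans hn)]; ring
    _ ≤ ∫ ω, (1 + varG ν p v x t ω + |meanG ν p v x t ω - m|) ∂lawG N := by
        rw [hcov]
        exact norm_integral_le_of_norm_le (f := fun ω => repAvg ν v xt ω f * m
          - repAvg ν v xt ω (fun z => f z * gP ω p (z 0))) (i6.add hdev) hpt
    _ = _ := by
        rw [integral_add i6 hdev, integral_add (integrable_const _) hvar]
        simp

lemma abs_pow_le_one_of_mem (p : ℕ) : ∀ u ∈ Set.Icc (-1 : ℝ) 1, |u ^ p| ≤ 1 := fun u hu => by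
  rw [abs_pow]; exact pow_le_one₀ (abs_nonneg _) (abs_le.2 hu)

lemma measurable_ggDefect_update (v : ℝ) (x : ℕ+ → ℝ) (hf : Measurable f) :
    Measurable fun t => ggDefect ν v (Function.update x p t) n f (fun u => u ^ (p : ℕ)) :=
  (stronglyMeasurable_ggDefect ν v hf (continuous_pow _).measurable).measurable.comp
    (measurable_update_param p x)

lemma integral_mul_abs_ggDefect_pow_le (hv : 0 < v) (hx : ∀ q, |x q| ≤ 1) (hf : Measurable f)
    (hf1 : ∀ z, |f z| ≤ 1) {y : ℝ} (hy : 0 < y) (hy1 : y ≤ 1) :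
    ∫ t, t * |ggDefect ν v (Function.update x p t) n f (fun u => u ^ (p : ℕ))| ∂unif
      ≤ 3 * 2 ^ (p : ℕ) / v + 16 * y + 96 * 4 ^ (p : ℕ) / (v * y) := by
  set s := v * (2 : ℝ)⁻¹ ^ (p : ℕ) with hs
  have hs0 : 0 < s := by positivity
  obtain ⟨k, hk, hkle, hkint⟩ := integral_abs_meanG_sub_le ν p hv hx hy hy1
  obtain ⟨hvar, hvarle⟩ := integrable_varG ν p hv hx
  have hmem : ∀ᵐ t ∂unif, t ∈ Set.Icc (0 : ℝ) 1 := ae_restrict_mem measurableSet_Icc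
  have hi1 : Integrable (fun t => ∫ ω, varG ν p v x t ω ∂lawG N) unif := hvar.integral_prod_left
  have hi2 : Integrable (fun t => 1 + (∫ ω, varG ν p v x t ω ∂lawG N)) unif :=
    (integrable_const _).add hi1
  have hpt : ∀ᵐ t ∂unif,
      t * |ggDefect ν v (Function.update x p t) n f (fun u => u ^ (p : ℕ))|
        ≤ s⁻¹ * (1 + (∫ ω, varG ν p v x t ω ∂lawG N) + k t) := by
    filter_upwards [hmem, hvar.prod_right_ae] with t ht hvt
    rw [le_inv_mul_iff₀ hs0, ← mul_assoc]
    refine (mul_abs_ggDefect_pow_le ν p hv.le hx ht.1 hf hf1 hvt).trans ?_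
    gcongr
    exact hkle t ht
  have hleft : Integrable (fun t =>
      t * |ggDefect ν v (Function.update x p t) n f (fun u => u ^ (p : ℕ))|) unif := by
    refine Integrable.mono' (integrable_const (2 : ℝ))
      ((measurable_id.mul (measurable_ggDefect_update ν p v x hf).abs).aestronglyMeasurable)
      (hmem.mono fun t ht => ?_)
    have := abs_ggDefect_le ν v (Function.update x p t) hf1 (abs_pow_le_one_of_mem p)
    rw [Real.norm_eq_abs, abs_mul, abs_abs, abs_of_nonneg ht.1]
    nlinarith [ht.1, ht.2, abs_nonneg (ggDefect ν v (Function.update x p t) n f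
      (fun u => u ^ (p : ℕ)))]
  refine (integral_mono_ae hleft ((hi2.add hk).const_mul _) hpt).trans ?_
  rw [integral_const_mul]
  have e1 : ∫ t, ((fun t => 1 + (∫ ω, varG ν p v x t ω ∂lawG N)) + k) t ∂unif
      = 1 + (∫ q : ℝ × (GIdx N → ℝ), varG ν p v x q.1 q.2 ∂unif.prod (lawG N))
        + ∫ t, k t ∂unif := by
    rw [integral_add' hi2 hk, integral_add (integrable_const _) hi1, integral_prod _ hvar]
    simp
  calc s⁻¹ * ∫ t, ((fun t => 1 + (∫ ω, varG ν p v x t ω ∂lawG N)) + k) t ∂unif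
      ≤ s⁻¹ * (1 + 2 + (16 * s * y + 96 * v / (s * y))) := by
        rw [e1]; gcongr
    _ = 3 * 2 ^ (p : ℕ) / v + 16 * y + 96 * 4 ^ (p : ℕ) / (v * y) := by
        have h4 : (4 : ℝ) ^ (p : ℕ) = 2 ^ (p : ℕ) * 2 ^ (p : ℕ) := by
          rw [← mul_pow]; norm_num
        rw [hs, inv_pow, h4]
        field_simp
        ring

/-- The weight `t` is removed by cutting off the interval `[0, ε]`. -/
lemma integral_unif_le_of_integral_mul_le {h : ℝ → ℝ} (hm : Measurable h) (h0 : ∀ t, 0 ≤ h t)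
    (h2 : ∀ t, h t ≤ 2) {ε C : ℝ} (hε : 0 < ε) (hC : ∫ t, t * h t ∂unif ≤ C) :
    ∫ t, h t ∂unif ≤ 2 * ε + C / ε := by
  have hmem : ∀ᵐ t ∂unif, t ∈ Set.Icc (0 : ℝ) 1 := ae_restrict_mem measurableSet_Icc
  have hi : Integrable h unif := integrable_of_abs_le hm fun t => by
    rw [abs_of_nonneg (h0 t)]; exact h2 t
  have hi1 : Integrable (fun t => t * h t) unif := by
    refine Integrable.mono' (integrable_const (2 : ℝ)) (by fun_prop) (hmem.mono fun t ht => ?_)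
    rw [Real.norm_eq_abs, abs_mul, abs_of_nonneg ht.1, abs_of_nonneg (h0 t)]
    nlinarith [ht.1, ht.2, h0 t, h2 t]
  have hi2 : Integrable ((Set.Iic ε).indicator fun _ => (2 : ℝ)) unif :=
    (integrable_const _).indicator measurableSet_Iic
  have hpt : ∀ᵐ t ∂unif, h t ≤ (Set.Iic ε).indicator (fun _ => (2 : ℝ)) t + ε⁻¹ * (t * h t) := by
    filter_upwards [hmem] with t ht
    by_cases hte : t ≤ ε
    · rw [Set.indicator_of_mem (show t ∈ Set.Iic ε from hte)]
      have : 0 ≤ ε⁻¹ * (t * h t) := mul_nonneg (by positivity) (mul_nonneg ht.1 (h0 t))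
      linarith [h2 t]
    · rw [Set.indicator_of_notMem (show t ∉ Set.Iic ε from hte), zero_add, le_inv_mul_iff₀ hε]
      exact mul_le_mul_of_nonneg_right (not_le.1 hte).le (h0 t)
  refine (integral_mono_ae hi (hi2.add (hi1.const_mul _)) hpt).trans ?_
  rw [integral_add' hi2 (hi1.const_mul _), integral_const_mul, integral_indicator measurableSet_Iic,
    setIntegral_const, smul_eq_mul, mul_comm _ (2 : ℝ), div_eq_inv_mul]
  have hvol : unif.real (Set.Iic ε) ≤ ε := by
    rw [measureReal_def, unif, Measure.restrict_apply measurableSet_Iic]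
    refine ENNReal.toReal_le_of_le_ofReal hε.le ((measure_mono (t := Set.Icc 0 ε) ?_).trans_eq ?_)
    · rintro t ⟨h1, h2⟩
      exact ⟨h2.1, h1⟩
    · simp
  gcongr

lemma ae_lawX_abs_le : ∀ᵐ x ∂lawX, ∀ q, |x q| ≤ 1 := by
  rw [ae_all_iff]
  intro q
  have h := measurePreserving_eval_infinitePi (fun _ : ℕ+ => unif) q
  refine h.quasiMeasurePreserving.ae (p := fun u : ℝ => |u| ≤ 1) ?_
  filter_upwards [ae_restrict_mem (μ := volume) (measurableSet_Icc (a := (0 : ℝ)) (b := 1))]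
    with u hu
  exact abs_le.2 ⟨by linarith [hu.1], hu.2⟩

lemma integrable_abs_ggDefect {ψ : ℝ → ℝ} {B : ℝ} (v : ℝ) (hf : Measurable f)
    (hf1 : ∀ z, |f z| ≤ 1) (hψ : Measurable ψ) (hB : ∀ u ∈ Set.Icc (-1 : ℝ) 1, |ψ u| ≤ B) :
    Integrable (fun x => |ggDefect ν v x n f ψ|) lawX :=
  (integrable_of_abs_le (stronglyMeasurable_ggDefect ν v hf hψ).measurable
    fun x => abs_ggDefect_le ν v x hf1 hB).abs

/-- As `x_p` is independent of the other `x_q`, the expectation over `x` may be computed by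
resampling `x_p` first. -/
lemma integral_abs_ggDefect_pow_le (hv : 0 < v) (hf : Measurable f)
    (hf1 : ∀ z, |f z| ≤ 1) {y ε : ℝ} (hy : 0 < y) (hy1 : y ≤ 1) (hε : 0 < ε) :
    ∫ x, |ggDefect ν v x n f (fun u => u ^ (p : ℕ))| ∂lawX
      ≤ 2 * ε + (3 * 2 ^ (p : ℕ) / v + 16 * y + 96 * 4 ^ (p : ℕ) / (v * y)) / ε := by
  have hI := integrable_abs_ggDefect ν v hf hf1 (ψ := fun u => u ^ (p : ℕ)) (by fun_prop)
    (abs_pow_le_one_of_mem p)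
  have hp := measurePreserving_update (fun _ : ℕ+ => unif) p
  have hI' : Integrable (fun q : (ℕ+ → ℝ) × ℝ =>
      |ggDefect ν v (Function.update q.1 p q.2) n f (fun u => u ^ (p : ℕ))|) (lawX.prod unif) :=
    hp.integrable_comp_of_integrable hI
  have e : ∫ x, |ggDefect ν v x n f (fun u => u ^ (p : ℕ))| ∂lawX
      = ∫ x, ∫ t, |ggDefect ν v (Function.update x p t) n f (fun u => u ^ (p : ℕ))|
        ∂unif ∂lawX := by
    rw [← integral_prod _ hI']
    have h2 : lawX = (lawX.prod unif).map (fun q => Function.update q.1 p q.2) := hp.map_eq.symm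
    conv_lhs => rw [h2]
    rw [integral_map hp.measurable.aemeasurable (h2 ▸ hI.aestronglyMeasurable)]
  rw [e]
  calc ∫ x, ∫ t, |ggDefect ν v (Function.update x p t) n f (fun u => u ^ (p : ℕ))| ∂unif ∂lawX
      ≤ ∫ _, (2 * ε + (3 * 2 ^ (p : ℕ) / v + 16 * y + 96 * 4 ^ (p : ℕ) / (v * y)) / ε) ∂lawX := by
        refine integral_mono_ae hI'.integral_prod_left (integrable_const _)
          (ae_lawX_abs_le.mono fun x hx => ?_)
        refine integral_unif_le_of_integral_mul_le (measurable_ggDefect_update ν p v x hf).abs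
          (fun t => abs_nonneg _) (fun t => ?_) hε
          (integral_mul_abs_ggDefect_pow_le ν p hv hx hf hf1 hy hy1)
        simpa using abs_ggDefect_le ν v (Function.update x p t) hf1 (abs_pow_le_one_of_mem p)
    _ = _ := by simp

end Monomial

/-! ### Polynomials and continuous functions -/

section Approximation

/-- The Ghirlanda–Guerra identity for `n` replicas and the function `ψ` holds in the limit
`v → ∞`, uniformly in `N`, `ν` and `f`. -/
def AsympGG (n : ℕ) [NeZero n] (ψ : ℝ → ℝ) : Prop :=
  ∀ ε > 0, ∃ V : ℝ, ∀ v, V ≤ v → 0 ≤ v → ∀ (N : ℕ) (ν : Measure (Sph N)), IsProbabilityMeasure ν →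
    ∀ f : (Fin n → Sph N) → ℝ, Measurable f → (∀ z, |f z| ≤ 1) →
      ∫ x, |ggDefect ν v x n f ψ| ∂lawX ≤ ε

variable {n : ℕ} [NeZero n]

lemma asympGG_pow (p : ℕ+) : AsympGG n fun u => u ^ (p : ℕ) := by
  intro ε₀ hε₀
  -- with `ε` the cut-off near `x_p = 0`, each of the four terms of the bound is at most `2 * ε`
  set ε := min 1 (ε₀ / 8) with hε
  have hε0 : 0 < ε := lt_min one_pos (by positivity)
  have hε1 : ε ≤ 1 := min_le_left _ _
  have hε8 : ε ≤ ε₀ / 8 := min_le_right _ _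
  set y := ε ^ 2 / 16 with hy
  have hy0 : 0 < y := by positivity
  have hy1 : y ≤ 1 := by rw [hy]; nlinarith
  refine ⟨max 1 (max (3 * 2 ^ (p : ℕ) / ε ^ 2) (96 * 4 ^ (p : ℕ) / (y * ε ^ 2))),
    fun v hV _ N ν hν f hf hf1 => ?_⟩
  have hv1 : 1 ≤ v := (le_max_left _ _).trans hV
  have hv : 0 < v := by linarith
  have h1 : 3 * 2 ^ (p : ℕ) / v ≤ ε ^ 2 := by
    have := ((le_max_left _ _).trans (le_max_right _ _)).trans hV
    rw [div_le_iff₀ (by positivity)] at this ⊢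
    linarith
  have h2 : 96 * 4 ^ (p : ℕ) / (v * y) ≤ ε ^ 2 := by
    have := ((le_max_right _ _).trans (le_max_right _ _)).trans hV
    rw [div_le_iff₀ (by positivity)] at this ⊢
    linarith
  refine (integral_abs_ggDefect_pow_le ν p hv hf hf1 hy0 hy1 hε0).trans ?_
  have h3 : (3 * 2 ^ (p : ℕ) / v + 16 * y + 96 * 4 ^ (p : ℕ) / (v * y)) / ε ≤ 3 * ε := by
    rw [div_le_iff₀ hε0]
    have : 16 * y = ε ^ 2 := by rw [hy]; ring
    nlinarith
  linarith

lemma asympGG_one : AsympGG n fun _ => 1 := by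
  intro ε hε
  refine ⟨0, fun v _ hv N ν hν f _ _ => ?_⟩
  rw [integral_congr_ae (g := fun _ => (0 : ℝ)) (ae_lawX_abs_le.mono fun x hx => ?_)]
  · simpa using hε.le
  · simp only [ggDefect_one ν hv hx, abs_zero]

lemma AsympGG.const_mul {ψ : ℝ → ℝ} (h : AsympGG n ψ) (c : ℝ) : AsympGG n fun u => c * ψ u := by
  intro ε hε
  obtain ⟨V, hV⟩ := h (ε / (|c| + 1)) (by positivity)
  refine ⟨V, fun v hv hv0 N ν hν f hf hf1 => ?_⟩
  simp_rw [ggDefect_const_mul, abs_mul]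
  rw [integral_const_mul]
  refine (mul_le_mul_of_nonneg_left (hV v hv hv0 N ν hν f hf hf1) (abs_nonneg c)).trans ?_
  rw [mul_div_assoc', div_le_iff₀ (by positivity)]
  nlinarith [abs_nonneg c]

lemma AsympGG.add {ψ χ : ℝ → ℝ} (hψ : AsympGG n ψ) (hχ : AsympGG n χ) (hψc : Continuous ψ)
    (hχc : Continuous χ) : AsympGG n fun u => ψ u + χ u := by
  intro ε hε
  obtain ⟨V, hV⟩ := hψ (ε / 2) (by positivity)
  obtain ⟨W, hW⟩ := hχ (ε / 2) (by positivity)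
  obtain ⟨B, hB⟩ := (isCompact_Icc (a := (-1 : ℝ)) (b := 1)).exists_bound_of_continuousOn
    hψc.continuousOn
  obtain ⟨C, hC⟩ := (isCompact_Icc (a := (-1 : ℝ)) (b := 1)).exists_bound_of_continuousOn
    hχc.continuousOn
  refine ⟨max V W, fun v hv hv0 N ν hν f hf hf1 => ?_⟩
  have i1 := integrable_abs_ggDefect ν v hf hf1 hψc.measurable hB
  have i2 := integrable_abs_ggDefect ν v hf hf1 hχc.measurable hC
  simp_rw [ggDefect_add ν v _ hf hf1 hψc.measurable hχc.measurable hB hC]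
  have h1 := hV v ((le_max_left _ _).trans hv) hv0 N ν hν f hf hf1
  have h2 := hW v ((le_max_right _ _).trans hv) hv0 N ν hν f hf hf1
  refine (integral_mono_of_nonneg (ae_of_all _ fun _ => abs_nonneg _) (i1.add i2)
    (ae_of_all _ fun x => abs_add_le _ _)).trans ?_
  rw [integral_add' i1 i2]
  linarith

lemma asympGG_polynomial (P : Polynomial ℝ) : AsympGG n fun u => P.eval u := by
  induction P using Polynomial.induction_on' with
  | add P Q hP hQ =>
    simp_rw [Polynomial.eval_add]
    exact hP.add hQ P.continuous Q.continuous
  | monomial k a =>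
    simp_rw [Polynomial.eval_monomial]
    rcases Nat.eq_zero_or_pos k with rfl | hk
    · simpa using (asympGG_one (n := n)).const_mul a
    · exact (asympGG_pow (n := n) ⟨k, hk⟩).const_mul a

lemma asympGG_of_continuous {ψ : ℝ → ℝ} (hψ : Continuous ψ) : AsympGG n ψ := by
  intro ε hε
  obtain ⟨P, hP⟩ := exists_polynomial_near_of_continuousOn (-1) 1 ψ hψ.continuousOn (ε / 4)
    (by positivity)
  obtain ⟨V, hV⟩ := asympGG_polynomial (n := n) P (ε / 2) (by positivity)
  refine ⟨V, fun v hv hv0 N ν hν f hf hf1 => ?_⟩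
  have hPm : Measurable fun u => P.eval u := P.continuous.measurable
  obtain ⟨B, hB⟩ := (isCompact_Icc (a := (-1 : ℝ)) (b := 1)).exists_bound_of_continuousOn
    P.continuous.continuousOn
  have hdiff : ∀ u ∈ Set.Icc (-1 : ℝ) 1, |ψ u - P.eval u| ≤ ε / 4 := fun u hu => by
    rw [abs_sub_comm]; exact (hP u hu).le
  have hsm : Measurable fun u => ψ u - P.eval u := hψ.measurable.sub hPm
  have hsplit : ∀ x, ggDefect ν v x n f ψ = ggDefect ν v x n f (fun u => P.eval u)
      + ggDefect ν v x n f (fun u => ψ u - P.eval u) := fun x => by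
    rw [← ggDefect_add ν v x hf hf1 hPm (χ := fun u => ψ u - P.eval u) hsm hB hdiff]
    simp
  have i1 := integrable_abs_ggDefect ν v hf hf1 hPm hB
  have h1 := hV v hv hv0 N ν hν f hf hf1
  calc ∫ x, |ggDefect ν v x n f ψ| ∂lawX
      ≤ ∫ x, (|ggDefect ν v x n f (fun u => P.eval u)| + ε / 2) ∂lawX := by
        refine integral_mono_of_nonneg (ae_of_all _ fun _ => abs_nonneg _)
          (i1.add (integrable_const _)) (ae_of_all _ fun x => ?_)
        have h2 := abs_ggDefect_le ν v x hf1 hdiff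
        simp only [hsplit]
        exact (abs_add_le _ _).trans (by linarith)
    _ ≤ ε := by
        rw [integral_add i1 (integrable_const _)]
        simp
        linarith

lemma ggDefect_congr {N : ℕ} (ν : Measure (Sph N)) (v : ℝ) (x : ℕ+ → ℝ)
    (f : (Fin n → Sph N) → ℝ) {ψ χ : ℝ → ℝ} (h : ∀ u ∈ Set.Icc (-1 : ℝ) 1, ψ u = χ u) :
    ggDefect ν v x n f ψ = ggDefect ν v x n f χ := by
  have h' : ∀ z w : Sph N, ψ (overlap z w) = χ (overlap z w) := fun z w =>
    h _ (abs_le.1 (abs_overlap_le_one z w))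
  unfold ggDefect
  simp_rw [h']

end Approximation

end GG

theorem theorem2 (n : ℕ) [NeZero n] (ψ : ℝ → ℝ) (hψ : ContinuousOn ψ (Set.Icc (-1) 1)) :
    ∃ δ : ℝ → ℝ, Tendsto δ atTop (𝓝 0) ∧
      ∀ v : ℝ, 0 ≤ v → ∀ (N : ℕ) (ν : Measure (GG.Sph N)), IsProbabilityMeasure ν →
        ∀ f : (Fin n → GG.Sph N) → ℝ, Measurable f → (∀ z, |f z| ≤ 1) →
          Integrable (fun x => |GG.ggDefect ν v x n f ψ|) GG.lawX ∧
          ∫ x, |GG.ggDefect ν v x n f ψ| ∂GG.lawX ≤ δ v := by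
  have hle : (-1 : ℝ) ≤ 1 := by norm_num
  -- overlaps lie in `[-1, 1]`, so `ψ` may be replaced by a continuous extension
  set χ : ℝ → ℝ := Set.IccExtend hle (Set.domRestrict (Set.Icc (-1) 1) ψ) with hχ
  have hχc : Continuous χ := hψ.domRestrict.Icc_extend'
  have hψχ : ∀ u ∈ Set.Icc (-1 : ℝ) 1, ψ u = χ u := fun u hu => by
    rw [hχ, Set.IccExtend_of_mem hle _ hu]; rfl
  obtain ⟨B, hB⟩ := (isCompact_Icc (a := (-1 : ℝ)) (b := 1)).exists_bound_of_continuousOn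
    hχc.continuousOn
  -- the smallest admissible `δ`: the supremum of the left-hand side over all `N`, `ν` and `f`
  set A : ℝ → Set ℝ := fun v => {r | ∃ (N : ℕ) (ν : Measure (GG.Sph N)),
    IsProbabilityMeasure ν ∧ ∃ f : (Fin n → GG.Sph N) → ℝ, Measurable f ∧ (∀ z, |f z| ≤ 1) ∧
      r = ∫ x, |GG.ggDefect ν v x n f χ| ∂GG.lawX} with hA
  refine ⟨fun v => sSup (A v), ?_, fun v hv N ν hν f hf hf1 => ?_⟩
  · rw [Metric.tendsto_atTop]
    intro ε hε
    obtain ⟨V, hV⟩ := GG.asympGG_of_continuous (n := n) hχc (ε / 2) (by positivity)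
    refine ⟨max V 0, fun v hv => ?_⟩
    have h0 : 0 ≤ sSup (A v) := Real.sSup_nonneg fun r hr => by
      obtain ⟨N, ν, _, f, _, _, rfl⟩ := hr
      exact integral_nonneg fun _ => abs_nonneg _
    have h1 : sSup (A v) ≤ ε / 2 := Real.sSup_le (fun r hr => by
      obtain ⟨N, ν, hν, f, hf, hf1, rfl⟩ := hr
      exact hV v ((le_max_left _ _).trans hv) ((le_max_right _ _).trans hv) N ν hν f hf hf1)
      (by positivity)
    rw [Real.dist_eq, sub_zero, abs_of_nonneg h0]
    linarith
  · simp_rw [fun x => GG.ggDefect_congr (n := n) ν v x f hψχ]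
    refine ⟨GG.integrable_abs_ggDefect ν v hf hf1 hχc.measurable hB, ?_⟩
    refine le_csSup ⟨2 * B, ?_⟩ ⟨N, ν, hν, f, hf, hf1, rfl⟩
    rintro r ⟨N, ν, hν, f, hf, hf1, rfl⟩
    refine (le_abs_self _).trans (GG.abs_integral_le_of_abs_le fun x => ?_)
    rw [abs_abs]
    exact GG.abs_ggDefect_le ν v x hf1 hB
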